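/- Notation. For $k\in\mathbb Z^n$ let $|k|$ be its Euclidean length, and for multi-indices $k^\gamma=k_1^{\gamma_1}\cdots k_n^{\gamma_n}$, $|\alpha|=\alpha_1+\dots+\alpha_n$. Put $\Delta_{k_j}f(k)=f(k+e_j)-f(k)$, $\Delta_k^\alpha=\Delta_{k_1}^{\alpha_1}\cdots\Delta_{k_n}^{\alpha_n}$, $D_{x_j}=\frac1{2\pi i}\partial_{x_j}$, $D_{x_j}^{(\ell)}=\prod_{r=0}^{\ell-1}(D_{x_j}-r)$ (so $D_{x_j}^{(0)}=I$), and $D_x^{(\beta)}=D_{x_1}^{(\beta_1)}\cdots D_{x_n}^{(\beta_n)}$. The torus $\mathbb T^n=(\mathbb R/\mathbb Z)^n$ carries its Haar probability measure $dx$. Let $0<\mu_0\le\mu_1\le\mu$ and let $\Lambda:\mathbb Z^n\to\mathbb R$ be a weight function with these exponents: there are $C_0,C_1>0$ with $C_0(1+|k|)^{\mu_0}\le\Lambda(k)\le C_1(1+|k|)^{\mu_1}$ for all $k$, and for all $\alpha\in\mathbb N_0^n$, $\gamma\in\{0,1\}^n$ there is $C_{\alpha,\gamma}>0$ with $|k^\gamma\Delta_k^{\alpha+\gamma}\Lambda(k)|\le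 C_{\alpha,\gamma}\Lambda(k)^{1-|\alpha|/\mu}$ for all $k$. Let $0<\rho\le 1/\mu$. For $m\in\mathbb R$ let $S^m_{\rho,\Lambda}$ be the set of all $\sigma:\mathbb Z^n\times\mathbb T^n\to\mathbb C$, smooth in $x$, such that for all $\alpha,\beta\in\mathbb N_0^n$ there is $C_{\alpha,\beta}>0$ with $|D_x^{(\beta)}\Delta_k^\alpha\sigma(k,x)|\le C_{\alpha,\beta}\Lambda(k)^{m-\rho|\alpha|}$ for all $(k,x)$. Let $M^m_{\rho,\Lambda}$ be the set of all $\sigma$, smooth in $x$, such that $k^\gamma\Delta_k^\gamma\sigma\in S^m_{\rho,\Lambda}$ for all $\gamma\in\{0,1\}^n$. A symbol $\sigma\in M^0_{\rho,\Lambda}$ is $M$-elliptic if there are $C,R>0$ with $|\sigma(k,x)|\ge C$ for all $x\in\mathbb T^n$ and all $|k|\ge R$. The Schwartz space $\mathcal S(\mathbb Z^n\times\mathbb T^n)$ is the set of all $\sigma$, smooth in $x$, with $\sup_{k,x}|k^\alpha D_x^{(\beta)}\Delta_k^{\delta}\sigma(k,x)|<\infty$ for all multi-indices $\alpha,\beta,\delta$.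 The pseudo-differential operator with symbol $\sigma$ is $(T_\sigma f)(k)=\int_{\mathbb T^n}e^{2\pi i k\cdot x}\sigma(k,x)\widehat f(x)\,dx$ for $f\in\ell^2(\mathbb Z^n)$, where $\widehat f(x)=\sum_{k}e^{-2\pi i k\cdot x}f(k)$ in $L^2(\mathbb T^n)$. A bounded operator $T$ is Fredholm if its range is closed and the null spaces $N(T)$ and $N(T^t)$ of $T$ and of its true adjoint $T^t$ are finite dimensional; its index is $i(T)=\dim N(T)-\dim N(T^t)$. **Theorem.** Let $\sigma\in M^0_{\rho,\Lambda}$ be $M$-elliptic. Then $T_\sigma$ is a bounded Fredholm operator on $\ell^2(\mathbb Z^n)$, and the following holds. (a) There are $\tau\in M^0_{\rho,\Lambda}$ and $\tau_1,\tau_2\in\bigcap_{m\in\mathbb R}M^m_{\rho,\Lambda}$ for which $T_\tau$, $T_1=T_{\tau_1}$, $T_2=T_{\tau_2}$ are bounded on $\ell^2(\mathbb Z^n)$ and $$T_\tau T_\sigma=I-T_1,\qquad T_\sigma T_\tau=I-T_2 .\qquad(*)$$ (b) For all $\tau\in M^0_{\rho,\Lambda}$ and $\tau_1,\tau_2\in\bigcap_{m\in\mathbb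 R}M^m_{\rho,\Lambda}$ whose operators $T_\tau$, $T_1=T_{\tau_1}$, $T_2=T_{\tau_2}$ are bounded on $\ell^2(\mathbb Z^n)$ and satisfy $(*)$: the symbols $\tau_1,\tau_2$ belong to $\mathcal S(\mathbb Z^n\times\mathbb T^n)$, the operators $T_1,T_2$ are trace class on $\ell^2(\mathbb Z^n)$, $$\operatorname{Tr}(T_j)=\sum_{k\in\mathbb Z^n}\int_{\mathbb T^n}\tau_j(k,x)\,dx\quad(j=1,2),$$ and $$i(T_\sigma)=\operatorname{Tr}(T_1)-\operatorname{Tr}(T_2)=\sum_{k\in\mathbb Z^n}\int_{\mathbb T^n}\bigl(\tau_1(k,x)-\tau_2(k,x)\bigr)\,dx ,$$ where all series over $\mathbb Z^n$ converge unconditionally. -/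

import Mathlib

namespace LatticePDO

open scoped ContDiff InnerProductSpace
open MeasureTheory

noncomputable section

/-! ### Differences on the lattice -/

/-- The Euclidean length `|k|` of a lattice point. -/
def latticeNorm {n : ℕ} (k : Fin n → ℤ) : ℝ :=
  Real.sqrt (∑ i, (k i : ℝ) ^ 2)

/-- The length `|α| = α₁ + ⋯ + αₙ` of a multi-index. -/
def order {n : ℕ} (α : Fin n → ℕ) : ℕ := ∑ i, α i

/-- The forward difference `Δ^α = Δ₁^{α₁} ⋯ Δₙ^{αₙ}` of a function on `ℤⁿ`, where
`Δⱼ f (k) = f (k + eⱼ) - f k`. -/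
def latticeDiff {n : ℕ} {G : Type*} [AddCommGroup G] (α : Fin n → ℕ)
    (f : (Fin n → ℤ) → G) : (Fin n → ℤ) → G :=
  (List.finRange n).foldr (fun j g => (fwdDiff (Pi.single j (1 : ℤ)))^[α j] g) f

/-- Weight functions on `ℤⁿ` with exponents `0 < μ₀ ≤ μ₁ ≤ μ`. The multi-index `γ` runs through
`{0,1}ⁿ`. -/
structure IsWeight {n : ℕ} (μ₀ μ₁ μ : ℝ) (Λ : (Fin n → ℤ) → ℝ) : Prop where
  pos : 0 < μ₀
  le_mid : μ₀ ≤ μ₁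
  le_top : μ₁ ≤ μ
  growth : ∃ C₀ C₁ : ℝ, 0 < C₀ ∧ 0 < C₁ ∧ ∀ k,
    C₀ * (1 + latticeNorm k) ^ μ₀ ≤ Λ k ∧ Λ k ≤ C₁ * (1 + latticeNorm k) ^ μ₁
  diff_bound : ∀ α γ : Fin n → ℕ, (∀ i, γ i ≤ 1) → ∃ C : ℝ, 0 < C ∧ ∀ k,
    |(∏ i, (k i : ℝ) ^ γ i) * latticeDiff (α + γ) Λ k|
      ≤ C * Λ k ^ (1 - (1 / μ) * (order α : ℝ))

/-! ### Derivatives on the torus -/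

/-- Smoothness of a function on `𝕋ⁿ = (ℝ/ℤ)ⁿ`: its periodic lift to `ℝⁿ` is smooth. -/
def SmoothOnTorus {n : ℕ} (f : UnitAddTorus (Fin n) → ℂ) : Prop :=
  ContDiff ℝ ∞ (fun x : Fin n → ℝ => f (fun i => (x i : UnitAddCircle)))

/-- `D_{xⱼ} = (1 / 2πi) ∂/∂xⱼ`. -/
def torusD {n : ℕ} (j : Fin n) (f : UnitAddTorus (Fin n) → ℂ) : UnitAddTorus (Fin n) → ℂ :=
  fun x => 1 / (2 * (Real.pi : ℂ) * Complex.I) *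
    deriv (fun t : ℝ => f (x + Pi.single j (t : UnitAddCircle))) 0

/-- `D_{xⱼ}^{(ℓ)} = D_{xⱼ} (D_{xⱼ} - 1) ⋯ (D_{xⱼ} - (ℓ - 1))`, with `D_{xⱼ}^{(0)}` the identity. -/
def torusDFalling {n : ℕ} (j : Fin n) :
    ℕ → (UnitAddTorus (Fin n) → ℂ) → (UnitAddTorus (Fin n) → ℂ)
  | 0, f => f
  | ℓ + 1, f => fun x =>
      torusD j (torusDFalling j ℓ f) x - (ℓ : ℂ) * torusDFalling j ℓ f x

/-- `D_x^{(β)} = D_{x₁}^{(β₁)} ⋯ D_{xₙ}^{(βₙ)}`. -/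
def torusDMulti {n : ℕ} (β : Fin n → ℕ) (f : UnitAddTorus (Fin n) → ℂ) :
    UnitAddTorus (Fin n) → ℂ :=
  (List.finRange n).foldr (fun j g => torusDFalling j (β j) g) f

/-! ### Symbol classes -/

/-- The class `S^m_{ρ,Λ}(ℤⁿ × 𝕋ⁿ)`. -/
def IsSSymbol {n : ℕ} (ρ : ℝ) (Λ : (Fin n → ℤ) → ℝ) (m : ℝ)
    (σ : (Fin n → ℤ) → UnitAddTorus (Fin n) → ℂ) : Prop :=
  (∀ k, SmoothOnTorus (σ k)) ∧
  ∀ α β : Fin n → ℕ, ∃ C : ℝ, 0 < C ∧ ∀ k x,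
    ‖torusDMulti β (latticeDiff α σ k) x‖ ≤ C * Λ k ^ (m - ρ * (order α : ℝ))

/-- The class `M^m_{ρ,Λ}(ℤⁿ × 𝕋ⁿ)`: for every `γ ∈ {0,1}ⁿ`, `k^γ Δ_k^γ σ` is in `S^m_{ρ,Λ}`. -/
def IsMSymbol {n : ℕ} (ρ : ℝ) (Λ : (Fin n → ℤ) → ℝ) (m : ℝ)
    (σ : (Fin n → ℤ) → UnitAddTorus (Fin n) → ℂ) : Prop :=
  (∀ k, SmoothOnTorus (σ k)) ∧
  ∀ γ : Fin n → ℕ, (∀ i, γ i ≤ 1) →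
    IsSSymbol ρ Λ m (fun k x => (∏ i, (k i : ℂ) ^ γ i) * latticeDiff γ σ k x)

/-- `M`-ellipticity of a symbol of order `m`. -/
def IsMElliptic {n : ℕ} (Λ : (Fin n → ℤ) → ℝ) (m : ℝ)
    (σ : (Fin n → ℤ) → UnitAddTorus (Fin n) → ℂ) : Prop :=
  ∃ C R : ℝ, 0 < C ∧ 0 < R ∧ ∀ k x, R ≤ latticeNorm k → C * Λ k ^ m ≤ ‖σ k x‖

/-- The Schwartz space `𝒮(ℤⁿ × 𝕋ⁿ)`. -/
def IsSchwartz {n : ℕ} (σ : (Fin n → ℤ) → UnitAddTorus (Fin n) → ℂ) : Prop :=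
  (∀ k, SmoothOnTorus (σ k)) ∧
  ∀ α β δ : Fin n → ℕ, ∃ C : ℝ, ∀ k x,
    ‖(∏ i, (k i : ℂ) ^ α i) * torusDMulti β (latticeDiff δ σ k) x‖ ≤ C

/-! ### Pseudo-differential operators -/

/-- The Hilbert space `ℓ²(ℤⁿ)`. -/
abbrev EllTwo (n : ℕ) : Type := lp (fun _ : Fin n → ℤ => ℂ) 2

/-- The Haar probability measure on `𝕋ⁿ`. -/
def torusMeasure (n : ℕ) : Measure (UnitAddTorus (Fin n)) :=
  Measure.pi fun _ => AddCircle.haarAddCircle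

/-- The Fourier transform `f̂ (x) = ∑ₖ f(k) e^{-2πi k·x}` of `f ∈ ℓ²(ℤⁿ)`; the sum is taken
in `L²(𝕋ⁿ)`. -/
def fourierLattice {n : ℕ} (f : EllTwo n) : Lp ℂ 2 (torusMeasure n) :=
  ∑' k : Fin n → ℤ, f k • (UnitAddTorus.mFourierLp 2 (-k) : Lp ℂ 2 (torusMeasure n))

/-- The series that defines the Fourier transform converges for every `f ∈ ℓ²(ℤⁿ)`. -/
theorem summable_fourierLattice {n : ℕ} (f : EllTwo n) :
    Summable fun k : Fin n → ℤ =>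
      f k • (UnitAddTorus.mFourierLp 2 (-k) : Lp ℂ 2 (torusMeasure n)) :=
  ((UnitAddTorus.orthonormal_mFourier (d := Fin n)).comp (fun k => -k)
    neg_injective).orthogonalFamily.summable_of_lp f

/-- `(T_σ f)(k) = ∫_{𝕋ⁿ} e^{2πi k·x} σ(k,x) f̂(x) dx`. -/
def pseudoDiff {n : ℕ} (σ : (Fin n → ℤ) → UnitAddTorus (Fin n) → ℂ) (f : EllTwo n)
    (k : Fin n → ℤ) : ℂ :=
  ∫ x, UnitAddTorus.mFourier k x * σ k x * fourierLattice f x ∂torusMeasure n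

/-- The bounded operator `T` on `ℓ²(ℤⁿ)` is the pseudo-differential operator with symbol `σ`. -/
def IsPseudoDiffOp {n : ℕ} (σ : (Fin n → ℤ) → UnitAddTorus (Fin n) → ℂ)
    (T : EllTwo n →L[ℂ] EllTwo n) : Prop :=
  ∀ f k, T f k = pseudoDiff σ f k

/-! ### Fredholm and trace class operators -/

section Operators

variable {X Y : Type*} [NormedAddCommGroup X] [NormedSpace ℂ X]
  [NormedAddCommGroup Y] [NormedSpace ℂ Y]

/-- The true adjoint `Tᵗ : Y' → X'`, `y' ↦ y' ∘ T`, between the dual spaces. -/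
def trueAdjoint (T : X →L[ℂ] Y) : StrongDual ℂ Y →L[ℂ] StrongDual ℂ X :=
  ContinuousLinearMap.precomp ℂ T

/-- A bounded operator is Fredholm if its range is closed and the null spaces of the operator and
of its true adjoint are finite dimensional. -/
structure IsFredholm (T : X →L[ℂ] Y) : Prop where
  isClosed_range : IsClosed (Set.range T)
  finite_ker : FiniteDimensional ℂ (LinearMap.ker (T : X →ₗ[ℂ] Y))
  finite_ker_adjoint : FiniteDimensional ℂ
    (LinearMap.ker (trueAdjoint T : StrongDual ℂ Y →ₗ[ℂ] StrongDual ℂ X))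

/-- The index `dim N(T) - dim N(Tᵗ)` of a Fredholm operator. -/
def fredholmIndex (T : X →L[ℂ] Y) : ℤ :=
  (Module.finrank ℂ (LinearMap.ker (T : X →ₗ[ℂ] Y)) : ℤ) -
    (Module.finrank ℂ
      (LinearMap.ker (trueAdjoint T : StrongDual ℂ Y →ₗ[ℂ] StrongDual ℂ X)) : ℤ)

end Operators

section Trace

universe u

variable {H : Type u} [NormedAddCommGroup H] [InnerProductSpace ℂ H]

/-- Trace class operators on a Hilbert space: `T = ∑ᵢ ⟨aᵢ, ·⟩ bᵢ` with `∑ᵢ ‖aᵢ‖ ‖bᵢ‖ < ∞`. -/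
def IsTraceClass (T : H →L[ℂ] H) : Prop :=
  ∃ a b : ℕ → H, Summable (fun i => ‖a i‖ * ‖b i‖) ∧
    ∀ v, HasSum (fun i => ⟪a i, v⟫_ℂ • b i) (T v)

/-- `Tr T = t`: in every orthonormal basis `e` the series `∑ᵢ ⟨eᵢ, T eᵢ⟩` converges
unconditionally to `t`. -/
def HasTrace (T : H →L[ℂ] H) (t : ℂ) : Prop :=
  ∀ (ι : Type u) (e : HilbertBasis ι ℂ H), HasSum (fun i => ⟪e i, T (e i)⟫_ℂ) t

end Trace

/-! ### Parametrices -/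

/-- `τ ∈ M^0_{ρ,Λ}` and `τ₁, τ₂ ∈ ⋂ₘ M^m_{ρ,Λ}` are the symbols of the bounded operators
`B, T₁, T₂` on `ℓ²(ℤⁿ)`, and `B A = I - T₁`, `A B = I - T₂`. -/
structure IsParametrix {n : ℕ} (ρ : ℝ) (Λ : (Fin n → ℤ) → ℝ) (A : EllTwo n →L[ℂ] EllTwo n)
    (τ τ₁ τ₂ : (Fin n → ℤ) → UnitAddTorus (Fin n) → ℂ)
    (B T₁ T₂ : EllTwo n →L[ℂ] EllTwo n) : Prop where
  symbol : IsMSymbol ρ Λ 0 τ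
  symbol_left : ∀ m : ℝ, IsMSymbol ρ Λ m τ₁
  symbol_right : ∀ m : ℝ, IsMSymbol ρ Λ m τ₂
  op : IsPseudoDiffOp τ B
  op_left : IsPseudoDiffOp τ₁ T₁
  op_right : IsPseudoDiffOp τ₂ T₂
  left_eq : B ∘L A = ContinuousLinearMap.id ℂ (EllTwo n) - T₁
  right_eq : A ∘L B = ContinuousLinearMap.id ℂ (EllTwo n) - T₂

end

end LatticePDO

open LatticePDO

/-! With a(k,p) the Fourier coefficients of σ(k,·), the operator is T_σ f(k) = ∑ₚ a(k,p) f(k+p)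
(`hasSum_pseudoDiff`, `isPseudoDiffOp_iff`). Smoothness in x is rapid decay in p, so the whole
calculus is carried out on coefficients, with no asymptotic expansion of symbols. Membership in M⁰
means that Δ^α a is O(`symbolGain` α) with rapid decay in p (`rapidDecay_symbolGain_iff`): each
coordinate with α_j > 0 gains Λ^{-ρ} per difference, one of these gains being improved to the
minimum of Λ^{-ρ} and (1+|k_j|)⁻¹. These weights are submultiplicative and vary at most polynomially
under translations (`IsWeight.slowlyVarying`), and rapid decay in p absorbs polynomial factors.
Hence the class is closed under products of operators and under pointwise products of symbols, both
instances of `coefMul`, and the two products differ by a gain of Λ^{-ρ} (`RapidDecay.coefMul_sub`).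

For an elliptic σ, replace σ by 1 on a bounded set of k; this changes T_σ by a smoothing operator.
The reciprocal of the new symbol lies in the class (`diffDecay_symbolCoeff_inv`) and inverts the
operator up to R = O(Λ^{-ρ}). Since Λ tends to infinity, deleting the rows of R in a bounded set of
k makes its norm less than 1, again with a smoothing error. The exact inverse G of 1 - R is in the
class because G = F + R^N F + R^N G R^N with F = ∑_{i<N} R^i, and the last term decays as fast as
desired for large N, G being merely bounded (`isSymbolicOp_of_inverse`). This yields a parametrix
with smoothing remainders.

A smoothing operator is nuclear through T = ∑ ⟨e_l, ·⟩ T e_l, with trace ∑ a(k,0) = ∑ ∫ τ(k,x) dx.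
Invertibility modulo nuclear operators gives Fredholmness (`isFredholm_of_nuclear`). For the index,
compare B with a pseudoinverse B' for which 1 - B'A = P and 1 - AB' = Q are orthogonal projections
of rank dim N(A) and dim N(Aᵗ). Then T₁ = P + B'T₂A - PBA and T₂ = Q + AB'T₂. By cyclicity Tr(B'T₂A)
= Tr(AB'T₂), and Tr(PBA) = Tr(BAP) = 0 since AP = 0; subtracting the traces gives the index
(`fredholmIndex_eq_of_nuclear`). -/

namespace LatticePDO

open scoped ContDiff InnerProductSpace
open MeasureTheory Filter Topology

noncomputable section

/-! ### Traces of nuclear operators and the index -/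

section NuclearTrace

universe u

variable {H : Type u} [NormedAddCommGroup H] [InnerProductSpace ℂ H]

/-- `T = ∑ᵢ ⟨aᵢ, ·⟩ bᵢ` with `∑ᵢ ‖aᵢ‖ ‖bᵢ‖ < ∞` and `∑ᵢ ⟨aᵢ, bᵢ⟩ = t`. -/
def HasNuclearTrace (T : H →L[ℂ] H) (t : ℂ) : Prop :=
  ∃ (κ : Type) (a b : κ → H), Summable (fun i => ‖a i‖ * ‖b i‖) ∧
    (∀ v, HasSum (fun i => ⟪a i, v⟫_ℂ • b i) (T v)) ∧ HasSum (fun i => ⟪a i, b i⟫_ℂ) t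

theorem summable_inner_of_summable_norm {κ : Type*} {a b : κ → H}
    (h : Summable fun i => ‖a i‖ * ‖b i‖) : Summable fun i => ⟪a i, b i⟫_ℂ :=
  .of_norm_bounded h fun _ => norm_inner_le_norm _ _

/-- Bessel and Cauchy–Schwarz. Uniformity in the finite set makes the double series over a nuclear
representation and an orthonormal basis absolutely summable. -/
theorem Orthonormal.sum_norm_inner_mul_inner_le {ι : Type*} {e : ι → H} (he : Orthonormal ℂ e)
    (x y : H) (s : Finset ι) : ∑ i ∈ s, ‖⟪x, e i⟫_ℂ * ⟪e i, y⟫_ℂ‖ ≤ ‖x‖ * ‖y‖ := by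
  have hx := he.sum_inner_products_le (s := s) x
  have hy := he.sum_inner_products_le (s := s) y
  have hcs := Finset.sum_mul_sq_le_sq_mul_sq s (fun i => ‖⟪e i, x⟫_ℂ‖) (fun i => ‖⟪e i, y⟫_ℂ‖)
  have : ∑ i ∈ s, ‖⟪x, e i⟫_ℂ * ⟪e i, y⟫_ℂ‖ = ∑ i ∈ s, ‖⟪e i, x⟫_ℂ‖ * ‖⟪e i, y⟫_ℂ‖ :=
    Finset.sum_congr rfl fun i _ => by rw [norm_mul, norm_inner_symm]
  rw [this]
  refine abs_le_of_sq_le_sq' (hcs.trans ?_) (by positivity) |>.2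
  rw [mul_pow]
  gcongr

/-- Fubini for ⟨aᵢ, eⱼ⟩⟨eⱼ, bᵢ⟩: summing over j first is Parseval and gives ∑ ⟨aᵢ, bᵢ⟩, summing over
i first gives the diagonal of T. In particular the number t does not depend on the nuclear
representation. -/
theorem HasNuclearTrace.hasTrace {T : H →L[ℂ] H} {t : ℂ} (h : HasNuclearTrace T t) :
    HasTrace T t := by
  obtain ⟨κ, a, b, hab, hT, ht⟩ := h
  intro ι e
  set F : κ × ι → ℂ := fun p => ⟪a p.1, e p.2⟫_ℂ * ⟪e p.2, b p.1⟫_ℂ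
  have hle := fun i => Orthonormal.sum_norm_inner_mul_inner_le e.orthonormal (a i) (b i)
  have hF : Summable F := by
    refine Summable.of_norm ((summable_prod_of_nonneg fun _ => norm_nonneg _).2 ⟨fun i => ?_, ?_⟩)
    · exact summable_of_sum_le (fun _ => norm_nonneg _) (hle i)
    · refine .of_nonneg_of_le (fun i => tsum_nonneg fun _ => norm_nonneg _) (fun i => ?_) hab
      exact Real.tsum_le_of_sum_le (fun _ => norm_nonneg _) (hle i)
  have h1 : HasSum F t := by
    have := hF.hasSum.prod_fiberwise fun i => e.hasSum_inner_mul_inner (a i) (b i)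
    rw [ht.unique this]
    exact hF.hasSum
  have h2 : HasSum (fun p : ι × κ => F p.swap) t := (Equiv.prodComm ι κ).hasSum_iff.2 h1
  refine h2.prod_fiberwise fun j => ?_
  have := (hT (e j)).mapL (innerSL ℂ (e j))
  simpa [F, Function.comp_def, inner_smul_right] using this

/-- Cyclicity of the trace. The factor X falls on bᵢ in one product and its adjoint on aᵢ in the
other, and ⟨aᵢ, X bᵢ⟩ = ⟨X* aᵢ, bᵢ⟩ term by term, so one number s serves both. -/
theorem HasNuclearTrace.exists_comp [CompleteSpace H] {T : H →L[ℂ] H} {t : ℂ}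
    (h : HasNuclearTrace T t) (X : H →L[ℂ] H) :
    ∃ s, HasNuclearTrace (X ∘L T) s ∧ HasNuclearTrace (T ∘L X) s := by
  obtain ⟨κ, a, b, hab, hT, -⟩ := h
  have h1 : Summable fun i => ‖a i‖ * ‖X (b i)‖ := by
    refine .of_nonneg_of_le (fun _ => by positivity) (fun i => ?_) (hab.mul_left ‖X‖)
    calc _ ≤ ‖a i‖ * (‖X‖ * ‖b i‖) := by gcongr; exact X.le_opNorm _
      _ = _ := by ring
  have h2 : Summable fun i => ‖X.adjoint (a i)‖ * ‖b i‖ := by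
    refine .of_nonneg_of_le (fun _ => by positivity) (fun i => ?_) (hab.mul_left ‖X.adjoint‖)
    calc _ ≤ (‖X.adjoint‖ * ‖a i‖) * ‖b i‖ := by gcongr; exact X.adjoint.le_opNorm _
      _ = _ := by ring
  refine ⟨∑' i, ⟪a i, X (b i)⟫_ℂ, ⟨κ, a, fun i => X (b i), h1, fun v => ?_,
    (summable_inner_of_summable_norm h1).hasSum⟩,
    ⟨κ, fun i => X.adjoint (a i), b, h2, fun v => ?_, ?_⟩⟩
  · simpa using (hT v).mapL X
  · simpa [ContinuousLinearMap.adjoint_inner_left] using hT (X v)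
  · simpa [ContinuousLinearMap.adjoint_inner_left] using
      (summable_inner_of_summable_norm h1).hasSum

theorem isTraceClass_of_countable {κ : Type*} [Countable κ] {T : H →L[ℂ] H} {a b : κ → H}
    (hab : Summable fun i => ‖a i‖ * ‖b i‖) (hT : ∀ v, HasSum (fun i => ⟪a i, v⟫_ℂ • b i) (T v)) :
    IsTraceClass T := by
  obtain ⟨f, hf⟩ := exists_injective_nat κ
  have hz : ∀ j ∉ Set.range f, Function.extend f a 0 j = 0 := fun j hj =>
    Function.extend_apply' _ _ _ hj
  refine ⟨Function.extend f a 0, Function.extend f b 0, ?_, fun v => ?_⟩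
  · refine (hf.summable_iff fun j hj => by simp [hz j hj]).1 ?_
    simpa [Function.comp_def, hf.extend_apply] using hab
  · refine (hf.hasSum_iff fun j hj => by simp [hz j hj]).1 ?_
    simpa [Function.comp_def, hf.extend_apply] using hT v

/-- The tail of the nuclear series is bounded in operator norm by the tail of ∑ ‖aᵢ‖ ‖bᵢ‖. -/
theorem HasNuclearTrace.exists_finiteRange_norm_sub_lt [CompleteSpace H] {T : H →L[ℂ] H} {t : ℂ}
    (h : HasNuclearTrace T t) {ε : ℝ} (hε : 0 < ε) :
    ∃ F : H →L[ℂ] H, (F : H →ₗ[ℂ] H).HasFiniteRange ∧ ‖T - F‖ < ε := by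
  obtain ⟨κ, a, b, hab, hT, -⟩ := h
  obtain ⟨s, hs⟩ := ((tendsto_order.1 (tendsto_tsum_compl_atTop_zero
    fun i => ‖a i‖ * ‖b i‖)).2 ε hε).exists
  refine ⟨∑ i ∈ s, (innerSL ℂ (a i)).smulRight (b i), ?_, lt_of_le_of_lt ?_ hs⟩
  · rw [ContinuousLinearMap.toLinearMap_sum]
    refine Finset.sum_induction _ LinearMap.HasFiniteRange (fun _ _ => .add) .zero fun i _ => ?_
    have : (((innerSL ℂ (a i)).smulRight (b i) : H →L[ℂ] H) : H →ₗ[ℂ] H) =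
      (LinearMap.toSpanSingleton ℂ H (b i)) ∘ₗ (innerSL ℂ (a i) : H →ₗ[ℂ] ℂ) := by
      ext; simp
    rw [this]
    exact LinearMap.HasFiniteRange.comp_right .of_finite_dom _
  · refine ContinuousLinearMap.opNorm_le_bound _ (tsum_nonneg fun _ => by positivity) fun v => ?_
    have h1 : HasSum (fun i : {i // i ∉ s} => ⟪a i, v⟫_ℂ • b i)
        (T v - ∑ i ∈ s, ⟪a i, v⟫_ℂ • b i) := by
      refine (s.hasSum_compl_iff (f := fun i => ⟪a i, v⟫_ℂ • b i)).2 ?_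
      simpa using hT v
    have h2 : Summable fun i : {i // i ∉ s} => ‖a i‖ * ‖b i‖ := hab.subtype _
    have := tsum_of_norm_bounded (h2.hasSum.mul_right ‖v‖) (f := fun i : {i // i ∉ s} =>
      ⟪a i, v⟫_ℂ • b i) fun i => by
        rw [norm_smul]
        calc _ ≤ (‖a i‖ * ‖v‖) * ‖b i‖ := by gcongr; exact norm_inner_le_norm _ _
          _ = _ := by ring
    rw [h1.tsum_eq] at this
    simpa using this

theorem hasNuclearTrace_starProjection (K : Submodule ℂ H) [FiniteDimensional ℂ K] :
    HasNuclearTrace K.starProjection (Module.finrank ℂ K) := by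
  let e := stdOrthonormalBasis ℂ K
  refine ⟨Fin (Module.finrank ℂ K), fun i => e i, fun i => e i, Summable.of_finite, fun v => ?_, ?_⟩
  · have := e.sum_repr (K.orthogonalProjectionOnto v)
    have h2 := hasSum_fintype fun i => ⟪(e i : H), v⟫_ℂ • (e i : H)
    convert h2 using 1
    conv_lhs => rw [Submodule.starProjection_apply, ← this]
    simp [OrthonormalBasis.repr_apply_apply]
  · have h2 := hasSum_fintype fun i => ⟪(e i : H), e i⟫_ℂ
    convert h2 using 1
    have : ∀ i, ‖(e i : H)‖ = 1 := e.orthonormal.1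
    simp [inner_self_eq_norm_sq_to_K, this]

/-! ### Fredholm operators as operators invertible modulo nuclear operators. -/

open LinearMap LinearMap.FiniteRangeSetoid in
/-- An operator with a two-sided inverse modulo nuclear operators is Fredholm. -/
theorem isFredholm_of_nuclear [CompleteSpace H] {A B T₁ T₂ : H →L[ℂ] H} {t₁ t₂ : ℂ}
    (h₁ : HasNuclearTrace T₁ t₁) (h₂ : HasNuclearTrace T₂ t₂)
    (hl : B ∘L A = ContinuousLinearMap.id ℂ H - T₁)
    (hr : A ∘L B = ContinuousLinearMap.id ℂ H - T₂) :
    ContinuousLinearMap.IsFredholm A := by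
  obtain ⟨F₁, hF₁, hn₁⟩ := h₁.exists_finiteRange_norm_sub_lt one_pos
  obtain ⟨F₂, hF₂, hn₂⟩ := h₂.exists_finiteRange_norm_sub_lt one_pos
  -- Up to finite rank the remainders have norm less than 1, so 1 - (Tᵢ - Fᵢ) is invertible.
  -- Multiplying by its inverse turns B into a left and a right inverse of A modulo finite rank.
  let u₁ := Units.oneSub (T₁ - F₁) hn₁
  let u₂ := Units.oneSub (T₂ - F₂) hn₂
  set U₁ : H →L[ℂ] H := ↑(u₁⁻¹) with hU₁
  set U₂ : H →L[ℂ] H := ↑(u₂⁻¹) with hU₂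
  have e₁ : U₁ * (1 - (T₁ - F₁)) = 1 := u₁.inv_mul
  have e₂ : (1 - (T₂ - F₂)) * U₂ = 1 := u₂.mul_inv
  have hl' : (U₁ * B) * A = 1 - U₁ * F₁ := by
    have : B * A = 1 - T₁ := hl
    have e : U₁ * (1 - T₁) = U₁ * (1 - (T₁ - F₁)) - U₁ * F₁ := by noncomm_ring
    rw [mul_assoc, this, e, e₁]
  have hr' : A * (B * U₂) = 1 - F₂ * U₂ := by
    have : A * B = 1 - T₂ := hr
    have e : (1 - T₂) * U₂ = (1 - (T₂ - F₂)) * U₂ - F₂ * U₂ := by noncomm_ring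
    rw [← mul_assoc, this, e, e₂]
  have fl : ((U₁ * F₁ : H →L[ℂ] H) : H →ₗ[ℂ] H).HasFiniteRange := hF₁.comp_left (U₁ : H →ₗ[ℂ] H)
  have fr : ((F₂ * U₂ : H →L[ℂ] H) : H →ₗ[ℂ] H).HasFiniteRange := hF₂.comp_right (U₂ : H →ₗ[ℂ] H)
  -- The left quasi-inverse U₁B and the right quasi-inverse BU₂ agree modulo finite rank, by
  -- evaluating U₁B · A · BU₂ in two ways. Hence U₁B is two-sided.
  have key : A * (U₁ * B) = 1 - (F₂ * U₂ + (A * ((U₁ * F₁) * (B * U₂)) - A * ((U₁ * B) * (F₂ * U₂)))) := by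
    have : U₁ * B = B * U₂ - (U₁ * F₁) * (B * U₂) + (U₁ * B) * (F₂ * U₂) := by
      calc U₁ * B = (U₁ * B) * (A * (B * U₂) + F₂ * U₂) := by rw [hr']; simp
        _ = ((U₁ * B) * A) * (B * U₂) + (U₁ * B) * (F₂ * U₂) := by noncomm_ring
        _ = _ := by rw [hl']; noncomm_ring
    calc A * (U₁ * B) = A * (B * U₂) - A * ((U₁ * F₁) * (B * U₂)) + A * ((U₁ * B) * (F₂ * U₂)) := by
          conv_lhs => rw [this]
          noncomm_ring
      _ = _ := by rw [hr']; noncomm_ring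
  refine ContinuousLinearMap.IsFredholm.of_isQuasiInverse (v := U₁ * B) ⟨?_, ?_⟩
  · refine equiv_iff_hasFiniteRange.2 ?_
    have : ((U₁ * B : H →L[ℂ] H) : H →ₗ[ℂ] H) ∘ₗ (A : H →ₗ[ℂ] H) - LinearMap.id =
        -((U₁ * F₁ : H →L[ℂ] H) : H →ₗ[ℂ] H) := by
      ext v
      have := DFunLike.congr_fun hl' v
      simp at this
      simp [this]
    rw [this]
    exact fl.neg
  · refine equiv_iff_hasFiniteRange.2 ?_
    have : (A : H →ₗ[ℂ] H) ∘ₗ ((U₁ * B : H →L[ℂ] H) : H →ₗ[ℂ] H) - LinearMap.id =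
        -((F₂ * U₂ + (A * ((U₁ * F₁) * (B * U₂)) - A * ((U₁ * B) * (F₂ * U₂))) : H →L[ℂ] H) :
          H →ₗ[ℂ] H) := by
      ext v
      have := DFunLike.congr_fun key v
      simp only [_root_.sub_apply, one_apply_eq_self] at this
      change (A * (U₁ * B)) v - v = -(_ : H →L[ℂ] H) v
      rw [this]
      abel
    rw [this]
    refine (fr.add (HasFiniteRange.sub ?_ ?_)).neg
    · exact (fl.comp_right ((B * U₂ : H →L[ℂ] H) : H →ₗ[ℂ] H)).comp_left (A : H →ₗ[ℂ] H)
    · exact (fr.comp_left ((U₁ * B : H →L[ℂ] H) : H →ₗ[ℂ] H)).comp_left (A : H →ₗ[ℂ] H)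

/-- The kernel of the true adjoint is the orthogonal complement of the range. -/
def kerTrueAdjointEquiv [CompleteSpace H] (A : H →L[ℂ] H) :
    (LinearMap.range (A : H →ₗ[ℂ] H))ᗮ ≃+
      LinearMap.ker (trueAdjoint A : StrongDual ℂ H →ₗ[ℂ] StrongDual ℂ H) where
  toFun x := ⟨InnerProductSpace.toDual ℂ H x, by
    ext v
    exact Submodule.inner_left_of_mem_orthogonal (LinearMap.mem_range_self _ v) x.2⟩
  invFun f := ⟨(InnerProductSpace.toDual ℂ H).symm f, by
    rintro _ ⟨v, rfl⟩
    rw [inner_eq_zero_symm, InnerProductSpace.toDual_symm_apply]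
    exact DFunLike.congr_fun f.2 v⟩
  left_inv x := by simp
  right_inv f := by simp
  map_add' x y := by ext; simp

theorem kerTrueAdjointEquiv_smul [CompleteSpace H] (A : H →L[ℂ] H) (c : ℂ)
    (x : (LinearMap.range (A : H →ₗ[ℂ] H))ᗮ) :
    kerTrueAdjointEquiv A (c • x) = starRingEnd ℂ c • kerTrueAdjointEquiv A x := by
  ext v
  simp [kerTrueAdjointEquiv, inner_smul_left]

/-- The Riesz map is conjugate linear, so it is no ℂ-linear equivalence; an additive equivalence
that is semilinear over a bijection of the scalars still preserves the rank. -/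
theorem rank_kerTrueAdjoint [CompleteSpace H] (A : H →L[ℂ] H) :
    Module.rank ℂ (LinearMap.range (A : H →ₗ[ℂ] H))ᗮ =
      Module.rank ℂ (LinearMap.ker (trueAdjoint A : StrongDual ℂ H →ₗ[ℂ] StrongDual ℂ H)) :=
  rank_eq_of_equiv_equiv (starRingEnd ℂ) (kerTrueAdjointEquiv A)
    (Function.Involutive.bijective Complex.conj_conj) (kerTrueAdjointEquiv_smul A)

theorem hasOrthogonalProjection_range [CompleteSpace H] {A : H →L[ℂ] H}
    (h : ContinuousLinearMap.IsFredholm A) :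
    (LinearMap.range (A : H →ₗ[ℂ] H)).HasOrthogonalProjection :=
  have : CompleteSpace (LinearMap.range (A : H →ₗ[ℂ] H)) := h.isClosed_range.completeSpace_coe
  inferInstance

theorem finiteDimensional_range_orthogonal [CompleteSpace H] {A : H →L[ℂ] H}
    (h : ContinuousLinearMap.IsFredholm A) :
    FiniteDimensional ℂ (LinearMap.range (A : H →ₗ[ℂ] H))ᗮ :=
  have := hasOrthogonalProjection_range h
  .of_fg (h.finite_coker.fg_of_isCompl (Submodule.isCompl_orthogonal _))

theorem isFredholm_of_mathlib [CompleteSpace H] {A : H →L[ℂ] H}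
    (h : ContinuousLinearMap.IsFredholm A) : IsFredholm A where
  isClosed_range := h.isClosed_range
  finite_ker := h.finite_ker
  finite_ker_adjoint := by
    have := finiteDimensional_range_orthogonal h
    have hf := Module.Free.of_divisionRing ℂ
      (LinearMap.ker (trueAdjoint A : StrongDual ℂ H →ₗ[ℂ] StrongDual ℂ H))
    exact Module.rank_lt_aleph0_iff.1 (rank_kerTrueAdjoint A ▸ Module.rank_lt_aleph0_iff.2 this)

theorem fredholmIndex_eq [CompleteSpace H] (A : H →L[ℂ] H) :
    fredholmIndex A = (Module.finrank ℂ (LinearMap.ker (A : H →ₗ[ℂ] H)) : ℤ) -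
      Module.finrank ℂ (LinearMap.range (A : H →ₗ[ℂ] H))ᗮ := by
  rw [fredholmIndex, Module.finrank, Module.finrank, ← rank_kerTrueAdjoint]
  rfl

/-- A Fredholm operator has an inverse modulo the orthogonal projections to its kernel and to the
complement of its range. -/
theorem exists_pseudoinverse [CompleteSpace H] {A : H →L[ℂ] H}
    (h : ContinuousLinearMap.IsFredholm A) : ∃ (B P Q : H →L[ℂ] H),
      B ∘L A = ContinuousLinearMap.id ℂ H - P ∧ A ∘L B = ContinuousLinearMap.id ℂ H - Q ∧
      A ∘L P = 0 ∧
      HasNuclearTrace P (Module.finrank ℂ (LinearMap.ker (A : H →ₗ[ℂ] H))) ∧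
      HasNuclearTrace Q (Module.finrank ℂ (LinearMap.range (A : H →ₗ[ℂ] H))ᗮ) := by
  have := hasOrthogonalProjection_range h
  have := finiteDimensional_range_orthogonal h
  have := h.finite_ker
  let pkg := h.fredholmPackage
    (Submodule.isTopCompl_orthogonal (LinearMap.ker (A : H →ₗ[ℂ] H)))
    (Submodule.isTopCompl_orthogonal (LinearMap.range (A : H →ₗ[ℂ] H)))
  have hA : ∀ x, A x = pkg.equiv (pkg.decDom.proj x) := fun x => DFunLike.congr_fun pkg.eq_equiv x
  have hproj : ∀ (K : Submodule ℂ H) [K.HasOrthogonalProjection] (h' : Submodule.IsTopCompl Kᗮ K)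
      (x : H), (Kᗮ.projectionOntoL K h' x : H) = x - K.starProjection x := fun K _ h' x =>
    Submodule.projectionL_eq_self_sub_projectionL (Submodule.isTopCompl_orthogonal K) x
  refine ⟨pkg.quasiInverse, (LinearMap.ker (A : H →ₗ[ℂ] H)).starProjection,
    (LinearMap.range (A : H →ₗ[ℂ] H))ᗮ.starProjection, ?_, ?_, ?_,
    hasNuclearTrace_starProjection _, hasNuclearTrace_starProjection _⟩
  · ext x
    have : pkg.quasiInverse (A x) = pkg.decDom.proj x := by
      simp only [ContinuousLinearMap.FredholmPackage.quasiInverse, ContinuousLinearMap.comp_apply,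
        hA x]
      simp
    simp only [ContinuousLinearMap.comp_apply, this]
    exact hproj _ _ x
  · ext x
    have : A (pkg.quasiInverse x) = pkg.decCodom.proj x := by
      rw [hA]
      simp [ContinuousLinearMap.FredholmPackage.quasiInverse]
    simp only [ContinuousLinearMap.comp_apply, this]
    rw [Submodule.starProjection_orthogonal]
    simp
    rfl
  · ext x
    exact (Submodule.starProjection_apply_mem (LinearMap.ker (A : H →ₗ[ℂ] H)) x)

theorem HasTrace.add {S T : H →L[ℂ] H} {s t : ℂ} (hS : HasTrace S s) (hT : HasTrace T t) :
    HasTrace (S + T) (s + t) := fun ι e => by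
  simpa [inner_add_right] using (hS ι e).add (hT ι e)

theorem HasTrace.sub {S T : H →L[ℂ] H} {s t : ℂ} (hS : HasTrace S s) (hT : HasTrace T t) :
    HasTrace (S - T) (s - t) := fun ι e => by
  simpa [inner_sub_right] using (hS ι e).sub (hT ι e)

theorem HasTrace.unique [CompleteSpace H] {T : H →L[ℂ] H} {s t : ℂ} (hs : HasTrace T s)
    (ht : HasTrace T t) : s = t := by
  obtain ⟨w, e, -⟩ := exists_hilbertBasis ℂ H
  exact (hs w e).unique (ht w e)

/-- The index of an operator with an inverse modulo nuclear operators. -/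
theorem fredholmIndex_eq_of_nuclear [CompleteSpace H] {A B T₁ T₂ : H →L[ℂ] H} {t₁ t₂ : ℂ}
    (h₁ : HasNuclearTrace T₁ t₁) (h₂ : HasNuclearTrace T₂ t₂)
    (hl : B ∘L A = ContinuousLinearMap.id ℂ H - T₁)
    (hr : A ∘L B = ContinuousLinearMap.id ℂ H - T₂) : (fredholmIndex A : ℂ) = t₁ - t₂ := by
  have hA := isFredholm_of_nuclear h₁ h₂ hl hr
  obtain ⟨B', P, Q, hP, hQ, hAP, tP, tQ⟩ := exists_pseudoinverse hA
  obtain ⟨s, -, hs⟩ := tP.exists_comp (B ∘L A)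
  obtain ⟨s0, h0, h0'⟩ := tP.exists_comp (B ∘L A)
  -- The number s0 is the trace of both BA·P and P·BA, and the first operator vanishes because A P =
  -- 0.
  have e0 : (B ∘L A) ∘L P = 0 := by rw [ContinuousLinearMap.comp_assoc, hAP]; simp
  have z : s0 = 0 := by
    rw [e0] at h0
    refine h0.hasTrace.unique fun ι e => ?_
    simp
  rw [z] at h0'
  -- Here r is the common trace of A·(B'T₂) and (B'T₂)·A. It cancels in the difference of the two
  -- traces below.
  obtain ⟨r0, hr0, -⟩ := h₂.exists_comp B'
  obtain ⟨r, hr1, hr2⟩ := hr0.exists_comp A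
  change B * A = 1 - T₁ at hl
  change A * B = 1 - T₂ at hr
  change B' * A = 1 - P at hP
  change A * B' = 1 - Q at hQ
  have E1 : T₁ = P + (B' ∘L T₂) ∘L A - P ∘L (B ∘L A) := by
    change T₁ = P + (B' * T₂) * A - P * (B * A)
    have a1 : T₁ = 1 - B * A := by rw [hl]; abel
    have a2 : T₂ = 1 - A * B := by rw [hr]; abel
    have a3 : P = 1 - B' * A := by rw [hP]; abel
    rw [a1, a2, a3]
    noncomm_ring
  have E2 : T₂ = Q + A ∘L (B' ∘L T₂) := by
    change T₂ = Q + A * (B' * T₂)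
    rw [← mul_assoc, hQ]
    have a2 : T₂ = 1 - A * B := by rw [hr]; abel
    have a4 : Q * A = 0 := by
      have : Q = 1 - A * B' := by rw [hQ]; abel
      rw [this, sub_mul, mul_assoc, hP, mul_sub, show A * P = 0 from hAP]
      simp
    have : Q * T₂ = Q := by rw [a2, mul_sub, ← mul_assoc, a4]; simp
    rw [sub_mul, this]
    simp
  have F1 := h₁.hasTrace.unique (E1 ▸ (tP.hasTrace.add hr2.hasTrace).sub h0'.hasTrace)
  have F2 := h₂.hasTrace.unique (t := (Module.finrank ℂ (LinearMap.range (A : H →ₗ[ℂ] H))ᗮ : ℂ) + r)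
    (by rw [E2]; exact tQ.hasTrace.add hr1.hasTrace)
  rw [fredholmIndex_eq, F1, F2]
  push_cast
  ring

end NuclearTrace

/-! ### Multi-index differences -/

section Differences

variable {n : ℕ} {G G' : Type*} [AddCommGroup G] [AddCommGroup G']

/-- Induction by unit vectors reduces statements on Δ^α to a single forward difference. -/
theorem multiindex_induction {P : (Fin n → ℕ) → Prop} (h0 : P 0)
    (h1 : ∀ α j, P α → P (α + Pi.single j 1)) (α : Fin n → ℕ) : P α := by
  induction hs : order α generalizing α with
  | zero =>
    have : α = 0 := by
      ext j
      simpa [order] using Finset.sum_eq_zero_iff.1 hs j (Finset.mem_univ j)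
    exact this ▸ h0
  | succ s ih =>
    obtain ⟨j, -, hj⟩ : ∃ j ∈ Finset.univ, α j ≠ 0 := by
      by_contra! h
      simp [order, Finset.sum_eq_zero h] at hs
    have hα : α = (α - Pi.single j 1) + Pi.single j 1 := by
      ext i
      rcases eq_or_ne i j with rfl | h
      · simp; omega
      · simp [h]
    rw [hα]
    refine h1 _ _ (ih _ ?_)
    have := congrArg order hα
    simp only [order, Pi.add_apply, Finset.sum_add_distrib] at this hs ⊢
    rw [Finset.sum_pi_single'] at this
    simp at this
    simp only [Pi.sub_apply] at *
    omega

theorem order_zero : order (0 : Fin n → ℕ) = 0 := by simp [order]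

theorem order_add (α β : Fin n → ℕ) : order (α + β) = order α + order β := by
  simp [order, Finset.sum_add_distrib]

theorem order_single (j : Fin n) (s : ℕ) : order (Pi.single j s) = s := by
  simp [order]

theorem fwdDiff_comm (a b : Fin n → ℤ) (f : (Fin n → ℤ) → G) :
    fwdDiff a (fwdDiff b f) = fwdDiff b (fwdDiff a f) := by
  ext k
  simp only [fwdDiff, add_right_comm k a b]
  abel

theorem fwdDiff_iterate_comm (a b : Fin n → ℤ) (m : ℕ) (f : (Fin n → ℤ) → G) :
    fwdDiff a ((fwdDiff b)^[m] f) = (fwdDiff b)^[m] (fwdDiff a f) :=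
  (Function.Commute.iterate_right (f := fwdDiff a) (g := fwdDiff b) (fwdDiff_comm a b) m) f

theorem latticeDiff_zero (f : (Fin n → ℤ) → G) : latticeDiff 0 f = f := by
  unfold latticeDiff
  induction List.finRange n with
  | nil => rfl
  | cons i l ih => simp

theorem fwdDiff_foldr (α : Fin n → ℕ) (a : Fin n → ℤ) (l : List (Fin n)) (f : (Fin n → ℤ) → G) :
    fwdDiff a (l.foldr (fun j g => (fwdDiff (Pi.single j (1 : ℤ)))^[α j] g) f) =
      l.foldr (fun j g => (fwdDiff (Pi.single j (1 : ℤ)))^[α j] g) (fwdDiff a f) := by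
  induction l with
  | nil => rfl
  | cons i l ih => rw [List.foldr_cons, fwdDiff_iterate_comm, ih, List.foldr_cons]

theorem fwdDiff_latticeDiff (α : Fin n → ℕ) (a : Fin n → ℤ) (f : (Fin n → ℤ) → G) :
    fwdDiff a (latticeDiff α f) = latticeDiff α (fwdDiff a f) :=
  fwdDiff_foldr α a _ f

theorem latticeDiff_add_single (α : Fin n → ℕ) (j : Fin n) (f : (Fin n → ℤ) → G) :
    latticeDiff (α + Pi.single j 1) f = latticeDiff α (fwdDiff (Pi.single j 1) f) := by
  -- Over an arbitrary list the additional difference is applied once for each occurrence of j, and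
  -- all differences commute. The list of all indices contains j exactly once.
  have key : ∀ l : List (Fin n),
      l.foldr (fun i g => (fwdDiff (Pi.single i (1 : ℤ)))^[(α + Pi.single j 1 : Fin n → ℕ) i] g) f =
      l.foldr (fun i g => (fwdDiff (Pi.single i (1 : ℤ)))^[α i] g)
        ((fwdDiff (Pi.single j 1))^[l.count j] f) := by
    intro l
    induction l with
    | nil => rfl
    | cons i l ih =>
      rw [List.foldr_cons, ih, List.foldr_cons]
      rcases eq_or_ne i j with rfl | h
      · rw [List.count_cons_self, Function.iterate_succ_apply', ← fwdDiff_foldr,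
          ← Function.iterate_succ_apply]
        simp
      · rw [List.count_cons_of_ne h]
        simp [h]
  have := key (List.finRange n)
  rw [List.count_eq_one_of_mem (List.nodup_finRange n) (List.mem_finRange j)] at this
  exact this

theorem latticeDiff_add_single' (α : Fin n → ℕ) (j : Fin n) (f : (Fin n → ℤ) → G) :
    latticeDiff (α + Pi.single j 1) f = fwdDiff (Pi.single j 1) (latticeDiff α f) := by
  rw [latticeDiff_add_single, fwdDiff_latticeDiff]

theorem latticeDiff_single (j : Fin n) (f : (Fin n → ℤ) → G) :
    latticeDiff (Pi.single j 1) f = fwdDiff (Pi.single j 1) f := by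
  simpa [latticeDiff_zero] using latticeDiff_add_single 0 j f

theorem latticeDiff_map (φ : G →+ G') (α : Fin n → ℕ) (f : (Fin n → ℤ) → G) (k : Fin n → ℤ) :
    latticeDiff α (fun k => φ (f k)) k = φ (latticeDiff α f k) := by
  induction α using multiindex_induction generalizing f with
  | h0 => simp [latticeDiff_zero]
  | h1 α j ih =>
    rw [latticeDiff_add_single, latticeDiff_add_single, ← ih]
    congr 1
    ext k
    simp [fwdDiff]

theorem latticeDiff_add (α : Fin n → ℕ) (f g : (Fin n → ℤ) → G) :
    latticeDiff α (f + g) = latticeDiff α f + latticeDiff α g := by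
  induction α using multiindex_induction generalizing f g with
  | h0 => simp [latticeDiff_zero]
  | h1 α j ih => rw [latticeDiff_add_single, fwdDiff_add, ih]; simp [latticeDiff_add_single]

theorem latticeDiff_neg (α : Fin n → ℕ) (f : (Fin n → ℤ) → G) :
    latticeDiff α (-f) = -latticeDiff α f := by
  ext k
  exact latticeDiff_map (-AddMonoidHom.id G) α f k

theorem latticeDiff_sub (α : Fin n → ℕ) (f g : (Fin n → ℤ) → G) :
    latticeDiff α (f - g) = latticeDiff α f - latticeDiff α g := by
  rw [sub_eq_add_neg, latticeDiff_add, latticeDiff_neg, sub_eq_add_neg]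

theorem latticeDiff_translate (α : Fin n → ℕ) (f : (Fin n → ℤ) → G) (q k : Fin n → ℤ) :
    latticeDiff α (fun k => f (k + q)) k = latticeDiff α f (k + q) := by
  induction α using multiindex_induction generalizing f with
  | h0 => simp [latticeDiff_zero]
  | h1 α j ih =>
    rw [latticeDiff_add_single, latticeDiff_add_single, ← ih]
    congr 1
    ext k
    simp [fwdDiff, add_right_comm k q]

end Differences

/-! ### Slowly varying weights -/

section Weights

variable {n : ℕ}

/-- `1 + |p₁| + ⋯ + |pₙ|`. -/
def bracket (p : Fin n → ℤ) : ℝ := 1 + ∑ j, |(p j : ℝ)|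

theorem one_le_bracket (p : Fin n → ℤ) : 1 ≤ bracket p :=
  le_add_of_nonneg_right (Finset.sum_nonneg fun _ _ => abs_nonneg _)

theorem bracket_pos (p : Fin n → ℤ) : 0 < bracket p := one_pos.trans_le (one_le_bracket p)

theorem abs_le_bracket (p : Fin n → ℤ) (j : Fin n) : 1 + |(p j : ℝ)| ≤ bracket p := by
  unfold bracket
  gcongr
  exact Finset.single_le_sum (f := fun j => |(p j : ℝ)|) (fun _ _ => abs_nonneg _)
    (Finset.mem_univ j)

theorem bracket_neg (p : Fin n → ℤ) : bracket (-p) = bracket p := by simp [bracket]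

theorem bracket_zero : bracket (0 : Fin n → ℤ) = 1 := by simp [bracket]

/-- Submultiplicativity lets decay in p compensate for a translation from k to k + p, and splits
decay in r into decay in p and in r - p. -/
theorem bracket_add_le (p q : Fin n → ℤ) : bracket (p + q) ≤ bracket p * bracket q := by
  have : ∑ j, |((p + q) j : ℝ)| ≤ ∑ j, |(p j : ℝ)| + ∑ j, |(q j : ℝ)| := by
    rw [← Finset.sum_add_distrib]
    exact Finset.sum_le_sum fun j _ => by simpa using abs_add_le (p j : ℝ) (q j)
  have h1 : 0 ≤ ∑ j, |(p j : ℝ)| := Finset.sum_nonneg fun _ _ => abs_nonneg _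
  have h2 : 0 ≤ ∑ j, |(q j : ℝ)| := Finset.sum_nonneg fun _ _ => abs_nonneg _
  unfold bracket
  nlinarith [mul_nonneg h1 h2]

theorem bracket_le_mul (p q : Fin n → ℤ) : bracket p ≤ bracket q * bracket (p - q) := by
  simpa using bracket_add_le q (p - q)

theorem summable_prod_apply {f : ℤ → ℝ} (hf : Summable f) (h0 : ∀ i, 0 ≤ f i) :
    Summable fun p : Fin n → ℤ => ∏ j, f (p j) := by
  refine summable_of_sum_le (c := ∏ _j : Fin n, ∑' i, f i)
    (fun p => Finset.prod_nonneg fun _ _ => h0 _) fun s => ?_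
  classical
  calc ∑ p ∈ s, ∏ j, f (p j)
      ≤ ∑ p ∈ Fintype.piFinset fun j => s.image fun p => p j, ∏ j, f (p j) := by
        refine Finset.sum_le_sum_of_subset_of_nonneg (fun p hp => ?_)
          fun p _ _ => Finset.prod_nonneg fun _ _ => h0 _
        exact Fintype.mem_piFinset.2 fun j => Finset.mem_image_of_mem _ hp
    _ = ∏ j, ∑ i ∈ s.image fun p => p j, f i := (Finset.prod_univ_sum _ _).symm
    _ ≤ _ := Finset.prod_le_prod (fun _ _ => Finset.sum_nonneg fun _ _ => h0 _)
        fun j _ => hf.sum_le_tsum _ fun _ _ => h0 _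

theorem summable_int_inv_sq : Summable fun i : ℤ => ((1 + |(i : ℝ)|) ^ 2)⁻¹ := by
  have : Summable fun i : ℤ => 1 / (i : ℝ) ^ 2 := Real.summable_one_div_int_pow.2 one_lt_two
  refine (this.add (hasSum_single (f := fun i : ℤ => if i = 0 then (1 : ℝ) else 0) 0
    fun i hi => by simp [hi]).summable).of_nonneg_of_le (fun _ => by positivity) fun i => ?_
  rcases eq_or_ne i 0 with rfl | hi
  · simp
  · have hi' : (0 : ℝ) < |(i : ℝ)| := by positivity
    simp only [hi, if_false, add_zero, ← sq_abs (i : ℝ), one_div]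
    gcongr
    linarith

/-- Each factor 1 + |pⱼ| is at most the bracket, so the 2n-th power of the bracket dominates ∏ (1 +
|pⱼ|)², and the series factors into n convergent one-dimensional ones. -/
theorem summable_bracket : Summable fun p : Fin n → ℤ => (bracket p ^ (2 * n))⁻¹ := by
  refine (summable_prod_apply summable_int_inv_sq fun _ => by positivity).of_nonneg_of_le
    (fun p => by have := bracket_pos p; positivity) fun p => ?_
  rw [Finset.prod_inv_distrib, Finset.prod_pow]
  refine inv_anti₀ (by positivity) ?_
  rw [mul_comm, pow_mul]
  gcongr
  calc ∏ i, (1 + |(p i : ℝ)|) ≤ ∏ _i : Fin n, bracket p :=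
        Finset.prod_le_prod (fun _ _ => by positivity) fun i _ => abs_le_bracket p i
    _ = _ := by simp

theorem summable_of_bracket_bound {E : Type*} [NormedAddCommGroup E] [CompleteSpace E]
    {f : (Fin n → ℤ) → E} {C : ℝ} (h : ∀ p, ‖f p‖ * bracket p ^ (2 * n) ≤ C) : Summable f := by
  refine .of_norm_bounded (summable_bracket.mul_left C) fun p => ?_
  have := bracket_pos p
  rw [← div_eq_mul_inv, le_div_iff₀ (by positivity)]
  exact h p

/-- `∑ₚ (1 + |p|)⁻²ⁿ`. -/
def bracketSum (n : ℕ) : ℝ := ∑' p : Fin n → ℤ, (bracket p ^ (2 * n))⁻¹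

theorem bracketSum_nonneg : 0 ≤ bracketSum n :=
  tsum_nonneg fun p => by have := bracket_pos p; positivity

theorem tsum_norm_le_of_bracket_bound {E : Type*} [NormedAddCommGroup E]
    {f : (Fin n → ℤ) → E} {C : ℝ} (h : ∀ p, ‖f p‖ * bracket p ^ (2 * n) ≤ C) :
    ∑' p, ‖f p‖ ≤ C * bracketSum n := by
  have hb : ∀ p, ‖f p‖ ≤ C * (bracket p ^ (2 * n))⁻¹ := fun p => by
    have := bracket_pos p
    rw [← div_eq_mul_inv, le_div_iff₀ (by positivity)]
    exact h p
  rw [bracketSum, ← tsum_mul_left]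
  have hs := (summable_bracket (n := n)).mul_left C
  exact Summable.tsum_le_tsum hb (hs.of_nonneg_of_le (fun _ => norm_nonneg _) hb) hs

theorem norm_tsum_le_of_bracket_bound {E : Type*} [NormedAddCommGroup E] [CompleteSpace E]
    {f : (Fin n → ℤ) → E} {C : ℝ} (h : ∀ p, ‖f p‖ * bracket p ^ (2 * n) ≤ C) :
    ‖∑' p, f p‖ ≤ C * bracketSum n :=
  (norm_tsum_le_tsum_norm (summable_of_bracket_bound (f := fun p => ‖f p‖)
    (by simpa using h))).trans (tsum_norm_le_of_bracket_bound h)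

/-- A positive function on `ℤⁿ` that varies at most polynomially under translations. -/
structure SlowlyVarying (U : (Fin n → ℤ) → ℝ) : Prop where
  pos : ∀ k, 0 < U k
  bound : ∃ (C : ℝ) (M : ℕ), 0 < C ∧ ∀ k p, U (k + p) ≤ C * bracket p ^ M * U k

theorem SlowlyVarying.const {c : ℝ} (hc : 0 < c) : SlowlyVarying fun _ : Fin n → ℤ => c :=
  ⟨fun _ => hc, 1, 0, one_pos, fun _ _ => by simp⟩

theorem slowlyVarying_bracket : SlowlyVarying (bracket (n := n)) :=
  ⟨bracket_pos, 1, 1, one_pos, fun k p => by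
    rw [one_mul, pow_one, mul_comm]; exact bracket_add_le k p⟩

theorem SlowlyVarying.mul {U V : (Fin n → ℤ) → ℝ} (hU : SlowlyVarying U) (hV : SlowlyVarying V) :
    SlowlyVarying fun k => U k * V k := by
  obtain ⟨C, M, hC, h⟩ := hU.bound
  obtain ⟨D, N, hD, h'⟩ := hV.bound
  refine ⟨fun k => mul_pos (hU.pos k) (hV.pos k), C * D, M + N, by positivity, fun k p => ?_⟩
  have := bracket_pos p
  have := hU.pos k
  calc U (k + p) * V (k + p) ≤ (C * bracket p ^ M * U k) *
        (D * bracket p ^ N * V k) :=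
        mul_le_mul (h k p) (h' k p) (hV.pos _).le (by positivity)
    _ = _ := by ring

theorem SlowlyVarying.inv {U : (Fin n → ℤ) → ℝ} (hU : SlowlyVarying U) :
    SlowlyVarying fun k => (U k)⁻¹ := by
  obtain ⟨C, M, hC, h⟩ := hU.bound
  refine ⟨fun k => inv_pos.2 (hU.pos k), C, M, hC, fun k p => ?_⟩
  have h1 := h (k + p) (-p)
  rw [add_neg_cancel_right, bracket_neg] at h1
  rw [← div_eq_mul_inv, le_div_iff₀ (hU.pos k), ← div_eq_inv_mul, div_le_iff₀ (hU.pos _)]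
  exact h1

theorem SlowlyVarying.pow {U : (Fin n → ℤ) → ℝ} (hU : SlowlyVarying U) (N : ℕ) :
    SlowlyVarying fun k => U k ^ N := by
  induction N with
  | zero => simpa using SlowlyVarying.const one_pos
  | succ N ih => simpa [pow_succ] using ih.mul hU

theorem SlowlyVarying.min {U V : (Fin n → ℤ) → ℝ} (hU : SlowlyVarying U) (hV : SlowlyVarying V) :
    SlowlyVarying fun k => min (U k) (V k) := by
  obtain ⟨C, M, hC, h⟩ := hU.bound
  obtain ⟨D, N, hD, h'⟩ := hV.bound
  refine ⟨fun k => lt_min (hU.pos k) (hV.pos k), C + D, M + N, by positivity, fun k p => ?_⟩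
  have h1 := one_le_bracket p
  have h2 := hU.pos k
  have h3 := hV.pos k
  rw [mul_min_of_nonneg _ _ (by have := bracket_pos p; positivity)]
  refine min_le_min ((h k p).trans ?_) ((h' k p).trans ?_)
  · gcongr <;> linarith
  · gcongr <;> linarith

theorem SlowlyVarying.rpow_of_nonneg {U : (Fin n → ℤ) → ℝ} (hU : SlowlyVarying U) {s : ℝ}
    (hs : 0 ≤ s) : SlowlyVarying fun k => U k ^ s := by
  obtain ⟨C, M, hC, h⟩ := hU.bound
  refine ⟨fun k => Real.rpow_pos_of_pos (hU.pos k) s, C ^ s, ⌈M * s⌉₊, by positivity,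
    fun k p => ?_⟩
  have h1 := one_le_bracket p
  have h2 := hU.pos k
  calc U (k + p) ^ s ≤ (C * bracket p ^ M * U k) ^ s :=
        Real.rpow_le_rpow (hU.pos _).le (h k p) hs
    _ = C ^ s * bracket p ^ (M * s : ℝ) * U k ^ s := by
        rw [Real.mul_rpow (by positivity) h2.le, Real.mul_rpow hC.le (by positivity),
          ← Real.rpow_natCast, ← Real.rpow_mul (by positivity)]
    _ ≤ _ := by
        gcongr
        rw [← Real.rpow_natCast]
        exact Real.rpow_le_rpow_of_exponent_le h1 (Nat.le_ceil _)

theorem SlowlyVarying.rpow {U : (Fin n → ℤ) → ℝ} (hU : SlowlyVarying U) (s : ℝ) :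
    SlowlyVarying fun k => U k ^ s := by
  rcases le_total 0 s with hs | hs
  · exact hU.rpow_of_nonneg hs
  · have := (hU.rpow_of_nonneg (neg_nonneg.2 hs)).inv
    simpa only [← Real.rpow_neg (hU.pos _).le, neg_neg] using this

theorem SlowlyVarying.prod {ι : Type*} (s : Finset ι) {U : ι → (Fin n → ℤ) → ℝ}
    (hU : ∀ i, SlowlyVarying (U i)) : SlowlyVarying fun k => ∏ i ∈ s, U i k := by
  classical
  induction s using Finset.induction_on with
  | empty => simpa using SlowlyVarying.const one_pos
  | insert i s hi ih => simpa [Finset.prod_insert hi] using (hU i).mul ih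

theorem SlowlyVarying.one_add_abs (j : Fin n) :
    SlowlyVarying fun k : Fin n → ℤ => 1 + |(k j : ℝ)| := by
  refine ⟨fun k => by positivity, 1, 1, one_pos, fun k p => ?_⟩
  have h1 := abs_le_bracket p j
  have h2 := abs_add_le (k j : ℝ) (p j)
  have h3 := abs_nonneg (k j : ℝ)
  have h4 := mul_nonneg h3 (abs_nonneg (p j : ℝ))
  have h5 := mul_le_mul_of_nonneg_right h1 (by positivity : 0 ≤ 1 + |(k j : ℝ)|)
  push_cast [Pi.add_apply]
  rw [one_mul, pow_one]
  linarith

/-- A slowly varying function is bounded below by a power. -/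
theorem SlowlyVarying.exists_lower {U : (Fin n → ℤ) → ℝ} (hU : SlowlyVarying U) :
    ∃ (C : ℝ) (M : ℕ), 0 < C ∧ ∀ k, (bracket k ^ M)⁻¹ ≤ C * U k := by
  obtain ⟨C, M, hC, h⟩ := hU.bound
  refine ⟨C / U 0, M, div_pos hC (hU.pos 0), fun k => ?_⟩
  have h1 := h k (-k)
  have h2 := bracket_pos k
  have h3 := hU.pos 0
  rw [add_neg_cancel, bracket_neg] at h1
  rw [inv_le_iff_one_le_mul₀ (by positivity), div_mul_eq_mul_div, div_mul_eq_mul_div,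
    le_div_iff₀ h3]
  linarith

end Weights

/-! ### Coefficient functions with rapid decay -/

section Decay

variable {n : ℕ}

/-- `|a(k,p)| = O(U(k) (1 + |p|)^{-N})` for every `N`. -/
def RapidDecay (U : (Fin n → ℤ) → ℝ) (a : (Fin n → ℤ) → (Fin n → ℤ) → ℂ) : Prop :=
  ∀ N : ℕ, ∃ C : ℝ, 0 ≤ C ∧ ∀ k p, ‖a k p‖ * bracket p ^ N ≤ C * U k

variable {U V : (Fin n → ℤ) → ℝ} {a b : (Fin n → ℤ) → (Fin n → ℤ) → ℂ}

theorem RapidDecay.mono (h : RapidDecay U a) {D : ℝ} (hD : 0 ≤ D) (hUV : ∀ k, U k ≤ D * V k) :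
    RapidDecay V a := fun N => by
  obtain ⟨C, hC, h⟩ := h N
  refine ⟨C * D, by positivity, fun k p => (h k p).trans ?_⟩
  rw [mul_assoc]
  gcongr
  exact hUV k

theorem RapidDecay.add (ha : RapidDecay U a) (hb : RapidDecay U b) : RapidDecay U (a + b) :=
  fun N => by
  obtain ⟨C, hC, ha⟩ := ha N
  obtain ⟨D, hD, hb⟩ := hb N
  refine ⟨C + D, by positivity, fun k p => ?_⟩
  have := bracket_pos p
  calc ‖(a + b) k p‖ * bracket p ^ N ≤ (‖a k p‖ + ‖b k p‖) * bracket p ^ N := by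
        gcongr; exact norm_add_le _ _
    _ ≤ _ := by rw [add_mul, add_mul]; exact add_le_add (ha k p) (hb k p)

theorem RapidDecay.neg (ha : RapidDecay U a) : RapidDecay U (-a) := fun N => by
  simpa using ha N

theorem RapidDecay.sub (ha : RapidDecay U a) (hb : RapidDecay U b) : RapidDecay U (a - b) :=
  sub_eq_add_neg a b ▸ ha.add hb.neg

theorem RapidDecay.translate (ha : RapidDecay U a) (hU : SlowlyVarying U) (q : Fin n → ℤ) :
    RapidDecay U fun k => a (k + q) := fun N => by
  obtain ⟨C, hC, ha⟩ := ha N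
  obtain ⟨D, M, hD, h⟩ := hU.bound
  have := bracket_pos q
  refine ⟨C * (D * bracket q ^ M), by positivity, fun k p => (ha _ p).trans ?_⟩
  rw [mul_assoc]
  gcongr
  exact h k q

theorem RapidDecay.fwdDiff (ha : RapidDecay U a) (hU : SlowlyVarying U) (q : Fin n → ℤ) :
    RapidDecay U (fwdDiff q a) := (ha.translate hU q).sub ha

theorem RapidDecay.latticeDiff (ha : RapidDecay U a) (hU : SlowlyVarying U) (α : Fin n → ℕ) :
    RapidDecay U (latticeDiff α a) := by
  induction α using multiindex_induction generalizing a with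
  | h0 => rwa [latticeDiff_zero]
  | h1 α j ih => rw [latticeDiff_add_single]; exact ih (ha.fwdDiff hU _)

theorem RapidDecay.mul_left (ha : RapidDecay U a) {u : (Fin n → ℤ) → ℂ} (hu : ∀ k, ‖u k‖ ≤ V k) :
    RapidDecay (fun k => V k * U k) fun k p => u k * a k p := fun N => by
  obtain ⟨C, hC, ha⟩ := ha N
  refine ⟨C, hC, fun k p => ?_⟩
  rw [norm_mul, mul_assoc, mul_left_comm C]
  exact mul_le_mul (hu k) (ha k p) (by have := bracket_pos p; positivity)
    ((norm_nonneg _).trans (hu k))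

/-- `c(k,r) = ∑ₚ a(k,p) b(k + εp, r - p)`: for `ε = 0` the coefficients of a product of symbols, for
`ε = 1` those of a product of operators. -/
def coefMul (ε : ℕ) (a b : (Fin n → ℤ) → (Fin n → ℤ) → ℂ) (k r : Fin n → ℤ) : ℂ :=
  ∑' p, a k p * b (k + ε • p) (r - p)

theorem bracket_nsmul_le {ε : ℕ} (hε : ε ≤ 1) (p : Fin n → ℤ) : bracket (ε • p) ≤ bracket p := by
  interval_cases ε
  · simpa [bracket_zero] using one_le_bracket p
  · simp

theorem RapidDecay.coefMul_bound {ε : ℕ} (hε : ε ≤ 1) (ha : RapidDecay U a)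
    (hV : SlowlyVarying V) (hb : RapidDecay V b) (N : ℕ) :
    ∃ C : ℝ, 0 ≤ C ∧ ∀ k r p,
      ‖a k p * b (k + ε • p) (r - p)‖ * bracket r ^ N * bracket p ^ (2 * n) ≤ C * (U k * V k) := by
  obtain ⟨D, M, hD, h⟩ := hV.bound
  obtain ⟨B, hB, hb⟩ := hb N
  -- Decay of order N pays for splitting r into p and r - p, order M for moving V from k + εp back
  -- to k, and order 2n remains for summing over p.
  obtain ⟨A, hA, ha⟩ := ha (N + M + 2 * n)
  refine ⟨A * (B * D), by positivity, fun k r p => ?_⟩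
  have hp := bracket_pos p
  have hr := bracket_pos r
  have hrp := bracket_pos (r - p)
  have hVk := hV.pos k
  have h1 : ‖b (k + ε • p) (r - p)‖ * bracket (r - p) ^ N ≤ B * (D * bracket p ^ M * V k) :=
    (hb _ _).trans <| by
      gcongr
      refine (h k _).trans ?_
      gcongr
      · exact (bracket_pos _).le
      · exact bracket_nsmul_le hε p
  calc ‖a k p * b (k + ε • p) (r - p)‖ * bracket r ^ N * bracket p ^ (2 * n)
      ≤ (‖a k p‖ * ‖b (k + ε • p) (r - p)‖) * (bracket p * bracket (r - p)) ^ N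
          * bracket p ^ (2 * n) := by
        rw [norm_mul]
        gcongr
        exact bracket_le_mul r p
    _ = ‖a k p‖ * bracket p ^ (N + 2 * n) * (‖b (k + ε • p) (r - p)‖ * bracket (r - p) ^ N) := by
        ring
    _ ≤ ‖a k p‖ * bracket p ^ (N + 2 * n) * (B * (D * bracket p ^ M * V k)) := by gcongr
    _ = (‖a k p‖ * bracket p ^ (N + M + 2 * n)) * (B * D * V k) := by ring
    _ ≤ (A * U k) * (B * D * V k) := mul_le_mul_of_nonneg_right (ha k p) (by positivity)
    _ = _ := by ring

theorem RapidDecay.summable_coefMul {ε : ℕ} (hε : ε ≤ 1) (ha : RapidDecay U a)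
    (hV : SlowlyVarying V) (hb : RapidDecay V b) (k r : Fin n → ℤ) :
    Summable fun p => a k p * b (k + ε • p) (r - p) := by
  obtain ⟨C, -, h⟩ := ha.coefMul_bound hε hV hb 0
  exact summable_of_bracket_bound fun p => by simpa using h k r p

theorem RapidDecay.coefMul {ε : ℕ} (hε : ε ≤ 1) (ha : RapidDecay U a)
    (hV : SlowlyVarying V) (hb : RapidDecay V b) :
    RapidDecay (fun k => U k * V k) (coefMul ε a b) := fun N => by
  obtain ⟨C, hC, h⟩ := ha.coefMul_bound hε hV hb N
  refine ⟨C * bracketSum n, mul_nonneg hC bracketSum_nonneg, fun k r => ?_⟩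
  have hr := bracket_pos r
  have := norm_tsum_le_of_bracket_bound (f := fun p => a k p * b (k + ε • p) (r - p))
    (C := C * (U k * V k) / bracket r ^ N) fun p => by
      rw [le_div_iff₀ (by positivity), mul_right_comm]; exact h k r p
  rw [div_mul_eq_mul_div, le_div_iff₀ (by positivity)] at this
  refine this.trans (le_of_eq (by ring))

/-- The discrete Leibniz rule: one factor is differenced and the other translated. Since ε • p is
added to the argument of b, the translation by q commutes with it. -/
theorem fwdDiff_coefMul {ε : ℕ} (hε : ε ≤ 1) (hU : SlowlyVarying U) (ha : RapidDecay U a)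
    (hV : SlowlyVarying V) (hb : RapidDecay V b) (q : Fin n → ℤ) :
    fwdDiff q (coefMul ε a b) =
      coefMul ε (fwdDiff q a) (fun k => b (k + q)) + coefMul ε a (fwdDiff q b) := by
  ext k r
  have hb' := hb.translate hV q
  have s1 := (ha.fwdDiff hU q).summable_coefMul hε hV hb' k r
  have s2 := ha.summable_coefMul hε hV (hb.fwdDiff hV q) k r
  have s3 := ha.summable_coefMul hε hV hb (k + q) r
  have s4 := ha.summable_coefMul hε hV hb k r
  simp only [fwdDiff, Pi.sub_apply, Pi.add_apply, coefMul] at *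
  rw [← s1.tsum_add s2, ← s3.tsum_sub s4]
  congr 1
  ext p
  rw [add_right_comm k q]
  ring

/-- A family of weights `W_α` with `W_α W_β ≤ W_{α+β}`. -/
structure IsWeightFamily (W : (Fin n → ℕ) → (Fin n → ℤ) → ℝ) : Prop where
  slow : ∀ α, SlowlyVarying (W α)
  mul_le : ∀ α β k, W α k * W β k ≤ W (α + β) k

/-- The bounds `Δ^α a = O(W_{α₀+α})`, with rapid decay in the second variable, for `|α| ≤ s`. -/
def DiffDecay (W : (Fin n → ℕ) → (Fin n → ℤ) → ℝ) (s : ℕ) (α₀ : Fin n → ℕ)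
    (a : (Fin n → ℤ) → (Fin n → ℤ) → ℂ) : Prop :=
  ∀ α, order α ≤ s → RapidDecay (W (α₀ + α)) (latticeDiff α a)

variable {W : (Fin n → ℕ) → (Fin n → ℤ) → ℝ} {s : ℕ} {α₀ β₀ : Fin n → ℕ}

theorem DiffDecay.rapidDecay (ha : DiffDecay W s α₀ a) : RapidDecay (W α₀) a := by
  simpa [latticeDiff_zero] using ha 0 (by simp [order_zero])

theorem DiffDecay.mono (ha : DiffDecay W s α₀ a) {s' : ℕ} (h : s' ≤ s) : DiffDecay W s' α₀ a :=
  fun α hα => ha α (hα.trans h)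

theorem DiffDecay.fwdDiff (ha : DiffDecay W (s + 1) α₀ a) (j : Fin n) :
    DiffDecay W s (α₀ + Pi.single j 1) (fwdDiff (Pi.single j 1) a) := fun α hα => by
  have := ha (α + Pi.single j 1) (by rw [order_add, order_single]; omega)
  rwa [latticeDiff_add_single, ← add_assoc, add_right_comm] at this

theorem DiffDecay.translate (hW : IsWeightFamily W) (ha : DiffDecay W s α₀ a) (q : Fin n → ℤ) :
    DiffDecay W s α₀ fun k => a (k + q) := fun α hα => by
  have := (ha α hα).translate (hW.slow _) q
  convert this using 2 with k
  exact latticeDiff_translate α a q k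

theorem DiffDecay.add (ha : DiffDecay W s α₀ a) (hb : DiffDecay W s α₀ b) :
    DiffDecay W s α₀ (a + b) := fun α hα => by
  rw [latticeDiff_add]; exact (ha α hα).add (hb α hα)

theorem DiffDecay.neg (ha : DiffDecay W s α₀ a) : DiffDecay W s α₀ (-a) := fun α hα => by
  rw [latticeDiff_neg]; exact (ha α hα).neg

theorem DiffDecay.sub (ha : DiffDecay W s α₀ a) (hb : DiffDecay W s α₀ b) :
    DiffDecay W s α₀ (a - b) := sub_eq_add_neg a b ▸ ha.add hb.neg

/-- By the Leibniz rule, each difference moves one unit from α to the offset of one factor and uses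
up one unit of s. The offsets keep both Leibniz terms under the same weight, and the base case is
the submultiplicativity of W. -/
theorem DiffDecay.coefMul {ε : ℕ} (hε : ε ≤ 1) (hW : IsWeightFamily W) (ha : DiffDecay W s α₀ a)
    (hb : DiffDecay W s β₀ b) : DiffDecay W s (α₀ + β₀) (coefMul ε a b) := by
  intro α hα
  induction α using multiindex_induction generalizing s α₀ β₀ a b with
  | h0 =>
    rw [latticeDiff_zero, add_zero]
    refine (ha.rapidDecay.coefMul hε (hW.slow _)
      hb.rapidDecay).mono zero_le_one fun k => ?_
    rw [one_mul]
    exact hW.mul_le _ _ k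
  | h1 α j ih =>
    rw [order_add, order_single] at hα
    obtain ⟨s, rfl⟩ : ∃ s', s = s' + 1 := ⟨s - 1, by omega⟩
    rw [latticeDiff_add_single, fwdDiff_coefMul hε (hW.slow _) ha.rapidDecay (hW.slow _)
      hb.rapidDecay, latticeDiff_add]
    refine RapidDecay.add ?_ ?_
    · have := ih (ha.fwdDiff j) ((hb.mono s.le_succ).translate hW (Pi.single j 1)) (by omega)
      convert this using 2
      abel
    · have := ih (ha.mono s.le_succ) (hb.fwdDiff j) (by omega)
      convert this using 2
      abel

/-! ### Coefficients of smoothing operators -/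

/-- `|a(k,p)| = O((1 + |k|)^{-N} (1 + |p|)^{-N})` for every `N`. -/
def IsSmoothing (a : (Fin n → ℤ) → (Fin n → ℤ) → ℂ) : Prop :=
  ∀ N : ℕ, RapidDecay (fun k => (bracket k ^ N)⁻¹) a

theorem slowlyVarying_bracket_pow_inv (N : ℕ) :
    SlowlyVarying fun k : Fin n → ℤ => (bracket k ^ N)⁻¹ := (slowlyVarying_bracket.pow N).inv

theorem IsSmoothing.neg (ha : IsSmoothing a) : IsSmoothing (-a) := fun N => (ha N).neg

theorem IsSmoothing.sub (ha : IsSmoothing a) (hb : IsSmoothing b) : IsSmoothing (a - b) :=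
  fun N => (ha N).sub (hb N)

/-- A slowly varying weight is bounded below by a negative power of the bracket, so smoothing
coefficients obey the bounds of every such weight. -/
theorem IsSmoothing.rapidDecay (ha : IsSmoothing a) (hU : SlowlyVarying U) : RapidDecay U a := by
  obtain ⟨C, M, hC, h⟩ := hU.exists_lower
  exact (ha M).mono hC.le h

theorem IsSmoothing.latticeDiff (ha : IsSmoothing a) (α : Fin n → ℕ) :
    IsSmoothing (latticeDiff α a) :=
  fun N => (ha N).latticeDiff (slowlyVarying_bracket_pow_inv N) α

theorem IsSmoothing.diffDecay (ha : IsSmoothing a) (hW : IsWeightFamily W) :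
    DiffDecay W s α₀ a := fun α _ => (ha.latticeDiff α).rapidDecay (hW.slow _)

/-- The lower power bound for 1/V says that V grows at most polynomially. Smoothing coefficients
therefore stay smoothing after multiplication by such a weight. -/
theorem bracket_pow_inv_mul_le (hV : SlowlyVarying V) (N : ℕ) :
    ∃ (M : ℕ) (D : ℝ), 0 ≤ D ∧ ∀ k, (bracket k ^ M)⁻¹ * V k ≤ D * (bracket k ^ N)⁻¹ := by
  obtain ⟨C, M, hC, h⟩ := hV.inv.exists_lower
  refine ⟨M + N, C, hC.le, fun k => ?_⟩
  have h1 := bracket_pos k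
  have h2 := hV.pos k
  have h3 := h k
  have h4 : (bracket k ^ M)⁻¹ * V k ≤ C := by
    calc _ ≤ C * (V k)⁻¹ * V k := by gcongr
      _ = C := by field_simp
  rw [pow_add, mul_inv, mul_right_comm]
  gcongr

theorem IsSmoothing.mul_left (ha : IsSmoothing a) (hV : SlowlyVarying V) {u : (Fin n → ℤ) → ℂ}
    (hu : ∀ k, ‖u k‖ ≤ V k) : IsSmoothing fun k p => u k * a k p := fun N => by
  obtain ⟨M, D, hD, h⟩ := bracket_pow_inv_mul_le hV N
  exact ((ha M).mul_left hu).mono hD fun k => by rw [mul_comm]; exact h k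

theorem IsSmoothing.coefMul_left (ha : IsSmoothing a) (hV : SlowlyVarying V) (hb : RapidDecay V b) :
    IsSmoothing (coefMul 1 a b) := fun N => by
  obtain ⟨M, D, hD, h⟩ := bracket_pow_inv_mul_le hV N
  exact ((ha M).coefMul le_rfl hV hb).mono
    hD h

theorem IsSmoothing.coefMul_right (hU : SlowlyVarying U) (ha : RapidDecay U a)
    (hb : IsSmoothing b) : IsSmoothing (coefMul 1 a b) := fun N => by
  obtain ⟨M, D, hD, h⟩ := bracket_pow_inv_mul_le hU N
  exact (ha.coefMul le_rfl (slowlyVarying_bracket_pow_inv M) (hb M)).mono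
    hD fun k => by rw [mul_comm]; exact h k

/-! ### The gain of one order for `ε = 1` against `ε = 0` -/

/-- Join k to k + p by a lattice path of unit steps whose ℓ¹ distance to k is monotone. There are at
most `bracket p` steps, each costing at most C (1 + |p|)^M. -/
theorem norm_translate_sub_le {F : (Fin n → ℤ) → ℂ} {C : ℝ} {M : ℕ} (hC : 0 ≤ C)
    (k : Fin n → ℤ)
    (hF : ∀ q j, ‖F (k + q + Pi.single j 1) - F (k + q)‖ ≤ C * bracket q ^ M) (p : Fin n → ℤ) :
    ‖F (k + p) - F k‖ ≤ C * bracket p ^ (M + 1) := by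
  suffices h : ∀ (s : ℕ) (p : Fin n → ℤ), ∑ j, (p j).natAbs = s →
      ‖F (k + p) - F k‖ ≤ s * (C * (1 + s) ^ M) by
    have hs : ((∑ j, (p j).natAbs : ℕ) : ℝ) = ∑ j, |(p j : ℝ)| := by
      push_cast
      exact Finset.sum_congr rfl fun j _ => by rw [Nat.cast_natAbs]; simp
    refine (h _ p rfl).trans ?_
    rw [hs, pow_succ, mul_comm, mul_assoc]
    have : 0 ≤ ∑ j, |(p j : ℝ)| := Finset.sum_nonneg fun _ _ => abs_nonneg _
    have h1 := one_le_bracket p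
    change C * (bracket p ^ M * _) ≤ _
    gcongr
    exact le_add_of_nonneg_left zero_le_one
  intro s
  induction s with
  | zero =>
    intro p hp
    have : p = 0 := by
      ext j
      simpa using Finset.sum_eq_zero_iff.1 hp j (Finset.mem_univ j)
    simp [this]
  | succ s ih =>
    intro p hp
    obtain ⟨j, -, hj⟩ : ∃ j ∈ Finset.univ, (p j).natAbs ≠ 0 := by
      by_contra! h
      simp [Finset.sum_eq_zero h] at hp
    have hb : ∀ q : Fin n → ℤ, ∑ j, (q j).natAbs ≤ s + 1 → bracket q ≤ 1 + (s + 1 : ℕ) := by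
      intro q hq
      unfold bracket
      gcongr
      refine le_trans (le_of_eq ?_) (Nat.cast_le.2 hq)
      push_cast
      exact Finset.sum_congr rfl fun j _ => by rw [Nat.cast_natAbs]; simp
    have hsum : ∀ c : ℤ, (p j + c).natAbs + 1 = (p j).natAbs →
        ∑ i, ((p + Pi.single j c : Fin n → ℤ) i).natAbs = s := by
      intro c hc
      rw [← Finset.add_sum_erase _ _ (Finset.mem_univ j)] at hp ⊢
      have : ∑ i ∈ Finset.univ.erase j, ((p + Pi.single j c : Fin n → ℤ) i).natAbs =
          ∑ i ∈ Finset.univ.erase j, (p i).natAbs :=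
        Finset.sum_congr rfl fun i hi => by simp [Finset.ne_of_mem_erase hi]
      rw [this, Pi.add_apply, Pi.single_eq_same]
      omega
    have step : ∀ c : ℤ, (p j + c).natAbs + 1 = (p j).natAbs →
        ‖F (k + p) - F (k + (p + Pi.single j c))‖ ≤ C * (1 + (s + 1 : ℕ)) ^ M →
        ‖F (k + p) - F k‖ ≤ (s + 1 : ℕ) * (C * (1 + (s + 1 : ℕ)) ^ M) := by
      intro c hc h
      have h2 := ih _ (hsum c hc)
      have h3 : C * (1 + (s : ℝ)) ^ M ≤ C * (1 + (s + 1 : ℕ)) ^ M := by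
        gcongr; simp
      generalize C * (1 + ((s + 1 : ℕ) : ℝ)) ^ M = K at h h3 ⊢
      have h4 := norm_sub_le_norm_sub_add_norm_sub (F (k + p)) (F (k + (p + Pi.single j c))) (F k)
      have h5 := mul_le_mul_of_nonneg_left h3 (Nat.cast_nonneg (α := ℝ) s)
      push_cast
      linarith
    -- The path is shortened by moving p one unit towards the origin. The increment is based at p
    -- when pⱼ < 0 and at p - eⱼ when pⱼ > 0, in both cases a point of ℓ¹ length at most s + 1.
    rcases lt_or_gt_of_ne (Int.natAbs_ne_zero.1 hj) with hneg | hpos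
    · refine step 1 (by omega) ?_
      rw [norm_sub_rev, ← add_assoc]
      refine (hF p j).trans ?_
      gcongr
      · exact (bracket_pos _).le
      · exact hb p hp.le
    · refine step (-1) (by omega) ?_
      have h := hF (p + Pi.single j (-1)) j
      have e : k + (p + Pi.single j (-1)) + Pi.single j 1 = k + p := by
        rw [add_assoc, add_assoc, ← Pi.single_add]; simp
      rw [e] at h
      refine h.trans ?_
      gcongr
      · exact (bracket_pos _).le
      · exact hb _ ((hsum (-1) (by omega)).le.trans s.le_succ)

/-- The difference between the coefficients of a product of operators and those of the operator
whose symbol is the product. -/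
theorem RapidDecay.coefMul_sub (hV : SlowlyVarying V)
    {V' : (Fin n → ℤ) → ℝ} (hV' : SlowlyVarying V')
    (ha : RapidDecay U a) (hb : RapidDecay V' b)
    (hb' : ∀ j, RapidDecay V (LatticePDO.latticeDiff (Pi.single j 1) b)) :
    RapidDecay (fun k => U k * V k) (LatticePDO.coefMul 1 a b - LatticePDO.coefMul 0 a b) := by
  intro N
  obtain ⟨D, M, hD, h⟩ := hV.bound
  choose B hB hb₁ using fun j => hb' j N
  -- Order N splits r, order M + 1 pays for the lattice path from k to k + p, and order 2n remains
  -- for the sum over p.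
  obtain ⟨A, hA, ha₁⟩ := ha (N + (M + 1) + 2 * n)
  set B' := ∑ j, B j
  have hB' : 0 ≤ B' := Finset.sum_nonneg fun j _ => hB j
  refine ⟨A * (B' * D) * bracketSum n,
    mul_nonneg (by positivity) bracketSum_nonneg, fun k r => ?_⟩
  have hr := bracket_pos r
  have hVk := hV.pos k
  have hdiff : ∀ p q, ‖b (k + p) q - b k q‖ * bracket q ^ N ≤
      B' * D * V k * bracket p ^ (M + 1) := by
    intro p q
    have hq := bracket_pos q
    rw [← le_div_iff₀ (by positivity), mul_div_right_comm]
    refine norm_translate_sub_le (F := fun k => b k q) (by positivity) k (fun p' j => ?_) p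
    have h1 := hb₁ j (k + p') q
    rw [latticeDiff_single] at h1
    rw [div_mul_eq_mul_div, le_div_iff₀ (by positivity)]
    calc _ ≤ B j * V (k + p') := h1
      _ ≤ B' * (D * bracket p' ^ M * V k) := by
        gcongr
        · exact (hV.pos _).le
        · exact Finset.single_le_sum (f := B) (fun j _ => hB j) (Finset.mem_univ j)
        · exact h k p'
      _ = _ := by ring
  have s1 := ha.summable_coefMul le_rfl hV' hb k r
  have s0 := ha.summable_coefMul zero_le_one hV' hb k r
  have hsub : (LatticePDO.coefMul 1 a b - LatticePDO.coefMul 0 a b) k r =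
      ∑' p, a k p * (b (k + p) (r - p) - b k (r - p)) := by
    simp only [Pi.sub_apply, LatticePDO.coefMul]
    rw [← s1.tsum_sub s0]
    simp [mul_sub]
  rw [hsub]
  have := norm_tsum_le_of_bracket_bound (f := fun p => a k p * (b (k + p) (r - p) - b k (r - p)))
    (C := A * (B' * D) * (U k * V k) / bracket r ^ N) fun p => by
      have hp := bracket_pos p
      have hrp := bracket_pos (r - p)
      rw [le_div_iff₀ (by positivity)]
      calc _ ≤ ‖a k p‖ * ‖b (k + p) (r - p) - b k (r - p)‖ * bracket p ^ (2 * n) *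
            (bracket p * bracket (r - p)) ^ N := by
            rw [norm_mul]
            gcongr
            exact bracket_le_mul r p
        _ = ‖a k p‖ * bracket p ^ (N + 2 * n) *
            (‖b (k + p) (r - p) - b k (r - p)‖ * bracket (r - p) ^ N) := by ring
        _ ≤ ‖a k p‖ * bracket p ^ (N + 2 * n) * (B' * D * V k * bracket p ^ (M + 1)) :=
            mul_le_mul_of_nonneg_left (hdiff p (r - p)) (by positivity)
        _ = (‖a k p‖ * bracket p ^ (N + (M + 1) + 2 * n)) * (B' * D * V k) := by ring
        _ ≤ (A * U k) * (B' * D * V k) :=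
            mul_le_mul_of_nonneg_right (ha₁ k p) (by positivity)
        _ = _ := by ring
  rw [div_mul_eq_mul_div, le_div_iff₀ (by positivity)] at this
  exact this.trans (le_of_eq (by ring))

end Decay

/-! ### Smooth functions on the torus -/

section Torus

variable {n : ℕ}

/-- The projection `ℝⁿ → 𝕋ⁿ`. -/
def torusMk (y : Fin n → ℝ) : UnitAddTorus (Fin n) := fun i => (y i : UnitAddCircle)

theorem isOpenQuotientMap_torusMk : IsOpenQuotientMap (torusMk (n := n)) :=
  IsOpenQuotientMap.piMap fun _ => QuotientAddGroup.isOpenQuotientMap_mk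

theorem torusMk_surjective : Function.Surjective (torusMk (n := n)) :=
  isOpenQuotientMap_torusMk.surjective

theorem torusMk_add_single (y : Fin n → ℝ) (j : Fin n) (t : ℝ) :
    torusMk y + Pi.single j (t : UnitAddCircle) = torusMk (y + t • Pi.single j 1) := by
  ext i
  rcases eq_or_ne i j with rfl | h
  · simp [torusMk]
  · simp [torusMk, h]

instance : IsProbabilityMeasure (torusMeasure n) := by unfold torusMeasure; infer_instance

instance : (torusMeasure n).IsAddLeftInvariant := by
  unfold torusMeasure; infer_instance

variable {f g : UnitAddTorus (Fin n) → ℂ}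

theorem SmoothOnTorus.continuous (hf : SmoothOnTorus f) : Continuous f :=
  isOpenQuotientMap_torusMk.isQuotientMap.continuous_iff.2 (ContDiff.continuous hf)

theorem SmoothOnTorus.integrable (hf : SmoothOnTorus f) : Integrable f (torusMeasure n) :=
  hf.continuous.integrable_of_hasCompactSupport (HasCompactSupport.of_compactSpace f)

theorem SmoothOnTorus.exists_bound (hf : SmoothOnTorus f) : ∃ C, ∀ x, ‖f x‖ ≤ C := by
  obtain ⟨C, hC⟩ := isCompact_univ.exists_bound_of_continuousOn hf.continuous.continuousOn
  exact ⟨C, fun x => hC x (Set.mem_univ x)⟩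

theorem smoothOnTorus_const (c : ℂ) : SmoothOnTorus fun _ : UnitAddTorus (Fin n) => c :=
  contDiff_const

theorem SmoothOnTorus.sub (hf : SmoothOnTorus f) (hg : SmoothOnTorus g) :
    SmoothOnTorus fun x => f x - g x := ContDiff.sub hf hg

theorem SmoothOnTorus.mul (hf : SmoothOnTorus f) (hg : SmoothOnTorus g) :
    SmoothOnTorus fun x => f x * g x := ContDiff.mul hf hg

theorem SmoothOnTorus.inv (hf : SmoothOnTorus f) (h0 : ∀ x, f x ≠ 0) :
    SmoothOnTorus fun x => (f x)⁻¹ := ContDiff.inv hf fun _ => h0 _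

theorem torusD_torusMk_of_hasFDerivAt {j : Fin n} {y : Fin n → ℝ} {f' : (Fin n → ℝ) →L[ℝ] ℂ}
    (h : HasFDerivAt (fun y => f (torusMk y)) f' y) :
    torusD j f (torusMk y) = 1 / (2 * (Real.pi : ℂ) * Complex.I) * f' (Pi.single j 1) := by
  have h1 : HasDerivAt (fun t : ℝ => y + t • (Pi.single j 1 : Fin n → ℝ)) (Pi.single j 1) 0 := by
    simpa using ((hasDerivAt_id (0 : ℝ)).smul_const (Pi.single j 1 : Fin n → ℝ)).const_add y
  have h2 : HasFDerivAt (fun y => f (torusMk y)) f' (y + (0 : ℝ) • (Pi.single j 1 : Fin n → ℝ)) :=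
    by simpa using h
  have h3 := h2.comp_hasDerivAt (0 : ℝ) h1
  unfold torusD
  congr 1
  refine HasDerivAt.deriv (h3.congr_of_eventuallyEq (.of_forall fun t => ?_))
  simp [torusMk_add_single]

theorem SmoothOnTorus.hasFDerivAt (hf : SmoothOnTorus f) (y : Fin n → ℝ) :
    HasFDerivAt (fun y => f (torusMk y)) (fderiv ℝ (fun y => f (torusMk y)) y) y :=
  ((ContDiff.differentiable hf (by simp)) y).hasFDerivAt

theorem SmoothOnTorus.torusD (hf : SmoothOnTorus f) (j : Fin n) : SmoothOnTorus (torusD j f) := by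
  have : (fun y : Fin n → ℝ => LatticePDO.torusD j f (torusMk y)) = fun y =>
      1 / (2 * (Real.pi : ℂ) * Complex.I) *
        fderiv ℝ (fun y => f (torusMk y)) y (Pi.single j 1) :=
    funext fun y => torusD_torusMk_of_hasFDerivAt (hf.hasFDerivAt y)
  unfold SmoothOnTorus
  change ContDiff ℝ ∞ fun y : Fin n → ℝ => LatticePDO.torusD j f (torusMk y)
  rw [this]
  have h1 : ContDiff ℝ ∞ (fderiv ℝ (fun y : Fin n → ℝ => f (torusMk y))) :=
    ContDiff.fderiv_right hf (by simp)
  exact contDiff_const.mul (h1.clm_apply contDiff_const)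

theorem SmoothOnTorus.hasDerivAt (hf : SmoothOnTorus f) (j : Fin n) (x : UnitAddTorus (Fin n))
    (t : ℝ) : HasDerivAt (fun t : ℝ => f (x + Pi.single j (t : UnitAddCircle)))
      (2 * (Real.pi : ℂ) * Complex.I *
        LatticePDO.torusD j f (x + Pi.single j (t : UnitAddCircle))) t := by
  obtain ⟨y, rfl⟩ := torusMk_surjective x
  have h1 : HasDerivAt (fun t : ℝ => y + t • (Pi.single j 1 : Fin n → ℝ)) (Pi.single j 1) t := by
    simpa using ((hasDerivAt_id t).smul_const (Pi.single j 1 : Fin n → ℝ)).const_add y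
  have h3 := (hf.hasFDerivAt (y + t • (Pi.single j 1 : Fin n → ℝ))).comp_hasDerivAt t h1
  rw [torusMk_add_single, torusD_torusMk_of_hasFDerivAt (hf.hasFDerivAt _), ← mul_assoc,
    mul_one_div_cancel (by simp [Real.pi_ne_zero]), one_mul]
  refine h3.congr_of_eventuallyEq (.of_forall fun t => ?_)
  simp [torusMk_add_single]

theorem torusD_eq_of_hasDerivAt {j : Fin n} {x : UnitAddTorus (Fin n)} {c : ℂ}
    (h : HasDerivAt (fun t : ℝ => f (x + Pi.single j (t : UnitAddCircle)))
      (2 * (Real.pi : ℂ) * Complex.I * c) 0) : torusD j f x = c := by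
  rw [torusD, h.deriv, ← mul_assoc, one_div_mul_cancel (by simp [Real.pi_ne_zero]), one_mul]

theorem SmoothOnTorus.hasDerivAt_zero (hf : SmoothOnTorus f) (j : Fin n)
    (x : UnitAddTorus (Fin n)) :
    HasDerivAt (fun t : ℝ => f (x + Pi.single j (t : UnitAddCircle)))
      (2 * (Real.pi : ℂ) * Complex.I * LatticePDO.torusD j f x) 0 := by
  simpa using hf.hasDerivAt j x 0

theorem torusD_add (hf : SmoothOnTorus f) (hg : SmoothOnTorus g) (j : Fin n) :
    torusD j (fun x => f x + g x) = fun x => torusD j f x + torusD j g x := by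
  ext x
  refine torusD_eq_of_hasDerivAt ?_
  rw [mul_add]
  exact (hf.hasDerivAt_zero j x).add (hg.hasDerivAt_zero j x)

theorem torusD_neg (hf : SmoothOnTorus f) (j : Fin n) :
    torusD j (fun x => -f x) = fun x => -torusD j f x := by
  ext x
  refine torusD_eq_of_hasDerivAt ?_
  rw [mul_neg]
  exact (hf.hasDerivAt_zero j x).neg

theorem torusD_mul (hf : SmoothOnTorus f) (hg : SmoothOnTorus g) (j : Fin n) :
    torusD j (fun x => f x * g x) = fun x => torusD j f x * g x + f x * torusD j g x := by
  ext x
  refine torusD_eq_of_hasDerivAt ?_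
  convert! (hf.hasDerivAt_zero j x).mul (hg.hasDerivAt_zero j x) using 1
  simp
  ring

theorem torusD_inv (hf : SmoothOnTorus f) (h0 : ∀ x, f x ≠ 0) (j : Fin n) :
    torusD j (fun x => (f x)⁻¹) = fun x => -(torusD j f x * (f x)⁻¹ * (f x)⁻¹) := by
  ext x
  refine torusD_eq_of_hasDerivAt ?_
  convert! (hf.hasDerivAt_zero j x).inv (by simpa using h0 x) using 1
  simp
  have := h0 x
  field_simp

theorem SmoothOnTorus.torusD_iterate (hf : SmoothOnTorus f) (j : Fin n) (N : ℕ) :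
    SmoothOnTorus ((LatticePDO.torusD j)^[N] f) := by
  induction N with
  | zero => exact hf
  | succ N ih => rw [Function.iterate_succ_apply']; exact ih.torusD j

theorem torusD_iterate_add (hf : SmoothOnTorus f) (hg : SmoothOnTorus g) (j : Fin n) (N : ℕ) :
    (torusD j)^[N] (fun x => f x + g x) = fun x => (torusD j)^[N] f x + (torusD j)^[N] g x := by
  induction N generalizing f g with
  | zero => rfl
  | succ N ih => rw [Function.iterate_succ_apply, torusD_add hf hg, ih (hf.torusD j) (hg.torusD j)]; rfl

theorem torusD_iterate_neg (hf : SmoothOnTorus f) (j : Fin n) (N : ℕ) :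
    (torusD j)^[N] (fun x => -f x) = fun x => -(torusD j)^[N] f x := by
  induction N generalizing f with
  | zero => rfl
  | succ N ih => rw [Function.iterate_succ_apply, torusD_neg hf, ih (hf.torusD j)]; rfl

theorem SmoothOnTorus.torusDFalling (hf : SmoothOnTorus f) (j : Fin n) (ℓ : ℕ) :
    SmoothOnTorus (torusDFalling j ℓ f) := by
  induction ℓ with
  | zero => exact hf
  | succ ℓ ih => exact (ih.torusD j).sub ((smoothOnTorus_const _).mul ih)

/-! ### Uniform bounds for reciprocals -/

section UniformBounds

variable {ι : Type*}

/-- Bounds for the first `s` derivatives in the `j`-th variable, uniform in a family. -/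
def UniformBound (j : Fin n) (s : ℕ) (u : ι → UnitAddTorus (Fin n) → ℂ) : Prop :=
  ∀ N ≤ s, ∃ C : ℝ, ∀ i x, ‖(torusD j)^[N] (u i) x‖ ≤ C

variable {j : Fin n} {s : ℕ} {u v : ι → UnitAddTorus (Fin n) → ℂ}

theorem UniformBound.torusD (hu : UniformBound j (s + 1) u) :
    UniformBound j s fun i => torusD j (u i) := fun N hN => by
  simpa [Function.iterate_succ_apply] using hu (N + 1) (by omega)

theorem UniformBound.mono (hu : UniformBound j s u) {s' : ℕ} (h : s' ≤ s) : UniformBound j s' u :=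
  fun N hN => hu N (hN.trans h)

theorem UniformBound.neg (hs : ∀ i, SmoothOnTorus (u i)) (hu : UniformBound j s u) :
    UniformBound j s fun i x => -u i x := fun N hN => by
  obtain ⟨C, hC⟩ := hu N hN
  exact ⟨C, fun i x => by rw [torusD_iterate_neg (hs i), norm_neg]; exact hC i x⟩

theorem UniformBound.mul (hus : ∀ i, SmoothOnTorus (u i)) (hvs : ∀ i, SmoothOnTorus (v i))
    (hu : UniformBound j s u) (hv : UniformBound j s v) :
    UniformBound j s fun i x => u i x * v i x := by
  intro N hN
  induction N generalizing s u v with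
  | zero =>
    obtain ⟨C, hC⟩ := hu 0 hN
    obtain ⟨D, hD⟩ := hv 0 hN
    refine ⟨C * D, fun i x => ?_⟩
    rw [Function.iterate_zero_apply, norm_mul]
    exact mul_le_mul (hC i x) (hD i x) (norm_nonneg _) ((norm_nonneg _).trans (hC i x))
  | succ N ih =>
    obtain ⟨s, rfl⟩ : ∃ s', s = s' + 1 := ⟨s - 1, by omega⟩
    obtain ⟨C, hC⟩ := ih (fun i => (hus i).torusD j) hvs hu.torusD (hv.mono s.le_succ) (by omega)
    obtain ⟨D, hD⟩ := ih hus (fun i => (hvs i).torusD j) (hu.mono s.le_succ) hv.torusD (by omega)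
    refine ⟨C + D, fun i x => ?_⟩
    rw [Function.iterate_succ_apply, torusD_mul (hus i) (hvs i), torusD_iterate_add
      (((hus i).torusD j).mul (hvs i)) ((hus i).mul ((hvs i).torusD j))]
    exact (norm_add_le _ _).trans (add_le_add (hC i x) (hD i x))

/-- Since D(1/u) = -Du · u⁻¹ · u⁻¹, the derivatives of order up to s + 1 are controlled by those of
u and by the derivatives of 1/u of order up to s. -/
theorem UniformBound.inv (hus : ∀ i, SmoothOnTorus (u i)) (hu : ∀ s, UniformBound j s u) {c : ℝ}
    (hc : 0 < c) (hcu : ∀ i x, c ≤ ‖u i x‖) (s : ℕ) : UniformBound j s fun i x => (u i x)⁻¹ := by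
  have h0 : ∀ i x, u i x ≠ 0 := fun i x => norm_pos_iff.1 (hc.trans_le (hcu i x))
  have hsm := fun i => (hus i).inv (h0 i)
  induction s with
  | zero =>
    intro N hN
    obtain rfl : N = 0 := by omega
    refine ⟨c⁻¹, fun i x => ?_⟩
    rw [Function.iterate_zero_apply, norm_inv]
    exact inv_anti₀ hc (hcu i x)
  | succ s ih =>
    intro N hN
    rcases N with _ | N
    · exact ih 0 (by omega)
    have hD := fun i => (hus i).torusD j
    have h1 := ((UniformBound.mul (fun i => (hD i).mul (hsm i)) hsm
      (UniformBound.mul hD hsm (hu (s + 1)).torusD ih) ih).neg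
        fun i => ((hD i).mul (hsm i)).mul (hsm i)) N (by omega)
    obtain ⟨C, hC⟩ := h1
    refine ⟨C, fun i x => ?_⟩
    rw [Function.iterate_succ_apply, torusD_inv (hus i) (h0 i)]
    exact hC i x

end UniformBounds

end Torus

/-! ### Fourier coefficients -/

section Fourier

open UnitAddTorus (mFourier)

variable {n : ℕ} {f g : UnitAddTorus (Fin n) → ℂ}

theorem mFourier_torusMk (p : Fin n → ℤ) (y : Fin n → ℝ) :
    mFourier p (torusMk y) = Complex.exp (2 * Real.pi * Complex.I * ∑ j, (p j : ℂ) * y j) := by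
  simp only [mFourier, ContinuousMap.coe_mk, torusMk, fourier_coe_apply, ← Complex.exp_sum,
    Finset.mul_sum]
  congr 1
  exact Finset.sum_congr rfl fun j _ => by push_cast; ring

theorem norm_mFourier (p : Fin n → ℤ) (x : UnitAddTorus (Fin n)) : ‖mFourier p x‖ = 1 := by
  simp only [mFourier, fourier_apply, ContinuousMap.coe_mk, norm_prod, Circle.norm_coe,
    Finset.prod_const_one]

theorem mFourier_add_right (p : Fin n → ℤ) (x y : UnitAddTorus (Fin n)) :
    mFourier p (x + y) = mFourier p x * mFourier p y := by
  obtain ⟨x, rfl⟩ := torusMk_surjective x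
  obtain ⟨y, rfl⟩ := torusMk_surjective y
  have : torusMk x + torusMk y = torusMk (x + y) := by ext i; simp [torusMk]
  rw [this, mFourier_torusMk, mFourier_torusMk, mFourier_torusMk, ← Complex.exp_add]
  congr 1
  simp [mul_add, Finset.sum_add_distrib]

theorem mFourier_single (p : Fin n → ℤ) (j : Fin n) (t : ℝ) :
    mFourier p (Pi.single j (t : UnitAddCircle)) =
      Complex.exp (2 * Real.pi * Complex.I * (p j * t)) := by
  have : (Pi.single j (t : UnitAddCircle) : UnitAddTorus (Fin n)) = torusMk (Pi.single j t) := by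
    ext i
    rcases eq_or_ne i j with rfl | h
    · simp [torusMk]
    · simp [torusMk, h]
  rw [this, mFourier_torusMk, Finset.sum_eq_single j]
  · simp
  · intro i _ hi; simp [hi]
  · simp

/-- The Fourier coefficient `∫ f(x) e^{-2πi p·x} dx`. -/
def torusCoeff (f : UnitAddTorus (Fin n) → ℂ) (p : Fin n → ℤ) : ℂ :=
  ∫ x, mFourier (-p) x * f x ∂torusMeasure n

theorem torusCoeff_zero (f : UnitAddTorus (Fin n) → ℂ) :
    torusCoeff f 0 = ∫ x, f x ∂torusMeasure n := by
  simp [torusCoeff, UnitAddTorus.mFourier_zero]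

theorem norm_torusCoeff_le {C : ℝ} (h : ∀ x, ‖f x‖ ≤ C) (p : Fin n → ℤ) : ‖torusCoeff f p‖ ≤ C := by
  have := norm_integral_le_of_norm_le_const (μ := torusMeasure n)
    (f := fun x => mFourier (-p) x * f x) (C := C)
    (.of_forall fun x => by rw [norm_mul, norm_mFourier, one_mul]; exact h x)
  simpa [torusCoeff] using this

theorem integrable_mFourier_mul (hf : Continuous f) (p : Fin n → ℤ) :
    Integrable (fun x => mFourier p x * f x) (torusMeasure n) :=
  ((mFourier p).continuous.mul hf).integrable_of_hasCompactSupport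
    (HasCompactSupport.of_compactSpace _)

theorem torusCoeff_sub (hf : Continuous f) (hg : Continuous g) (p : Fin n → ℤ) :
    torusCoeff (fun x => f x - g x) p = torusCoeff f p - torusCoeff g p := by
  simp only [torusCoeff, mul_sub]
  exact integral_sub (integrable_mFourier_mul hf _) (integrable_mFourier_mul hg _)

theorem torusCoeff_const_mul (c : ℂ) (f : UnitAddTorus (Fin n) → ℂ) (p : Fin n → ℤ) :
    torusCoeff (fun x => c * f x) p = c * torusCoeff f p := by
  simp only [torusCoeff, mul_left_comm _ c]
  exact integral_const_mul c _

theorem torusCoeff_neg (f : UnitAddTorus (Fin n) → ℂ) (p : Fin n → ℤ) :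
    torusCoeff (fun x => -f x) p = -torusCoeff f p := by
  simpa using torusCoeff_const_mul (-1) f p

theorem torusCoeff_one (p : Fin n → ℤ) :
    torusCoeff (fun _ => (1 : ℂ)) p = if p = 0 then 1 else 0 := by
  have h := orthonormal_iff_ite.1 (UnitAddTorus.orthonormal_mFourier (d := Fin n)) p 0
  rw [ContinuousMap.inner_toLp] at h
  simp only [← UnitAddTorus.mFourier_neg, UnitAddTorus.mFourier_zero] at h
  refine Eq.trans ?_ h
  unfold torusCoeff
  refine integral_congr_ae (.of_forall fun x => ?_)
  simp [mul_comm]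

/-- Differentiation under the integral; the derivative is bounded by a constant because the torus is
compact. Compared with `integral_translate` at t = 0 this replaces integration by parts. -/
theorem hasDerivAt_integral_translate (hf : SmoothOnTorus f) (j : Fin n) (p : Fin n → ℤ) :
    HasDerivAt (fun t : ℝ => ∫ x, mFourier p x * f (x + Pi.single j (t : UnitAddCircle))
      ∂torusMeasure n)
      (∫ x, mFourier p x * (2 * (Real.pi : ℂ) * Complex.I * torusD j f x) ∂torusMeasure n) 0 := by
  obtain ⟨C, hC⟩ := (hf.torusD j).exists_bound
  set F : ℝ → UnitAddTorus (Fin n) → ℂ := fun t x =>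
    mFourier p x * f (x + Pi.single j (t : UnitAddCircle)) with hF
  set F' : ℝ → UnitAddTorus (Fin n) → ℂ := fun t x => mFourier p x *
    (2 * (Real.pi : ℂ) * Complex.I * torusD j f (x + Pi.single j (t : UnitAddCircle))) with hF'
  have hint : ∀ t, Integrable (F t) (torusMeasure n) := fun t =>
    integrable_mFourier_mul (hf.continuous.comp (continuous_id.add continuous_const)) p
  have hint' : Integrable (F' 0) (torusMeasure n) :=
    integrable_mFourier_mul (continuous_const.mul
      ((hf.torusD j).continuous.comp (continuous_id.add continuous_const))) p
  have hbd : ∀ x t, ‖F' t x‖ ≤ ‖2 * (Real.pi : ℂ) * Complex.I‖ * C := fun x t => by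
    rw [hF', norm_mul, norm_mFourier, one_mul, norm_mul]
    exact mul_le_mul_of_nonneg_left (hC _) (norm_nonneg _)
  have hder : ∀ x t, HasDerivAt (fun t => F t x) (F' t x) t := fun x t =>
    (hf.hasDerivAt j x t).const_mul _
  have h := (hasDerivAt_integral_of_dominated_loc_of_deriv_le (μ := torusMeasure n)
    (F := F) (F' := F') (x₀ := (0 : ℝ)) (s := Set.univ)
    (bound := fun _ => ‖2 * (Real.pi : ℂ) * Complex.I‖ * C)
    univ_mem (.of_forall fun t => (hint t).aestronglyMeasurable) (hint 0)
    hint'.aestronglyMeasurable (.of_forall fun x t _ => hbd x t) (integrable_const _)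
    (.of_forall fun x t _ => hder x t)).2
  simpa [hF, hF'] using h

theorem integral_translate (f : UnitAddTorus (Fin n) → ℂ) (j : Fin n) (p : Fin n → ℤ) (t : ℝ) :
    ∫ x, mFourier (-p) x * f (x + Pi.single j (t : UnitAddCircle)) ∂torusMeasure n =
      Complex.exp (2 * Real.pi * Complex.I * (p j * t)) * torusCoeff f p := by
  rw [torusCoeff, ← integral_const_mul, ← integral_add_right_eq_self (fun x =>
    Complex.exp (2 * Real.pi * Complex.I * (p j * t)) * (mFourier (-p) x * f x))
    (Pi.single j (t : UnitAddCircle))]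
  refine integral_congr_ae (.of_forall fun x => ?_)
  have : Complex.exp (2 * Real.pi * Complex.I * (p j * t)) *
      Complex.exp (2 * Real.pi * Complex.I * ((-p) j * t)) = 1 := by
    rw [← Complex.exp_add, ← Complex.exp_zero]
    congr 1
    simp
  change mFourier (-p) x * f (x + Pi.single j (t : UnitAddCircle)) =
    Complex.exp (2 * Real.pi * Complex.I * (p j * t)) *
      (mFourier (-p) (x + Pi.single j (t : UnitAddCircle)) * f (x + Pi.single j ↑t))
  rw [mFourier_add_right, mFourier_single]
  linear_combination (-(mFourier (-p) x * f (x + Pi.single j (t : UnitAddCircle)))) * this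

theorem torusCoeff_torusD (hf : SmoothOnTorus f) (j : Fin n) (p : Fin n → ℤ) :
    torusCoeff (torusD j f) p = p j * torusCoeff f p := by
  have h1 := hasDerivAt_integral_translate hf j (-p)
  simp only [integral_translate] at h1
  have h3 : HasDerivAt (fun t : ℝ => Complex.exp (2 * Real.pi * Complex.I * (p j * t)) *
      torusCoeff f p) (2 * Real.pi * Complex.I * p j * torusCoeff f p) 0 := by
    have : HasDerivAt (fun t : ℝ => 2 * Real.pi * Complex.I * (p j * (t : ℂ)))
        (2 * Real.pi * Complex.I * (p j * 1)) 0 :=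
      (Complex.ofRealCLM.hasDerivAt.const_mul _).const_mul _
    convert! this.cexp.mul_const (torusCoeff f p) using 1
    simp
  have hpi : 2 * (Real.pi : ℂ) * Complex.I ≠ 0 := by simp [Real.pi_ne_zero]
  refine mul_left_cancel₀ hpi ?_
  rw [← torusCoeff_const_mul, ← mul_assoc]
  exact h1.unique h3

theorem torusCoeff_torusD_iterate (hf : SmoothOnTorus f) (j : Fin n) (N : ℕ) (p : Fin n → ℤ) :
    torusCoeff ((torusD j)^[N] f) p = (p j : ℂ) ^ N * torusCoeff f p := by
  induction N with
  | zero => simp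
  | succ N ih =>
    rw [Function.iterate_succ_apply', torusCoeff_torusD (hf.torusD_iterate j N), ih, pow_succ]
    ring

theorem torusCoeff_torusDFalling_succ (hf : SmoothOnTorus f) (j : Fin n) (ℓ : ℕ)
    (p : Fin n → ℤ) : torusCoeff (torusDFalling j (ℓ + 1) f) p =
      (p j : ℂ) * torusCoeff (torusDFalling j ℓ f) p - ℓ * torusCoeff (torusDFalling j ℓ f) p := by
  have h := hf.torusDFalling j ℓ
  rw [← torusCoeff_torusD h, ← torusCoeff_const_mul,
    ← torusCoeff_sub (g := fun x => (ℓ : ℂ) * torusDFalling j ℓ f x) (h.torusD j).continuous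
      (continuous_const.mul h.continuous)]
  rfl

theorem torusDMulti_single (j : Fin n) (ℓ : ℕ) (f : UnitAddTorus (Fin n) → ℂ) :
    torusDMulti (Pi.single j ℓ) f = torusDFalling j ℓ f := by
  have key : ∀ l : List (Fin n), l.Nodup →
      l.foldr (fun i g => torusDFalling i ((Pi.single j ℓ : Fin n → ℕ) i) g) f =
        if j ∈ l then torusDFalling j ℓ f else f := by
    intro l hl
    induction l with
    | nil => rfl
    | cons i l ih =>
      rw [List.nodup_cons] at hl
      rw [List.foldr_cons, ih hl.2]
      rcases eq_or_ne i j with rfl | h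
      · simp [hl.1]
      · simp [h, h.symm, torusDFalling]
  unfold torusDMulti
  rw [key _ (List.nodup_finRange n), if_pos (List.mem_finRange j)]

theorem torusDMulti_zero (f : UnitAddTorus (Fin n) → ℂ) : torusDMulti 0 f = f := by
  unfold torusDMulti
  induction List.finRange n with
  | nil => rfl
  | cons i l ih => rw [List.foldr_cons, ih]; rfl

/-- The largest coordinate dominates: the bracket is at most (n + 1) max(1, |pⱼ|) for the maximising
j. Decay can thus be tested one coordinate at a time. -/
theorem bracket_pow_le (p : Fin n → ℤ) (N : ℕ) :
    bracket p ^ N ≤ (n + 1 : ℝ) ^ N * (1 + ∑ j, |(p j : ℝ)| ^ N) := by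
  have h0 : 0 ≤ ∑ j, |(p j : ℝ)| ^ N := Finset.sum_nonneg fun _ _ => by positivity
  rcases Nat.eq_zero_or_pos n with rfl | hn
  · simp [bracket]
  · have : Nonempty (Fin n) := ⟨⟨0, hn⟩⟩
    obtain ⟨j, -, hj⟩ := Finset.exists_max_image Finset.univ (fun j => |(p j : ℝ)|)
      Finset.univ_nonempty
    have h1 : bracket p ≤ (n + 1) * max 1 |(p j : ℝ)| := by
      have : ∑ i, |(p i : ℝ)| ≤ n * |(p j : ℝ)| := by
        simpa using Finset.sum_le_card_nsmul Finset.univ _ _ hj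
      have h2 := le_max_left 1 |(p j : ℝ)|
      have h3 := mul_le_mul_of_nonneg_left (le_max_right 1 |(p j : ℝ)|) (Nat.cast_nonneg (α := ℝ) n)
      unfold bracket
      linarith
    calc bracket p ^ N ≤ ((n + 1) * max 1 |(p j : ℝ)|) ^ N := by
          gcongr; exact (bracket_pos p).le
      _ = (n + 1 : ℝ) ^ N * max 1 |(p j : ℝ)| ^ N := mul_pow _ _ _
      _ ≤ _ := by
        gcongr
        rcases max_cases 1 |(p j : ℝ)| with ⟨h, -⟩ | ⟨h, -⟩
        · rw [h, one_pow]; linarith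
        · rw [h]
          have := Finset.single_le_sum (f := fun j => |(p j : ℝ)| ^ N) (fun _ _ => by positivity)
            (Finset.mem_univ j)
          linarith

/-- Decay in each coordinate direction gives rapid decay. -/
theorem rapidDecay_of_coord {U : (Fin n → ℤ) → ℝ} {a : (Fin n → ℤ) → (Fin n → ℤ) → ℂ}
    (h0 : ∃ C : ℝ, 0 ≤ C ∧ ∀ k p, ‖a k p‖ ≤ C * U k)
    (h : ∀ (j : Fin n) (N : ℕ), ∃ C : ℝ, 0 ≤ C ∧ ∀ k p, |(p j : ℝ)| ^ N * ‖a k p‖ ≤ C * U k) :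
    RapidDecay U a := by
  intro N
  obtain ⟨C₀, hC₀, h0⟩ := h0
  choose C hC h using fun j => h j N
  refine ⟨(n + 1 : ℝ) ^ N * (C₀ + ∑ j, C j),
    mul_nonneg (by positivity) (add_nonneg hC₀ (Finset.sum_nonneg fun j _ => hC j)),
    fun k p => ?_⟩
  calc ‖a k p‖ * bracket p ^ N ≤ ‖a k p‖ * ((n + 1 : ℝ) ^ N * (1 + ∑ j, |(p j : ℝ)| ^ N)) := by
        gcongr; exact bracket_pow_le p N
    _ = (n + 1 : ℝ) ^ N * (‖a k p‖ + ∑ j, |(p j : ℝ)| ^ N * ‖a k p‖) := by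
        rw [← Finset.sum_mul]; ring
    _ ≤ (n + 1 : ℝ) ^ N * (C₀ * U k + ∑ j, C j * U k) := by
        refine mul_le_mul_of_nonneg_left (add_le_add (h0 k p) ?_) (by positivity)
        exact Finset.sum_le_sum fun j _ => h j k p
    _ = _ := by rw [← Finset.sum_mul]; ring

/-- On coefficients, the falling derivative of order ℓ + 1 multiplies that of order ℓ by pⱼ - ℓ.
Hence a power of pⱼ is gained by induction, provided the claim is made for all ℓ at once; only
derivatives in a single variable enter. -/
theorem rapidDecay_torusCoeff_of_falling {U : (Fin n → ℤ) → ℝ}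
    {τ : (Fin n → ℤ) → UnitAddTorus (Fin n) → ℂ} (hτ : ∀ k, SmoothOnTorus (τ k))
    (h : ∀ β : Fin n → ℕ, ∃ C : ℝ, 0 < C ∧ ∀ k x, ‖torusDMulti β (τ k) x‖ ≤ C * U k) :
    RapidDecay U fun k => torusCoeff (τ k) := by
  refine rapidDecay_of_coord ?_ fun j N => ?_
  · obtain ⟨C, hC, h⟩ := h 0
    exact ⟨C, hC.le, fun k p => norm_torusCoeff_le (fun x => by
      simpa [torusDMulti_zero] using h k x) p⟩
  suffices H : ∀ (N ℓ : ℕ), ∃ C : ℝ, 0 ≤ C ∧ ∀ k p,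
      |(p j : ℝ)| ^ N * ‖torusCoeff (torusDFalling j ℓ (τ k)) p‖ ≤ C * U k from H N 0
  intro N
  induction N with
  | zero =>
    intro ℓ
    obtain ⟨C, hC, h⟩ := h (Pi.single j ℓ)
    refine ⟨C, hC.le, fun k p => ?_⟩
    rw [pow_zero, one_mul]
    exact norm_torusCoeff_le (fun x => by simpa [torusDMulti_single] using h k x) p
  | succ N ih =>
    intro ℓ
    obtain ⟨C, hC, h1⟩ := ih (ℓ + 1)
    obtain ⟨D, hD, h2⟩ := ih ℓ
    refine ⟨C + ℓ * D, by positivity, fun k p => ?_⟩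
    have e : (p j : ℂ) * torusCoeff (torusDFalling j ℓ (τ k)) p =
        torusCoeff (torusDFalling j (ℓ + 1) (τ k)) p +
          ℓ * torusCoeff (torusDFalling j ℓ (τ k)) p := by
      rw [torusCoeff_torusDFalling_succ (hτ k)]; ring
    have e' : |(p j : ℝ)| * ‖torusCoeff (torusDFalling j ℓ (τ k)) p‖ ≤
        ‖torusCoeff (torusDFalling j (ℓ + 1) (τ k)) p‖ +
          ℓ * ‖torusCoeff (torusDFalling j ℓ (τ k)) p‖ := by
      have := congrArg norm e
      rw [norm_mul, Complex.norm_intCast] at this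
      rw [this]
      exact (norm_add_le _ _).trans (by rw [norm_mul, Complex.norm_natCast])
    calc _ = |(p j : ℝ)| ^ N * (|(p j : ℝ)| * ‖torusCoeff (torusDFalling j ℓ (τ k)) p‖) := by ring
      _ ≤ |(p j : ℝ)| ^ N * (‖torusCoeff (torusDFalling j (ℓ + 1) (τ k)) p‖ +
          ℓ * ‖torusCoeff (torusDFalling j ℓ (τ k)) p‖) := by gcongr
      _ = |(p j : ℝ)| ^ N * ‖torusCoeff (torusDFalling j (ℓ + 1) (τ k)) p‖ +
          ℓ * (|(p j : ℝ)| ^ N * ‖torusCoeff (torusDFalling j ℓ (τ k)) p‖) := by ring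
      _ ≤ C * U k + ℓ * (D * U k) :=
        add_le_add (h1 k p) (mul_le_mul_of_nonneg_left (h2 k p) (Nat.cast_nonneg _))
      _ = _ := by ring

theorem rapidDecay_torusCoeff_of_uniformBound {τ : (Fin n → ℤ) → UnitAddTorus (Fin n) → ℂ}
    (hτ : ∀ k, SmoothOnTorus (τ k)) (h0 : ∃ C : ℝ, ∀ k x, ‖τ k x‖ ≤ C)
    (h : ∀ j s, UniformBound j s τ) : RapidDecay (fun _ => 1) fun k => torusCoeff (τ k) := by
  refine rapidDecay_of_coord ?_ fun j N => ?_
  · obtain ⟨C, hC⟩ := h0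
    exact ⟨max C 0, le_max_right _ _, fun k p => by
      rw [mul_one]; exact (norm_torusCoeff_le (hC k) p).trans (le_max_left _ _)⟩
  · obtain ⟨C, hC⟩ := h j N N le_rfl
    refine ⟨max C 0, le_max_right _ _, fun k p => ?_⟩
    have := norm_torusCoeff_le (hC k) p
    rw [torusCoeff_torusD_iterate (hτ k), norm_mul, norm_pow, Complex.norm_intCast] at this
    rw [mul_one]
    exact this.trans (le_max_left _ _)

/-! ### Fourier series with rapidly decaying coefficients -/

/-- Rapidly decaying functions on `ℤⁿ`. -/
def IsRapid (a : (Fin n → ℤ) → ℂ) : Prop := ∀ N : ℕ, ∃ C : ℝ, ∀ p, ‖a p‖ * bracket p ^ N ≤ C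

theorem RapidDecay.isRapid {U : (Fin n → ℤ) → ℝ} {a : (Fin n → ℤ) → (Fin n → ℤ) → ℂ}
    (h : RapidDecay U a) (k : Fin n → ℤ) : IsRapid (a k) := fun N => by
  obtain ⟨C, -, h⟩ := h N
  exact ⟨C * U k, h k⟩

/-- `∑ₚ a(p) e^{2πi p·x}`. -/
def torusSeries (a : (Fin n → ℤ) → ℂ) (x : UnitAddTorus (Fin n)) : ℂ := ∑' p, a p * mFourier p x

variable {a : (Fin n → ℤ) → ℂ}

theorem IsRapid.summable (ha : IsRapid a) : Summable a := by
  obtain ⟨C, h⟩ := ha (2 * n)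
  exact summable_of_bracket_bound h

theorem IsRapid.summable_mul_mFourier (ha : IsRapid a) (x : UnitAddTorus (Fin n)) :
    Summable fun p => a p * mFourier p x :=
  .of_norm_bounded ha.summable.norm fun p => by rw [norm_mul, norm_mFourier, mul_one]

theorem IsRapid.mul (ha : IsRapid a) {P : (Fin n → ℤ) → ℂ} {D : ℝ} {M : ℕ}
    (hP : ∀ p, ‖P p‖ ≤ D * bracket p ^ M) : IsRapid fun p => P p * a p := fun N => by
  obtain ⟨C, h⟩ := ha (M + N)
  have hD : 0 ≤ D := by simpa [bracket_zero] using (norm_nonneg _).trans (hP 0)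
  refine ⟨D * C, fun p => ?_⟩
  have := bracket_pos p
  calc ‖P p * a p‖ * bracket p ^ N ≤ (D * bracket p ^ M) * ‖a p‖ * bracket p ^ N := by
        rw [norm_mul]; gcongr; exact hP p
    _ = D * (‖a p‖ * bracket p ^ (M + N)) := by ring
    _ ≤ _ := mul_le_mul_of_nonneg_left (h p) hD

theorem IsRapid.sub {b : (Fin n → ℤ) → ℂ} (ha : IsRapid a) (hb : IsRapid b) : IsRapid (a - b) :=
  fun N => by
    obtain ⟨C, hC⟩ := ha N
    obtain ⟨D, hD⟩ := hb N
    refine ⟨C + D, fun p => le_trans ?_ (add_le_add (hC p) (hD p))⟩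
    rw [← add_mul]
    exact mul_le_mul_of_nonneg_right (norm_sub_le _ _) (pow_pos (bracket_pos p) N).le

theorem norm_coord_le (j : Fin n) (p : Fin n → ℤ) : ‖(p j : ℂ)‖ ≤ 1 * bracket p ^ 1 := by
  rw [Complex.norm_intCast, one_mul, pow_one]
  linarith [abs_le_bracket p j]

theorem IsRapid.coord_mul (ha : IsRapid a) (j : Fin n) : IsRapid fun p => (p j : ℂ) * a p :=
  ha.mul (norm_coord_le j)

theorem norm_torusSeries_le {C : ℝ} (h : ∀ p, ‖a p‖ * bracket p ^ (2 * n) ≤ C)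
    (x : UnitAddTorus (Fin n)) : ‖torusSeries a x‖ ≤ C * bracketSum n :=
  norm_tsum_le_of_bracket_bound fun p => by rw [norm_mul, norm_mFourier, mul_one]; exact h p

/-- The coordinate functionals of `ℝⁿ`. -/
def coordProj (j : Fin n) : (Fin n → ℝ) →L[ℝ] ℝ :=
  ContinuousLinearMap.proj (R := ℝ) (φ := fun _ : Fin n => ℝ) j

theorem coordProj_apply (j : Fin n) (y : Fin n → ℝ) : coordProj j y = y j := rfl

theorem hasFDerivAt_mFourier_torusMk (p : Fin n → ℤ) (y : Fin n → ℝ) :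
    HasFDerivAt (fun y => mFourier p (torusMk y)) (∑ j, (2 * Real.pi * Complex.I * p j *
      mFourier p (torusMk y)) • (Complex.ofRealCLM ∘L coordProj j)) y := by
  have h1 : HasFDerivAt (fun y : Fin n → ℝ => 2 * Real.pi * Complex.I * ∑ j, (p j : ℂ) * y j)
      ((2 * Real.pi * Complex.I : ℂ) • ∑ j, (p j : ℂ) •
        (Complex.ofRealCLM ∘L coordProj j)) y := by
    refine HasFDerivAt.const_mul (HasFDerivAt.fun_sum fun j _ => HasFDerivAt.const_mul ?_ _) _
    exact (Complex.ofRealCLM ∘L coordProj j).hasFDerivAt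
  have h2 := h1.cexp
  simp only [← mFourier_torusMk] at h2
  refine h2.congr_fderiv ?_
  rw [Finset.smul_sum, Finset.smul_sum]
  refine Finset.sum_congr rfl fun j _ => ?_
  rw [smul_smul, smul_smul]
  congr 1
  ring

theorem hasFDerivAt_torusSeries (ha : IsRapid a) (y : Fin n → ℝ) :
    HasFDerivAt (fun y => torusSeries a (torusMk y)) (∑ j, (2 * Real.pi * Complex.I *
      torusSeries (fun p => (p j : ℂ) * a p) (torusMk y)) •
        (Complex.ofRealCLM ∘L coordProj j)) y := by
  set L : Fin n → ((Fin n → ℝ) →L[ℝ] ℂ) := fun j =>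
    Complex.ofRealCLM ∘L coordProj j
  have hu : Summable fun p => ∑ j, ‖2 * Real.pi * Complex.I‖ * ‖(p j : ℂ) * a p‖ * ‖L j‖ :=
    summable_sum fun j _ => ((ha.coord_mul j).summable.norm.mul_left _).mul_right _
  have h1 := hasFDerivAt_tsum (𝕜 := ℝ) (f := fun p y => a p * mFourier p (torusMk y))
    (f' := fun p y => a p • ∑ j, (2 * Real.pi * Complex.I * p j * mFourier p (torusMk y)) • L j)
    hu (fun p y => (hasFDerivAt_mFourier_torusMk p y).const_mul (a p)) (fun p y => by
      rw [Finset.smul_sum]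
      refine (norm_sum_le _ _).trans (Finset.sum_le_sum fun j _ => le_of_eq ?_)
      rw [smul_smul, norm_smul]
      simp only [norm_mul, norm_mFourier]
      ring) (ha.summable_mul_mFourier (torusMk 0)) y
  refine h1.congr_fderiv (Eq.symm ?_)
  have h2 : ∀ j, HasSum (fun p => (a p * (2 * Real.pi * Complex.I * p j * mFourier p (torusMk y)))
      • L j) ((2 * Real.pi * Complex.I *
        torusSeries (fun p => (p j : ℂ) * a p) (torusMk y)) • L j) := fun j => by
    refine HasSum.smul_const ?_ _
    convert! (((ha.coord_mul j).summable_mul_mFourier (torusMk y)).hasSum.mul_left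
      (2 * Real.pi * Complex.I)) using 1
    ext p
    ring
  rw [← (hasSum_sum fun j (_ : j ∈ Finset.univ) => h2 j).tsum_eq]
  congr 1
  ext1 p
  rw [Finset.smul_sum]
  exact Finset.sum_congr rfl fun j _ => (smul_smul _ _ _).symm

/-- The derivative is again a combination of such series, with coefficients pⱼ a(p), which are still
rapidly decaying; so the order of differentiability can be raised inductively. -/
theorem smoothOnTorus_torusSeries (ha : IsRapid a) : SmoothOnTorus (torusSeries a) := by
  refine contDiff_infty.2 fun N => ?_
  change ContDiff ℝ N fun y => torusSeries a (torusMk y)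
  induction N generalizing a with
  | zero =>
    refine contDiff_zero.2 (Differentiable.continuous (𝕜 := ℝ) fun y => ?_)
    exact (hasFDerivAt_torusSeries ha y).differentiableAt
  | succ N ih =>
    push_cast
    refine contDiff_succ_iff_hasFDerivAt.2 ⟨_, ?_, hasFDerivAt_torusSeries ha⟩
    exact ContDiff.sum fun j _ => (contDiff_const.mul (ih (ha.coord_mul j))).smul contDiff_const

theorem torusD_torusSeries (ha : IsRapid a) (j : Fin n) :
    torusD j (torusSeries a) = torusSeries fun p => (p j : ℂ) * a p := by
  ext x
  obtain ⟨y, rfl⟩ := torusMk_surjective x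
  rw [torusD_torusMk_of_hasFDerivAt (hasFDerivAt_torusSeries ha y)]
  rw [_root_.sum_apply, Finset.sum_eq_single j]
  · have : 2 * (Real.pi : ℂ) * Complex.I ≠ 0 := by simp [Real.pi_ne_zero]
    simp only [_root_.smul_apply, ContinuousLinearMap.comp_apply, coordProj_apply,
      Pi.single_eq_same, Complex.ofRealCLM_apply, Complex.ofReal_one, smul_eq_mul, mul_one]
    rw [← mul_assoc, one_div_mul_cancel this, one_mul]
  · intro i _ hi; simp [hi, coordProj_apply]
  · simp

theorem torusD_iterate_torusSeries (ha : IsRapid a) (j : Fin n) (N : ℕ) :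
    (torusD j)^[N] (torusSeries a) = torusSeries fun p => (p j : ℂ) ^ N * a p := by
  induction N generalizing a with
  | zero => simp
  | succ N ih =>
    rw [Function.iterate_succ_apply, torusD_torusSeries ha, ih (ha.coord_mul j)]
    congr 1
    ext p
    ring

theorem torusSeries_sub {b : (Fin n → ℤ) → ℂ} (ha : IsRapid a) (hb : IsRapid b)
    (x : UnitAddTorus (Fin n)) :
    torusSeries (fun p => a p - b p) x = torusSeries a x - torusSeries b x := by
  rw [torusSeries, torusSeries, torusSeries,
    ← (ha.summable_mul_mFourier x).tsum_sub (hb.summable_mul_mFourier x)]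
  simp only [sub_mul]

theorem torusSeries_const_mul (c : ℂ) (a : (Fin n → ℤ) → ℂ) (x : UnitAddTorus (Fin n)) :
    torusSeries (fun p => c * a p) x = c * torusSeries a x := by
  simp only [torusSeries, mul_assoc, tsum_mul_left]

/-- The multiplier is pⱼ(pⱼ - 1)⋯(pⱼ - ℓ + 1); only its polynomial growth matters later, and it must
not depend on the series. -/
theorem exists_torusDFalling_torusSeries (j : Fin n) (ℓ : ℕ) :
    ∃ (P : (Fin n → ℤ) → ℂ) (D : ℝ) (M : ℕ), (∀ p, ‖P p‖ ≤ D * bracket p ^ M) ∧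
      ∀ a : (Fin n → ℤ) → ℂ, IsRapid a →
        torusDFalling j ℓ (torusSeries a) = torusSeries fun p => P p * a p := by
  induction ℓ with
  | zero => exact ⟨fun _ => 1, 1, 0, by simp, fun a _ => by simp [torusDFalling]⟩
  | succ ℓ ih =>
    obtain ⟨P, D, M, hP, h⟩ := ih
    refine ⟨fun p => ((p j : ℂ) - ℓ) * P p, (1 + ℓ) * D, M + 1, fun p => ?_, fun a ha => ?_⟩
    · have h1 := one_le_bracket p
      have h2 := norm_coord_le j p
      have h3 : ‖(p j : ℂ) - ℓ‖ ≤ (1 + ℓ) * bracket p := by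
        refine (norm_sub_le _ _).trans ?_
        rw [Complex.norm_natCast]
        nlinarith [Nat.cast_nonneg (α := ℝ) ℓ]
      calc _ ≤ ((1 + ℓ) * bracket p) * (D * bracket p ^ M) := by
            rw [norm_mul]
            exact mul_le_mul h3 (hP p) (norm_nonneg _) (by positivity)
        _ = _ := by ring
    · have hr := ha.mul hP
      ext x
      rw [torusDFalling, h a ha, torusD_torusSeries hr]
      change torusSeries _ x - (ℓ : ℂ) * torusSeries _ x = _
      rw [← torusSeries_const_mul,
        ← torusSeries_sub (hr.coord_mul j) (hr.mul (P := fun _ => (ℓ : ℂ)) (D := ℓ) (M := 0)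
          (by simp))]
      congr 1
      ext p
      ring

/-- `D^{(β)}` acts on Fourier series through a polynomially bounded multiplier. -/
theorem exists_torusDMulti_torusSeries (β : Fin n → ℕ) :
    ∃ (P : (Fin n → ℤ) → ℂ) (D : ℝ) (M : ℕ), (∀ p, ‖P p‖ ≤ D * bracket p ^ M) ∧
      ∀ a : (Fin n → ℤ) → ℂ, IsRapid a →
        torusDMulti β (torusSeries a) = torusSeries fun p => P p * a p := by
  unfold torusDMulti
  induction List.finRange n with
  | nil => exact ⟨fun _ => 1, 1, 0, by simp, fun a _ => by simp⟩
  | cons j l ih =>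
    obtain ⟨P, D, M, hP, h⟩ := ih
    obtain ⟨Q, D', M', hQ, h'⟩ := exists_torusDFalling_torusSeries j (β j)
    refine ⟨fun p => Q p * P p, D' * D, M' + M, fun p => ?_, fun a ha => ?_⟩
    · have := bracket_pos p
      calc _ ≤ (D' * bracket p ^ M') * (D * bracket p ^ M) := by
            rw [norm_mul]
            exact mul_le_mul (hQ p) (hP p) (norm_nonneg _) ((norm_nonneg _).trans (hQ p))
        _ = _ := by ring
    · rw [List.foldr_cons, h a ha, h' _ (ha.mul hP)]
      congr 1
      ext p
      ring

/-- Bounds for the symbol from rapid decay of the coefficients. -/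
theorem RapidDecay.exists_torusDMulti_bound {U : (Fin n → ℤ) → ℝ}
    {a : (Fin n → ℤ) → (Fin n → ℤ) → ℂ} (hU : ∀ k, 0 ≤ U k) (ha : RapidDecay U a)
    (β : Fin n → ℕ) :
    ∃ C : ℝ, 0 < C ∧ ∀ k x, ‖torusDMulti β (torusSeries (a k)) x‖ ≤ C * U k := by
  obtain ⟨P, D, M, hP, h⟩ := exists_torusDMulti_torusSeries β
  obtain ⟨C, hC, hb⟩ := ha (M + 2 * n)
  have hD : 0 ≤ D := by simpa [bracket_zero] using (norm_nonneg _).trans (hP 0)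
  have hS := bracketSum_nonneg (n := n)
  refine ⟨D * C * bracketSum n + 1, by positivity, fun k x => ?_⟩
  rw [h _ (ha.isRapid k)]
  refine (norm_torusSeries_le (C := D * (C * U k)) (fun p => ?_) x).trans ?_
  · have := bracket_pos p
    calc _ ≤ (D * bracket p ^ M) * ‖a k p‖ * bracket p ^ (2 * n) := by
          rw [norm_mul]; gcongr; exact hP p
      _ = D * (‖a k p‖ * bracket p ^ (M + 2 * n)) := by ring
      _ ≤ _ := mul_le_mul_of_nonneg_left (hb k p) hD
  · nlinarith [hU k]

theorem torusSeries_torusCoeff (hf : SmoothOnTorus f) (h : IsRapid (torusCoeff f)) :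
    torusSeries (torusCoeff f) = f := by
  ext x
  have h1 := UnitAddTorus.hasSum_mFourier_series_apply_of_summable (f := ⟨f, hf.continuous⟩)
    h.summable x
  exact h1.tsum_eq

/-- Absolute convergence of the series and boundedness of g allow termwise integration. The constant
case g = 1 recovers the coefficients, the general case turns products into convolutions. -/
theorem torusCoeff_torusSeries_mul (ha : IsRapid a) (hg : Continuous g) (r : Fin n → ℤ) :
    torusCoeff (fun x => torusSeries a x * g x) r = ∑' p, a p * torusCoeff g (r - p) := by
  obtain ⟨C, hC⟩ := isCompact_univ.exists_bound_of_continuousOn hg.continuousOn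
  have h1 := hasSum_integral_of_summable_integral_norm (μ := torusMeasure n)
    (F := fun p x => a p * (mFourier (-(r - p)) x * g x))
    (fun p => (integrable_mFourier_mul hg _).const_mul _) ?_
  · simp only [integral_const_mul] at h1
    rw [torusCoeff]
    simp only [torusCoeff]
    rw [h1.tsum_eq]
    congr 1
    ext x
    rw [torusSeries, ← mul_assoc, mul_comm _ (tsum _), mul_assoc, ← tsum_mul_right]
    congr 1
    ext p
    rw [neg_sub, sub_eq_neg_add, add_comm, UnitAddTorus.mFourier_add]
    ring
  · refine .of_nonneg_of_le (fun p => integral_nonneg fun _ => norm_nonneg _) (fun p => ?_)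
      (ha.summable.norm.mul_right C)
    refine (integral_mono_of_nonneg (.of_forall fun _ => norm_nonneg _)
      (integrable_const (‖a p‖ * C)) (.of_forall fun x => ?_)).trans (by simp)
    simp only [norm_mul, norm_mFourier, one_mul]
    gcongr
    exact hC x (Set.mem_univ x)

theorem torusCoeff_torusSeries (ha : IsRapid a) : torusCoeff (torusSeries a) = a := by
  ext r
  have := torusCoeff_torusSeries_mul ha (continuous_const (y := (1 : ℂ))) r
  simp only [mul_one, torusCoeff_one] at this
  rw [this, tsum_eq_single r]
  · simp
  · intro p hp
    rw [if_neg (sub_ne_zero.2 hp.symm), mul_zero]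

/-- The coefficients of a product of symbols. -/
theorem torusCoeff_mul {τ τ' : (Fin n → ℤ) → UnitAddTorus (Fin n) → ℂ}
    (hτ : ∀ k, SmoothOnTorus (τ k)) (hτ' : ∀ k, SmoothOnTorus (τ' k))
    (h : ∀ k, IsRapid (torusCoeff (τ k))) :
    (fun k => torusCoeff fun x => τ k x * τ' k x) =
      coefMul 0 (fun k => torusCoeff (τ k)) fun k => torusCoeff (τ' k) := by
  ext k r
  have := torusCoeff_torusSeries_mul (h k) (hτ' k).continuous r
  rw [torusSeries_torusCoeff (hτ k) (h k)] at this
  simpa [coefMul] using this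

end Fourier

/-! ### Weight functions -/

section Weights

variable {n : ℕ}

theorem abs_le_latticeNorm (k : Fin n → ℤ) (j : Fin n) : |(k j : ℝ)| ≤ latticeNorm k := by
  rw [latticeNorm, ← Real.sqrt_sq_eq_abs]
  exact Real.sqrt_le_sqrt (Finset.single_le_sum (f := fun i => (k i : ℝ) ^ 2)
    (fun _ _ => sq_nonneg _) (Finset.mem_univ j))

theorem latticeNorm_nonneg (k : Fin n → ℤ) : 0 ≤ latticeNorm k := Real.sqrt_nonneg _

theorem bracket_le_latticeNorm (k : Fin n → ℤ) : bracket k ≤ (n + 1) * (1 + latticeNorm k) := by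
  have h : ∑ j, |(k j : ℝ)| ≤ n * latticeNorm k := by
    simpa using Finset.sum_le_card_nsmul Finset.univ _ _ fun j _ => abs_le_latticeNorm k j
  have := latticeNorm_nonneg k
  unfold bracket
  nlinarith [Nat.cast_nonneg (α := ℝ) n]

theorem abs_rpow_sub_one_le {s X : ℝ} (hs : 0 < s) :
    ∃ K : ℝ, 0 ≤ K ∧ ∀ x, 0 < x → x ≤ X → |x ^ s - 1| ≤ K * |x - 1| := by
  have h1 : ∀ m : ℕ, ∃ K : ℝ, 0 ≤ K ∧ ∀ x, 0 < x → x ≤ X → |x ^ m - 1| ≤ K * |x - 1| := by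
    intro m
    induction m with
    | zero => exact ⟨0, le_rfl, by simp⟩
    | succ m ih =>
      obtain ⟨K, hK, h⟩ := ih
      refine ⟨max X 0 * K + 1, by positivity, fun x hx hX => ?_⟩
      calc |x ^ (m + 1) - 1| = |x * (x ^ m - 1) + (x - 1)| := by congr 1; ring
        _ ≤ |x| * |x ^ m - 1| + |x - 1| := (abs_add_le _ _).trans (by rw [abs_mul])
        _ ≤ max X 0 * (K * |x - 1|) + |x - 1| := by
          refine add_le_add ?_ le_rfl
          refine mul_le_mul ?_ (h x hx hX) (abs_nonneg _) (le_max_right _ _)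
          rw [abs_of_pos hx]
          exact hX.trans (le_max_left _ _)
        _ = _ := by ring
  -- On each side of 1 the quantity |x^s - 1| increases with s, so the natural exponent ⌈s⌉
  -- dominates.
  obtain ⟨K, hK, h⟩ := h1 ⌈s⌉₊
  refine ⟨K, hK, fun x hx hX => le_trans ?_ (h x hx hX)⟩
  have hle : s ≤ (⌈s⌉₊ : ℝ) := Nat.le_ceil s
  rw [← Real.rpow_natCast]
  rcases le_total 1 x with hx1 | hx1
  · have h2 := Real.rpow_le_rpow_of_exponent_le hx1 hle
    have h3 := Real.one_le_rpow hx1 hs.le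
    rw [abs_of_nonneg (by linarith), abs_of_nonneg (by linarith)]
    linarith
  · have h2 := Real.rpow_le_rpow_of_exponent_ge hx hx1 hle
    have h3 := Real.rpow_le_one hx.le hx1 hs.le
    rw [abs_of_nonpos (by linarith), abs_of_nonpos (by linarith)]
    linarith

variable {μ₀ μ₁ μ ρ : ℝ} {Λ : (Fin n → ℤ) → ℝ}

theorem IsWeight.exists_lower (h : IsWeight μ₀ μ₁ μ Λ) : ∃ c : ℝ, 0 < c ∧ ∀ k,
    c * bracket k ^ μ₀ ≤ Λ k := by
  obtain ⟨C₀, _, hC₀, -, hb⟩ := h.growth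
  refine ⟨C₀ / (n + 1 : ℝ) ^ μ₀, by positivity, fun k => le_trans ?_ (hb k).1⟩
  have h1 : bracket k ^ μ₀ ≤ (n + 1 : ℝ) ^ μ₀ * (1 + latticeNorm k) ^ μ₀ := by
    rw [← Real.mul_rpow (by positivity) (by have := latticeNorm_nonneg k; positivity)]
    exact Real.rpow_le_rpow (bracket_pos k).le (bracket_le_latticeNorm k) h.pos.le
  rw [div_mul_eq_mul_div, div_le_iff₀ (by positivity)]
  calc _ ≤ C₀ * ((n + 1 : ℝ) ^ μ₀ * (1 + latticeNorm k) ^ μ₀) :=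
        mul_le_mul_of_nonneg_left h1 hC₀.le
    _ = _ := by ring

theorem IsWeight.exists_lower_const (h : IsWeight μ₀ μ₁ μ Λ) : ∃ c : ℝ, 0 < c ∧ ∀ k, c ≤ Λ k := by
  obtain ⟨c, hc, hb⟩ := h.exists_lower
  refine ⟨c, hc, fun k => le_trans ?_ (hb k)⟩
  have := Real.one_le_rpow (one_le_bracket k) h.pos.le
  nlinarith

theorem IsWeight.apply_pos (h : IsWeight μ₀ μ₁ μ Λ) (k : Fin n → ℤ) : 0 < Λ k := by
  obtain ⟨c, hc, hb⟩ := h.exists_lower_const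
  exact hc.trans_le (hb k)

/-- From Λ ≥ c · bracket^{μ₀} the choice t = N/μ₀ suffices. Through this bound order -∞ in Λ becomes
decay faster than every power of |k|. -/
theorem IsWeight.rpow_neg_le (h : IsWeight μ₀ μ₁ μ Λ) (N : ℕ) : ∃ (t C : ℝ), 0 ≤ t ∧ 0 ≤ C ∧ ∀ k,
    Λ k ^ (-t) ≤ C * (bracket k ^ N)⁻¹ := by
  obtain ⟨c, hc, hb⟩ := h.exists_lower
  have h0 := h.pos
  refine ⟨N / μ₀, c ^ (-(N / μ₀ : ℝ)), by positivity, by positivity, fun k => ?_⟩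
  have hk := bracket_pos k
  calc Λ k ^ (-(N / μ₀ : ℝ)) ≤ (c * bracket k ^ μ₀) ^ (-(N / μ₀ : ℝ)) :=
        Real.rpow_le_rpow_of_nonpos (by positivity) (hb k) (by simp; positivity)
    _ = c ^ (-(N / μ₀ : ℝ)) * (bracket k ^ μ₀) ^ (-(N / μ₀ : ℝ)) :=
        Real.mul_rpow hc.le (by positivity)
    _ = _ := by
        rw [← Real.rpow_mul hk.le, mul_neg, mul_div_cancel₀ _ h0.ne', Real.rpow_neg hk.le,
          Real.rpow_natCast]

/-- The bound |ΔⱼΛ| ≤ C Λ^{1-1/μ} makes Λ^{1/μ} Lipschitz on the lattice. A Lipschitz function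
bounded below by a positive constant changes under translation by p by at most a multiple of the
bracket of p; raising to the power μ gives the claim. -/
theorem IsWeight.slowlyVarying (h : IsWeight μ₀ μ₁ μ Λ) : SlowlyVarying Λ := by
  have hμ : 0 < μ := h.pos.trans_le (h.le_mid.trans h.le_top)
  have hs : 0 < 1 / μ := by positivity
  obtain ⟨c, hc, hlow⟩ := h.exists_lower_const
  have hpos := h.apply_pos
  have hd : ∀ j : Fin n, ∃ C : ℝ, 0 < C ∧ ∀ k,
      |Λ (k + Pi.single j 1) - Λ k| ≤ C * Λ k ^ (1 - 1 / μ) := fun j => by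
    obtain ⟨C, hC, hb⟩ := h.diff_bound (Pi.single j 1) 0 (by simp)
    refine ⟨C, hC, fun k => ?_⟩
    simpa [latticeDiff_single, order_single, fwdDiff] using hb k
  choose C hC hd using hd
  have hlip : ∀ j : Fin n, ∃ K : ℝ, 0 ≤ K ∧ ∀ k,
      |Λ (k + Pi.single j 1) ^ (1 / μ) - Λ k ^ (1 / μ)| ≤ K := fun j => by
    -- The number X bounds the ratio x = Λ(k + eⱼ)/Λ(k): |x - 1| ≤ Cⱼ Λ(k)^{-1/μ}, and Λ is at least
    -- c.
    obtain ⟨K, hK, hKb⟩ := abs_rpow_sub_one_le (X := 1 + C j * c ^ (-(1 / μ))) hs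
    refine ⟨K * C j, mul_nonneg hK (hC j).le, fun k => ?_⟩
    have hk := hpos k
    set x := Λ (k + Pi.single j 1) / Λ k with hx
    have hx0 : 0 < x := div_pos (hpos _) hk
    have hx1 : |x - 1| ≤ C j * Λ k ^ (-(1 / μ)) := by
      have : x - 1 = (Λ (k + Pi.single j 1) - Λ k) / Λ k := by rw [hx]; field_simp
      rw [this, abs_div, abs_of_pos hk, div_le_iff₀ hk, mul_assoc, ← Real.rpow_add_one hk.ne']
      rw [neg_add_eq_sub]
      exact hd j k
    have hx2 : x ≤ 1 + C j * c ^ (-(1 / μ)) := by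
      have h1 := (le_abs_self _).trans hx1
      have h2 := mul_le_mul_of_nonneg_left (Real.rpow_le_rpow_of_nonpos hc (hlow k)
        (neg_nonpos.2 hs.le)) (hC j).le
      linarith
    have h3 : Λ (k + Pi.single j 1) ^ (1 / μ) = Λ k ^ (1 / μ) * x ^ (1 / μ) := by
      rw [← Real.mul_rpow hk.le hx0.le, hx, mul_div_cancel₀ _ hk.ne']
    have hL : 0 < Λ k ^ (1 / μ) := Real.rpow_pos_of_pos hk _
    calc |Λ (k + Pi.single j 1) ^ (1 / μ) - Λ k ^ (1 / μ)|
        = Λ k ^ (1 / μ) * |x ^ (1 / μ) - 1| := by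
          rw [h3, ← mul_sub_one, abs_mul, abs_of_pos hL]
      _ ≤ Λ k ^ (1 / μ) * (K * (C j * Λ k ^ (-(1 / μ)))) := by
          refine mul_le_mul_of_nonneg_left ((hKb x hx0 hx2).trans ?_) hL.le
          exact mul_le_mul_of_nonneg_left hx1 hK
      _ = K * C j := by
          rw [Real.rpow_neg hk.le]
          field_simp
  choose K hK hlip using hlip
  have hF : SlowlyVarying fun k => Λ k ^ (1 / μ) := by
    refine ⟨fun k => Real.rpow_pos_of_pos (hpos k) _, ?_⟩
    set D := ∑ j, K j
    have hD : 0 ≤ D := Finset.sum_nonneg fun j _ => hK j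
    have hc' : 0 < c ^ (1 / μ) := Real.rpow_pos_of_pos hc _
    refine ⟨1 + D / c ^ (1 / μ), 1, by positivity, fun k p => ?_⟩
    have h1 := norm_translate_sub_le (F := fun k => ((Λ k ^ (1 / μ) : ℝ) : ℂ)) (M := 0) hD k
      (fun q j => by
        rw [← Complex.ofReal_sub, Complex.norm_real, Real.norm_eq_abs, pow_zero, mul_one]
        exact (hlip j _).trans (Finset.single_le_sum (fun j _ => hK j) (Finset.mem_univ j))) p
    rw [← Complex.ofReal_sub, Complex.norm_real, Real.norm_eq_abs] at h1
    have h2 := (le_abs_self _).trans h1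
    have h3 : c ^ (1 / μ) ≤ Λ k ^ (1 / μ) := Real.rpow_le_rpow hc.le (hlow k) hs.le
    have h4 := one_le_bracket p
    have h5 : D ≤ D / c ^ (1 / μ) * Λ k ^ (1 / μ) := by
      rw [div_mul_eq_mul_div, le_div_iff₀ hc']
      exact mul_le_mul_of_nonneg_left h3 hD
    have h6 := Real.rpow_pos_of_pos (hpos k) (1 / μ)
    simp only [zero_add, pow_one] at h2 ⊢
    nlinarith [mul_le_mul_of_nonneg_right h5 (bracket_pos p).le,
      mul_le_mul_of_nonneg_right h4 h6.le]
  convert hF.rpow μ using 2 with k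
  rw [← Real.rpow_mul (hpos k).le, one_div_mul_cancel hμ.ne', Real.rpow_one]

/-! ### The weight family of the class `M⁰` -/

/-- `Λ^{-ρ}`. -/
def weightGain (ρ : ℝ) (Λ : (Fin n → ℤ) → ℝ) (k : Fin n → ℤ) : ℝ := Λ k ^ (-ρ)

/-- `min (Λ^{-ρ}, (1 + |kⱼ|)⁻¹)`. -/
def coordGain (ρ : ℝ) (Λ : (Fin n → ℤ) → ℝ) (j : Fin n) (k : Fin n → ℤ) : ℝ :=
  min (weightGain ρ Λ k) (1 + |(k j : ℝ)|)⁻¹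

/-- The bound for the `ℓ`-th difference in the `j`-th coordinate of a symbol in `M⁰`. -/
def diffGain (ρ : ℝ) (Λ : (Fin n → ℤ) → ℝ) (j : Fin n) : ℕ → (Fin n → ℤ) → ℝ
  | 0, _ => 1
  | ℓ + 1, k => weightGain ρ Λ k ^ ℓ * coordGain ρ Λ j k

/-- Weights which use `Λ^{-ρ}` in the coordinates in `s` and `diffGain` in the others. -/
def partGain (ρ : ℝ) (Λ : (Fin n → ℤ) → ℝ) (s : Finset (Fin n)) (α : Fin n → ℕ)
    (k : Fin n → ℤ) : ℝ :=
  ∏ j, if j ∈ s then weightGain ρ Λ k ^ α j else diffGain ρ Λ j (α j) k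

theorem weightGain_pos (hΛ : SlowlyVarying Λ) (k : Fin n → ℤ) : 0 < weightGain ρ Λ k :=
  Real.rpow_pos_of_pos (hΛ.pos k) _

theorem coordGain_pos (hΛ : SlowlyVarying Λ) (j : Fin n) (k : Fin n → ℤ) :
    0 < coordGain ρ Λ j k :=
  lt_min (weightGain_pos hΛ k) (by positivity)

theorem coordGain_le (j : Fin n) (k : Fin n → ℤ) : coordGain ρ Λ j k ≤ weightGain ρ Λ k :=
  min_le_left _ _

theorem diffGain_pos (hΛ : SlowlyVarying Λ) (j : Fin n) (ℓ : ℕ) (k : Fin n → ℤ) :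
    0 < diffGain ρ Λ j ℓ k := by
  cases ℓ with
  | zero => exact one_pos
  | succ ℓ => exact mul_pos (pow_pos (weightGain_pos hΛ k) _) (coordGain_pos hΛ j k)

theorem diffGain_le (hΛ : SlowlyVarying Λ) (j : Fin n) (ℓ : ℕ) (k : Fin n → ℤ) :
    diffGain ρ Λ j ℓ k ≤ weightGain ρ Λ k ^ ℓ := by
  cases ℓ with
  | zero => simp [diffGain]
  | succ ℓ =>
    rw [diffGain, pow_succ]
    exact mul_le_mul_of_nonneg_left (coordGain_le j k) (pow_pos (weightGain_pos hΛ k) _).le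

theorem slowlyVarying_weightGain (hΛ : SlowlyVarying Λ) : SlowlyVarying (weightGain ρ Λ) :=
  hΛ.rpow _

theorem slowlyVarying_diffGain (hΛ : SlowlyVarying Λ) (j : Fin n) (ℓ : ℕ) :
    SlowlyVarying (diffGain ρ Λ j ℓ) := by
  cases ℓ with
  | zero => exact .const one_pos
  | succ ℓ =>
    exact ((slowlyVarying_weightGain hΛ).pow ℓ).mul
      ((slowlyVarying_weightGain hΛ).min (SlowlyVarying.one_add_abs j).inv)

/-- If both orders are positive, the product has two coordinate gains where only one is wanted. The
other is weakened to Λ^{-ρ}, which is possible because the coordinate gain is a minimum with Λ^{-ρ}.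
-/
theorem diffGain_mul_le (hΛ : SlowlyVarying Λ) (j : Fin n) (a b : ℕ) (k : Fin n → ℤ) :
    diffGain ρ Λ j a k * diffGain ρ Λ j b k ≤ diffGain ρ Λ j (a + b) k := by
  rcases a with _ | a
  · simp [diffGain]
  rcases b with _ | b
  · simp [diffGain]
  rw [show a + 1 + (b + 1) = a + b + 1 + 1 by ring]
  simp only [diffGain]
  have h1 := weightGain_pos (ρ := ρ) hΛ k
  have h2 := coordGain_pos (ρ := ρ) hΛ j k
  calc _ = weightGain ρ Λ k ^ (a + b) * coordGain ρ Λ j k * coordGain ρ Λ j k := by ring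
    _ ≤ weightGain ρ Λ k ^ (a + b) * coordGain ρ Λ j k * weightGain ρ Λ k :=
        mul_le_mul_of_nonneg_left (coordGain_le j k) (by positivity)
    _ = _ := by ring

/-- The bounds for the differences of symbols in `M⁰`. -/
def symbolGain (ρ : ℝ) (Λ : (Fin n → ℤ) → ℝ) : (Fin n → ℕ) → (Fin n → ℤ) → ℝ := partGain ρ Λ ∅

theorem symbolGain_eq (α : Fin n → ℕ) (k : Fin n → ℤ) :
    symbolGain ρ Λ α k = ∏ j, diffGain ρ Λ j (α j) k := by simp [symbolGain, partGain]

theorem isWeightFamily_symbolGain (hΛ : SlowlyVarying Λ) : IsWeightFamily (symbolGain ρ Λ) where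
  slow α := by
    simpa only [← symbolGain_eq] using
      SlowlyVarying.prod Finset.univ fun j => slowlyVarying_diffGain (ρ := ρ) hΛ j (α j)
  mul_le α β k := by
    simp only [symbolGain_eq, ← Finset.prod_mul_distrib]
    exact Finset.prod_le_prod (fun j _ => (mul_pos (diffGain_pos hΛ _ _ _)
      (diffGain_pos hΛ _ _ _)).le) fun j _ => diffGain_mul_le hΛ _ _ _ _

theorem symbolGain_zero : symbolGain ρ Λ 0 = fun _ => 1 := by
  ext k
  simp [symbolGain_eq, diffGain]

theorem symbolGain_single_le (j : Fin n) (k : Fin n → ℤ) :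
    symbolGain ρ Λ (Pi.single j 1) k ≤ weightGain ρ Λ k := by
  rw [symbolGain_eq, Finset.prod_eq_single j]
  · simpa [diffGain] using coordGain_le j k
  · intro i _ hi; simp [hi, diffGain]
  · simp

theorem partGain_univ (α : Fin n → ℕ) (k : Fin n → ℤ) :
    partGain ρ Λ Finset.univ α k = weightGain ρ Λ k ^ order α := by
  simp [partGain, Finset.prod_pow_eq_pow_sum, order]

theorem partGain_pos (hΛ : SlowlyVarying Λ) (s : Finset (Fin n)) (α : Fin n → ℕ)
    (k : Fin n → ℤ) : 0 < partGain ρ Λ s α k :=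
  Finset.prod_pos fun j _ => by
    split_ifs
    · exact pow_pos (weightGain_pos hΛ k) _
    · exact diffGain_pos hΛ _ _ _

theorem partGain_eq_mul_prod (s : Finset (Fin n)) (j : Fin n) (α : Fin n → ℕ) (k : Fin n → ℤ) :
    partGain ρ Λ s α k =
      (if j ∈ s then weightGain ρ Λ k ^ α j else diffGain ρ Λ j (α j) k) *
        ∏ i ∈ Finset.univ.erase j,
          if i ∈ s then weightGain ρ Λ k ^ α i else diffGain ρ Λ i (α i) k :=
  (Finset.mul_prod_erase _ _ (Finset.mem_univ j)).symm

/-- All four weights have the same factors P off the coordinate j, so comparisons reduce to the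
single factor at j. -/
theorem exists_partGain_eq (hΛ : SlowlyVarying Λ) {s : Finset (Fin n)} {j : Fin n} (hj : j ∉ s)
    (α : Fin n → ℕ) (k : Fin n → ℤ) : ∃ P : ℝ, 0 ≤ P ∧
      partGain ρ Λ (insert j s) α k = weightGain ρ Λ k ^ α j * P ∧
      partGain ρ Λ (insert j s) (α + Pi.single j 1) k = weightGain ρ Λ k ^ (α j + 1) * P ∧
      partGain ρ Λ s α k = diffGain ρ Λ j (α j) k * P ∧
      partGain ρ Λ s (α + Pi.single j 1) k =
        weightGain ρ Λ k ^ α j * coordGain ρ Λ j k * P := by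
  refine ⟨∏ i ∈ Finset.univ.erase j,
    if i ∈ s then weightGain ρ Λ k ^ α i else diffGain ρ Λ i (α i) k,
    Finset.prod_nonneg fun i _ => ?_, ?_, ?_, ?_, ?_⟩
  · split_ifs
    · exact (pow_pos (weightGain_pos hΛ k) _).le
    · exact (diffGain_pos hΛ _ _ _).le
  all_goals
    rw [partGain_eq_mul_prod _ j]
    congr 1
    · simp [hj, diffGain]
  · refine Finset.prod_congr rfl fun i hi => ?_
    simp [Finset.ne_of_mem_erase hi]
  · refine Finset.prod_congr rfl fun i hi => ?_
    simp [Finset.ne_of_mem_erase hi]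
  · refine Finset.prod_congr rfl fun i hi => ?_
    simp [Finset.ne_of_mem_erase hi]

end Weights

/-! ### Differences of `kⱼ Δⱼ f` -/

section Euler

variable {n : ℕ}

/-- `kⱼ Δⱼ a`. -/
def eulerDiff (j : Fin n) (a : (Fin n → ℤ) → (Fin n → ℤ) → ℂ) (k p : Fin n → ℤ) : ℂ :=
  (k j : ℂ) * fwdDiff (Pi.single j 1) a k p

/-- Iterating Δⱼ(kⱼ g) = kⱼ Δⱼ g + g(· + eⱼ) leaves αⱼ copies of Δ^α a translated by eⱼ, and a
translate is Δⱼ plus the identity. -/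
theorem latticeDiff_eulerDiff (j : Fin n) (a : (Fin n → ℤ) → (Fin n → ℤ) → ℂ) (α : Fin n → ℕ) :
    latticeDiff α (eulerDiff j a) = fun k p =>
      (k j : ℂ) * latticeDiff (α + Pi.single j 1) a k p +
        α j * (latticeDiff (α + Pi.single j 1) a k p + latticeDiff α a k p) := by
  induction α using multiindex_induction with
  | h0 =>
    ext k p
    simp [latticeDiff_zero, latticeDiff_single, eulerDiff]
  | h1 α i ih =>
    rw [latticeDiff_add_single', ih]
    have e : latticeDiff (α + Pi.single i 1 + Pi.single j 1) a =
        fwdDiff (Pi.single i 1) (latticeDiff (α + Pi.single j 1) a) := by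
      rw [add_right_comm, latticeDiff_add_single']
    rw [e]
    rcases eq_or_ne i j with rfl | h
    · ext k p
      simp only [fwdDiff, latticeDiff_add_single', Pi.sub_apply, Pi.add_apply, Pi.single_eq_same]
      push_cast
      ring
    · ext k p
      rw [latticeDiff_add_single' α i]
      simp only [fwdDiff, Pi.sub_apply, Pi.add_apply, Pi.single_eq_of_ne h.symm, add_zero]
      ring

variable {V V' : (Fin n → ℕ) → (Fin n → ℤ) → ℝ} {a : (Fin n → ℤ) → (Fin n → ℤ) → ℂ}

theorem RapidDecay.const_mul {U : (Fin n → ℤ) → ℝ} (ha : RapidDecay U a) (c : ℂ) :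
    RapidDecay U fun k p => c * a k p := fun N => by
  obtain ⟨C, hC, h⟩ := ha N
  refine ⟨‖c‖ * C, by positivity, fun k p => ?_⟩
  calc _ = ‖c‖ * (‖a k p‖ * bracket p ^ N) := by rw [norm_mul]; ring
    _ ≤ ‖c‖ * (C * U k) := mul_le_mul_of_nonneg_left (h k p) (norm_nonneg _)
    _ = _ := by ring

theorem rapidDecay_latticeDiff_eulerDiff {j : Fin n} {α : Fin n → ℕ} {U : (Fin n → ℤ) → ℝ}
    (h0 : RapidDecay U (latticeDiff α a))
    (h1 : RapidDecay U (latticeDiff (α + Pi.single j 1) a))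
    (h2 : RapidDecay U fun k p => (k j : ℂ) * latticeDiff (α + Pi.single j 1) a k p) :
    RapidDecay U (latticeDiff α (eulerDiff j a)) := by
  rw [latticeDiff_eulerDiff]
  exact h2.add ((h1.add h0).const_mul _)

theorem RapidDecay.coord_mul_latticeDiff {j : Fin n} {α : Fin n → ℕ} {U : (Fin n → ℤ) → ℝ}
    (h0 : RapidDecay U (LatticePDO.latticeDiff α a))
    (h1 : RapidDecay U (LatticePDO.latticeDiff (α + Pi.single j 1) a))
    (h2 : RapidDecay U (LatticePDO.latticeDiff α (eulerDiff j a))) :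
    RapidDecay U fun k p => (k j : ℂ) * LatticePDO.latticeDiff (α + Pi.single j 1) a k p := by
  convert h2.sub ((h1.add h0).const_mul (α j : ℂ)) using 1
  ext k p
  rw [latticeDiff_eulerDiff]
  simp

theorem RapidDecay.mul_min {j : Fin n} {U U' u : (Fin n → ℤ) → ℝ} (hU : ∀ k, 0 ≤ U k)
    (hu : ∀ k, 0 ≤ u k) (h1 : RapidDecay (fun k => U k * u k) a) (h2 : RapidDecay U fun k p => (k j : ℂ) * a k p)
    (h3 : RapidDecay U a) (hU' : ∀ k, U' k = U k * min (u k) (1 + |(k j : ℝ)|)⁻¹) :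
    RapidDecay U' a := fun N => by
  obtain ⟨C₁, hC₁, h1⟩ := h1 N
  obtain ⟨C₂, hC₂, h2⟩ := h2 N
  obtain ⟨C₃, hC₃, h3⟩ := h3 N
  refine ⟨C₁ + (C₂ + C₃), by positivity, fun k p => ?_⟩
  have h4 : ‖a k p‖ * bracket p ^ N * (1 + |(k j : ℝ)|) ≤ (C₂ + C₃) * U k := by
    have := h2 k p
    rw [norm_mul, Complex.norm_intCast] at this
    linarith [h3 k p]
  have h5 : 0 < 1 + |(k j : ℝ)| := by positivity
  rw [← le_div_iff₀ h5] at h4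
  have hk := hU k
  rw [hU' k]
  rcases min_cases (u k) (1 + |(k j : ℝ)|)⁻¹ with ⟨h, h'⟩ | ⟨h, h'⟩
  · rw [h]
    have h6 := h1 k p
    have h8 := mul_nonneg hk (hu k)
    nlinarith
  · rw [h]
    have h9 : 0 ≤ U k * (1 + |(k j : ℝ)|)⁻¹ := by positivity
    rw [mul_div_assoc, div_eq_mul_inv] at h4
    nlinarith

/-- `k^γ Δ^γ a`. -/
def eulerMulti (γ : Fin n → ℕ) (a : (Fin n → ℤ) → (Fin n → ℤ) → ℂ) (k p : Fin n → ℤ) : ℂ :=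
  (∏ i, (k i : ℂ) ^ γ i) * latticeDiff γ a k p

theorem eulerMulti_zero (a : (Fin n → ℤ) → (Fin n → ℤ) → ℂ) : eulerMulti 0 a = a := by
  ext k p
  simp [eulerMulti, latticeDiff_zero]

/-- As γⱼ = 0, the monomial k^γ is unaffected by translation along eⱼ and passes through Δⱼ. -/
theorem eulerMulti_add_single {γ : Fin n → ℕ} {j : Fin n} (hγ : γ j = 0)
    (a : (Fin n → ℤ) → (Fin n → ℤ) → ℂ) :
    eulerMulti (γ + Pi.single j 1) a = eulerDiff j (eulerMulti γ a) := by
  ext k p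
  have h1 : ∏ i, (k i : ℂ) ^ (γ + Pi.single j 1 : Fin n → ℕ) i = (k j : ℂ) * ∏ i, (k i : ℂ) ^ γ i := by
    simp only [Pi.add_apply, pow_add, Finset.prod_mul_distrib]
    rw [mul_comm, Finset.prod_eq_single j (by intro i _ hi; simp [hi]) (by simp)]
    simp
  have h2 : ∏ i, ((k + Pi.single j 1 : Fin n → ℤ) i : ℂ) ^ γ i = ∏ i, (k i : ℂ) ^ γ i := by
    refine Finset.prod_congr rfl fun i _ => ?_
    rcases eq_or_ne i j with rfl | h
    · simp [hγ]
    · simp [h]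
  simp only [eulerMulti, eulerDiff, h1, latticeDiff_add_single', fwdDiff, Pi.sub_apply, h2]
  ring

theorem norm_prod_pow_le (γ : Fin n → ℕ) (k : Fin n → ℤ) :
    ‖∏ i, (k i : ℂ) ^ γ i‖ ≤ bracket k ^ order γ := by
  rw [norm_prod, order, ← Finset.prod_pow_eq_pow_sum]
  refine Finset.prod_le_prod (fun _ _ => norm_nonneg _) fun i _ => ?_
  rw [norm_pow, Complex.norm_intCast]
  exact pow_le_pow_left₀ (abs_nonneg _) (by linarith [abs_le_bracket k i]) _

theorem IsSmoothing.eulerMulti (ha : IsSmoothing a) (γ : Fin n → ℕ) :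
    IsSmoothing (eulerMulti γ a) :=
  (ha.latticeDiff γ).mul_left (slowlyVarying_bracket.pow (order γ)) (norm_prod_pow_le γ)

variable {ρ : ℝ} {Λ : (Fin n → ℤ) → ℝ}

/-- Removing a coordinate from the set in which only `Λ^{-ρ}` is gained. -/
theorem rapidDecay_partGain_of_insert (hΛ : SlowlyVarying Λ)
    {D : ℝ} (hD : 0 ≤ D) (hgD : ∀ k, weightGain ρ Λ k ≤ D) {s : Finset (Fin n)} {j : Fin n}
    (hj : j ∉ s) (h0 : ∀ α, RapidDecay (partGain ρ Λ (insert j s) α) (latticeDiff α a))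
    (h1 : ∀ α, RapidDecay (partGain ρ Λ (insert j s) α) (latticeDiff α (eulerDiff j a)))
    (α : Fin n → ℕ) : RapidDecay (partGain ρ Λ s α) (latticeDiff α a) := by
  rcases Nat.eq_zero_or_pos (α j) with hα | hα
  · refine (h0 α).mono one_pos.le fun k => ?_
    obtain ⟨P, -, e1, -, e2, -⟩ := exists_partGain_eq (ρ := ρ) hΛ hj α k
    simp [e1, e2, hα, diffGain]
  -- For αⱼ > 0 write α = β + eⱼ. The Leibniz formula recovers kⱼ Δ^α a from Δ^β(kⱼ Δⱼ a), which
  -- provides the gain (1 + |kⱼ|)⁻¹; the gain Λ^{-ρ} is the bound for Δ^α a itself.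
  · obtain ⟨β, rfl⟩ : ∃ β : Fin n → ℕ, α = β + Pi.single j 1 := by
      refine ⟨Function.update α j (α j - 1), ?_⟩
      ext i
      rcases eq_or_ne i j with rfl | h
      · simp; omega
      · simp [h]
    have e : ∀ k, partGain ρ Λ (insert j s) (β + Pi.single j 1) k =
        partGain ρ Λ (insert j s) β k * weightGain ρ Λ k := fun k => by
      obtain ⟨P, -, e1, e1', -⟩ := exists_partGain_eq (ρ := ρ) hΛ hj β k
      rw [e1, e1']; ring
    have h2 : RapidDecay (partGain ρ Λ (insert j s) β) (latticeDiff (β + Pi.single j 1) a) :=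
      (h0 _).mono hD fun k => by
        rw [e, mul_comm D]
        exact mul_le_mul_of_nonneg_left (hgD k) (partGain_pos hΛ _ _ _).le
    refine RapidDecay.mul_min (j := j) (fun k => (partGain_pos hΛ _ _ _).le)
      (fun k => (weightGain_pos (ρ := ρ) hΛ k).le) ((h0 _).mono one_pos.le fun k => by rw [e, one_mul])
      ((h0 β).coord_mul_latticeDiff h2 (h1 β)) h2 fun k => ?_
    obtain ⟨P, -, e1, -, -, e2⟩ := exists_partGain_eq (ρ := ρ) hΛ hj β k
    rw [e1, e2, coordGain]
    ring

theorem rapidDecay_partGain_insert (hΛ : SlowlyVarying Λ) {s : Finset (Fin n)} {j : Fin n}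
    (hj : j ∉ s) (h : ∀ α, RapidDecay (partGain ρ Λ s α) (latticeDiff α a)) (α : Fin n → ℕ) :
    RapidDecay (partGain ρ Λ (insert j s) α) (latticeDiff α a) := by
  refine (h α).mono one_pos.le fun k => ?_
  obtain ⟨P, hP, e1, -, e2, -⟩ := exists_partGain_eq (ρ := ρ) hΛ hj α k
  rw [e1, e2, one_mul]
  exact mul_le_mul_of_nonneg_right (diffGain_le hΛ _ _ _) hP

/-- The factor kⱼ consumes the gain (1 + |kⱼ|)⁻¹ available at α + eⱼ and leaves Λ^{-ραⱼ}. The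
coordinate j is thereby moved into the set where only powers of Λ^{-ρ} are claimed. -/
theorem rapidDecay_partGain_eulerDiff (hΛ : SlowlyVarying Λ) {D : ℝ} (hD : 0 ≤ D)
    (hgD : ∀ k, weightGain ρ Λ k ≤ D) {s : Finset (Fin n)} {j : Fin n}
    (hj : j ∉ s) (h : ∀ α, RapidDecay (partGain ρ Λ s α) (latticeDiff α a)) (α : Fin n → ℕ) :
    RapidDecay (partGain ρ Λ (insert j s) α) (latticeDiff α (eulerDiff j a)) := by
  refine rapidDecay_latticeDiff_eulerDiff (rapidDecay_partGain_insert hΛ hj h α) ?_ ?_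
  · refine (rapidDecay_partGain_insert hΛ hj h _).mono hD fun k => ?_
    obtain ⟨P, hP, e1, e1', -⟩ := exists_partGain_eq (ρ := ρ) hΛ hj α k
    rw [e1, e1', pow_succ]
    calc _ = weightGain ρ Λ k ^ α j * P * weightGain ρ Λ k := by ring
      _ ≤ weightGain ρ Λ k ^ α j * P * D := mul_le_mul_of_nonneg_left (hgD k)
          (mul_nonneg (pow_pos (weightGain_pos hΛ k) _).le hP)
      _ = _ := by ring
  · have h1 := (h (α + Pi.single j 1)).mul_left (u := fun k => (k j : ℂ))
      (V := fun k => 1 + |(k j : ℝ)|) (fun k => by rw [Complex.norm_intCast]; linarith)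
    refine h1.mono one_pos.le fun k => ?_
    obtain ⟨P, hP, e1, -, -, e2⟩ := exists_partGain_eq (ρ := ρ) hΛ hj α k
    rw [e1, e2, one_mul]
    have h2 : 0 < 1 + |(k j : ℝ)| := by positivity
    have h3 : (1 + |(k j : ℝ)|) * coordGain ρ Λ j k ≤ 1 :=
      (mul_le_mul_of_nonneg_left (min_le_right _ _) h2.le).trans_eq (mul_inv_cancel₀ h2.ne')
    calc _ = weightGain ρ Λ k ^ α j * P * ((1 + |(k j : ℝ)|) * coordGain ρ Λ j k) := by ring
      _ ≤ weightGain ρ Λ k ^ α j * P * 1 := mul_le_mul_of_nonneg_left h3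
          (mul_nonneg (pow_pos (weightGain_pos hΛ k) _).le hP)
      _ = _ := by ring

/-- The two descriptions of the coefficients of symbols in `M⁰`. -/
theorem rapidDecay_symbolGain_iff (hΛ : SlowlyVarying Λ) {D : ℝ} (hD : 0 ≤ D)
    (hgD : ∀ k, weightGain ρ Λ k ≤ D) :
    (∀ α, RapidDecay (symbolGain ρ Λ α) (latticeDiff α a)) ↔
      ∀ γ : Fin n → ℕ, (∀ i, γ i ≤ 1) → ∀ α,
        RapidDecay (fun k => weightGain ρ Λ k ^ order α) (latticeDiff α (eulerMulti γ a)) := by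
  constructor
  · intro h
    -- Here s contains the coordinates in which γ may equal 1. For s = ∅ only γ = 0 occurs, and each
    -- new coordinate is spent on one factor kⱼ Δⱼ.
    suffices H : ∀ (s : Finset (Fin n)) (γ : Fin n → ℕ), (∀ i, γ i ≤ 1) → (∀ i, i ∉ s → γ i = 0) →
        ∀ α, RapidDecay (partGain ρ Λ s α) (latticeDiff α (eulerMulti γ a)) by
      intro γ hγ α
      have := H Finset.univ γ hγ (by simp) α
      rwa [show partGain ρ Λ Finset.univ α = fun k => weightGain ρ Λ k ^ order α from
        funext fun k => partGain_univ α k] at this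
    intro s
    induction s using Finset.induction_on with
    | empty =>
      intro γ _ hγ α
      obtain rfl : γ = 0 := funext fun i => hγ i (by simp)
      rw [eulerMulti_zero]
      exact h α
    | insert j s hj ih =>
      intro γ h1 hγ α
      rcases Nat.eq_zero_or_pos (γ j) with h0 | h0
      · exact rapidDecay_partGain_insert hΛ hj (ih γ h1 fun i hi => by
          rcases eq_or_ne i j with rfl | hij
          · exact h0
          · exact hγ i (by simp [hij, hi])) α
      · obtain ⟨β, hβj, rfl⟩ : ∃ β : Fin n → ℕ, β j = 0 ∧ γ = β + Pi.single j 1 := by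
          have := h1 j
          refine ⟨Function.update γ j 0, by simp, ?_⟩
          ext i
          rcases eq_or_ne i j with rfl | h
          · simp; omega
          · simp [h]
        rw [eulerMulti_add_single hβj]
        refine rapidDecay_partGain_eulerDiff hΛ hD hgD hj (ih β (fun i => ?_) fun i hi => ?_) α
        · exact (Nat.le_add_right _ _).trans (h1 i)
        · rcases eq_or_ne i j with rfl | hij
          · exact hβj
          · simpa [hij] using hγ i (by simp [hij, hi])
  · intro h
    -- Conversely the improved gain is recovered one coordinate at a time: s is the set of
    -- coordinates already treated, and γ vanishes there. Treating j uses the bounds for both γ and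
    -- γ + eⱼ.
    suffices H : ∀ (s : Finset (Fin n)) (γ : Fin n → ℕ), (∀ i, γ i ≤ 1) → (∀ i, i ∈ s → γ i = 0) →
        ∀ α, RapidDecay (partGain ρ Λ sᶜ α) (latticeDiff α (eulerMulti γ a)) by
      intro α
      simpa [eulerMulti_zero, symbolGain] using H Finset.univ 0 (by simp) (by simp) α
    intro s
    induction s using Finset.induction_on with
    | empty =>
      intro γ hγ _ α
      have : partGain ρ Λ (∅ : Finset (Fin n))ᶜ α = fun k => weightGain ρ Λ k ^ order α := by
        ext k
        rw [Finset.compl_empty, partGain_univ]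
      rw [this]
      exact h γ hγ α
    | insert j s hj ih =>
      intro γ h1 hγ α
      have hγj := hγ j (by simp)
      have e : sᶜ = insert j (insert j s)ᶜ := by
        ext i
        rcases eq_or_ne i j with rfl | h
        · simp [hj]
        · simp [h]
      rw [e] at ih
      refine rapidDecay_partGain_of_insert hΛ hD hgD (by simp) (ih γ h1 fun i hi =>
        hγ i (by simp [hi])) (fun α => ?_) α
      rw [← eulerMulti_add_single hγj]
      refine ih _ (fun i => ?_) (fun i hi => ?_) α
      · rcases eq_or_ne i j with rfl | h
        · simp [hγj]
        · simpa [h] using h1 i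
      · have : i ≠ j := fun h => hj (h ▸ hi)
        simpa [this] using hγ i (by simp [hi])

end Euler

/-! ### Symbols and coefficients -/

section Symbols

variable {n : ℕ} {ρ m : ℝ} {Λ : (Fin n → ℤ) → ℝ} {a : (Fin n → ℤ) → (Fin n → ℤ) → ℂ}
  {σ : (Fin n → ℤ) → UnitAddTorus (Fin n) → ℂ}

/-- The Fourier coefficients in `x` of a symbol. -/
def symbolCoeff (σ : (Fin n → ℤ) → UnitAddTorus (Fin n) → ℂ) : (Fin n → ℤ) → (Fin n → ℤ) → ℂ :=
  fun k => torusCoeff (σ k)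

/-- The symbol with given Fourier coefficients. -/
def coeffSymbol (a : (Fin n → ℤ) → (Fin n → ℤ) → ℂ) : (Fin n → ℤ) → UnitAddTorus (Fin n) → ℂ :=
  fun k => torusSeries (a k)

theorem smooth_latticeDiff (hσ : ∀ k, SmoothOnTorus (σ k)) (α : Fin n → ℕ) (k : Fin n → ℤ) :
    SmoothOnTorus (latticeDiff α σ k) := by
  induction α using multiindex_induction generalizing k with
  | h0 => rw [latticeDiff_zero]; exact hσ k
  | h1 α j ih => rw [latticeDiff_add_single']; exact (ih _).sub (ih _)

theorem symbolCoeff_latticeDiff (hσ : ∀ k, SmoothOnTorus (σ k)) (α : Fin n → ℕ) :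
    symbolCoeff (latticeDiff α σ) = latticeDiff α (symbolCoeff σ) := by
  induction α using multiindex_induction with
  | h0 => simp only [latticeDiff_zero]
  | h1 α j ih =>
    rw [latticeDiff_add_single', latticeDiff_add_single', ← ih]
    ext k p
    exact torusCoeff_sub (smooth_latticeDiff hσ α _).continuous
      (smooth_latticeDiff hσ α _).continuous p

theorem isRapid_latticeDiff (ha : ∀ k, IsRapid (a k)) (α : Fin n → ℕ) (k : Fin n → ℤ) :
    IsRapid (latticeDiff α a k) := by
  induction α using multiindex_induction generalizing k with
  | h0 => rw [latticeDiff_zero]; exact ha k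
  | h1 α j ih => rw [latticeDiff_add_single']; exact (ih _).sub (ih _)

theorem latticeDiff_coeffSymbol (ha : ∀ k, IsRapid (a k)) (α : Fin n → ℕ) :
    latticeDiff α (coeffSymbol a) = coeffSymbol (latticeDiff α a) := by
  induction α using multiindex_induction with
  | h0 => simp only [latticeDiff_zero]
  | h1 α j ih =>
    rw [latticeDiff_add_single', latticeDiff_add_single', ih]
    ext k x
    exact (torusSeries_sub (isRapid_latticeDiff ha α _) (isRapid_latticeDiff ha α _) x).symm

theorem symbolCoeff_coeffSymbol (ha : ∀ k, IsRapid (a k)) : symbolCoeff (coeffSymbol a) = a :=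
  funext fun k => torusCoeff_torusSeries (ha k)

theorem IsSSymbol.rapidDecay (h : IsSSymbol ρ Λ m σ) (α : Fin n → ℕ) :
    RapidDecay (fun k => Λ k ^ (m - ρ * order α)) (latticeDiff α (symbolCoeff σ)) := by
  rw [← symbolCoeff_latticeDiff h.1]
  exact rapidDecay_torusCoeff_of_falling (smooth_latticeDiff h.1 α) fun β => h.2 α β

theorem isSSymbol_coeffSymbol (hΛ : ∀ k, 0 < Λ k) (ha : ∀ k, IsRapid (a k))
    (h : ∀ α, RapidDecay (fun k => Λ k ^ (m - ρ * order α)) (latticeDiff α a)) :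
    IsSSymbol ρ Λ m (coeffSymbol a) := by
  refine ⟨fun k => smoothOnTorus_torusSeries (ha k), fun α β => ?_⟩
  rw [latticeDiff_coeffSymbol ha]
  exact (h α).exists_torusDMulti_bound (fun k => (Real.rpow_pos_of_pos (hΛ k) _).le) β

theorem IsMSymbol.rapidDecay (h : IsMSymbol ρ Λ m σ) {γ : Fin n → ℕ} (hγ : ∀ i, γ i ≤ 1)
    (α : Fin n → ℕ) : RapidDecay (fun k => Λ k ^ (m - ρ * order α))
      (latticeDiff α (eulerMulti γ (symbolCoeff σ))) := by
  convert (h.2 γ hγ).rapidDecay α using 2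
  ext k p
  rw [eulerMulti, ← symbolCoeff_latticeDiff h.1]
  exact (torusCoeff_const_mul _ _ _).symm

theorem isMSymbol_coeffSymbol (hΛ : ∀ k, 0 < Λ k) (ha : ∀ k, IsRapid (a k))
    (h : ∀ γ : Fin n → ℕ, (∀ i, γ i ≤ 1) → ∀ α,
      RapidDecay (fun k => Λ k ^ (m - ρ * order α)) (latticeDiff α (eulerMulti γ a))) :
    IsMSymbol ρ Λ m (coeffSymbol a) := by
  refine ⟨fun k => smoothOnTorus_torusSeries (ha k), fun γ hγ => ?_⟩
  convert isSSymbol_coeffSymbol hΛ (a := eulerMulti γ a) (fun k => ?_) (h γ hγ) using 1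
  · ext k x
    rw [latticeDiff_coeffSymbol ha]
    exact (torusSeries_const_mul _ _ _).symm
  · exact (isRapid_latticeDiff ha γ k).mul (P := fun _ => ∏ i, (k i : ℂ) ^ γ i)
      (D := ‖∏ i, (k i : ℂ) ^ γ i‖) (M := 0) (by simp)

theorem rpow_zero_sub (hΛ : SlowlyVarying Λ) (N : ℕ) (k : Fin n → ℤ) :
    Λ k ^ (0 - ρ * (N : ℝ)) = weightGain ρ Λ k ^ N := by
  rw [weightGain, ← Real.rpow_natCast, ← Real.rpow_mul (hΛ.pos k).le, zero_sub, neg_mul]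

variable {μ₀ μ₁ μ : ℝ}

theorem IsWeight.exists_weightGain_le (h : IsWeight μ₀ μ₁ μ Λ) (hρ : 0 ≤ ρ) :
    ∃ D : ℝ, 0 ≤ D ∧ ∀ k, weightGain ρ Λ k ≤ D := by
  obtain ⟨c, hc, hb⟩ := h.exists_lower_const
  exact ⟨c ^ (-ρ), by positivity, fun k =>
    Real.rpow_le_rpow_of_nonpos hc (hb k) (neg_nonpos.2 hρ)⟩

theorem IsMSymbol.rapidDecay_symbolGain (hΛ : IsWeight μ₀ μ₁ μ Λ) (hρ : 0 ≤ ρ)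
    (h : IsMSymbol ρ Λ 0 σ) (α : Fin n → ℕ) :
    RapidDecay (symbolGain ρ Λ α) (latticeDiff α (symbolCoeff σ)) := by
  obtain ⟨D, hD, hg⟩ := hΛ.exists_weightGain_le hρ
  refine (rapidDecay_symbolGain_iff hΛ.slowlyVarying hD hg).2 (fun γ hγ α => ?_) α
  simpa only [rpow_zero_sub hΛ.slowlyVarying] using h.rapidDecay hγ α

theorem isMSymbol_zero_coeffSymbol (hΛ : IsWeight μ₀ μ₁ μ Λ) (hρ : 0 ≤ ρ)
    (h : ∀ α, RapidDecay (symbolGain ρ Λ α) (latticeDiff α a)) :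
    IsMSymbol ρ Λ 0 (coeffSymbol a) := by
  obtain ⟨D, hD, hg⟩ := hΛ.exists_weightGain_le hρ
  have h0 := h 0
  rw [latticeDiff_zero] at h0
  refine isMSymbol_coeffSymbol hΛ.apply_pos h0.isRapid fun γ hγ α => ?_
  simpa only [rpow_zero_sub hΛ.slowlyVarying] using
    (rapidDecay_symbolGain_iff hΛ.slowlyVarying hD hg).1 h γ hγ α

theorem IsSmoothing.isMSymbol (ha : IsSmoothing a) (hΛ : SlowlyVarying Λ) :
    IsMSymbol ρ Λ m (coeffSymbol a) :=
  isMSymbol_coeffSymbol hΛ.pos (ha 0).isRapid fun γ _ α =>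
    ((ha.eulerMulti γ).latticeDiff α).rapidDecay (hΛ.rpow _)

/-- Only γ = 0 and α = 0 are needed: differences and polynomial factors in k preserve smoothing
coefficients, so the remaining bounds follow from these. -/
theorem isSmoothing_symbolCoeff (hΛ : IsWeight μ₀ μ₁ μ Λ) (h : ∀ m, IsMSymbol ρ Λ m σ) :
    IsSmoothing (symbolCoeff σ) := fun N => by
  obtain ⟨t, C, -, hC, hb⟩ := hΛ.rpow_neg_le N
  have h1 := (h (-t)).rapidDecay (γ := 0) (by simp) 0
  rw [latticeDiff_zero, eulerMulti_zero] at h1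
  simp only [order_zero, Nat.cast_zero, mul_zero, sub_zero] at h1
  exact h1.mono hC hb

theorem coeffSymbol_symbolCoeff (hσ : ∀ k, SmoothOnTorus (σ k))
    (h : ∀ k, IsRapid (symbolCoeff σ k)) : coeffSymbol (symbolCoeff σ) = σ :=
  funext fun k => torusSeries_torusCoeff (hσ k) (h k)

theorem isSchwartz_of_isSmoothing (hσ : ∀ k, SmoothOnTorus (σ k))
    (h : IsSmoothing (symbolCoeff σ)) : IsSchwartz σ := by
  refine ⟨hσ, fun α β δ => ?_⟩
  have hr := (h 0).isRapid
  obtain ⟨C, hC, hb⟩ := ((h.latticeDiff δ) (order α)).exists_torusDMulti_bound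
    (fun k => by have := bracket_pos k; positivity) β
  refine ⟨C, fun k x => ?_⟩
  have h1 := hb k x
  have h2 := pow_pos (bracket_pos k) (order α)
  rw [← coeffSymbol_symbolCoeff hσ hr, latticeDiff_coeffSymbol hr, norm_mul]
  refine (mul_le_mul (norm_prod_pow_le α k) h1 (norm_nonneg _) h2.le).trans (le_of_eq ?_)
  field_simp

end Symbols

/-! ### Operators on `ℓ²(ℤⁿ)` and their coefficients -/

section Operators

variable {n : ℕ}

/-- The standard basis vectors of `ℓ²(ℤⁿ)`. -/
def basisVec (l : Fin n → ℤ) : EllTwo n := lp.single 2 l (1 : ℂ)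

theorem basisVec_apply (l k : Fin n → ℤ) : basisVec l k = if k = l then (1 : ℂ) else 0 := by
  rw [basisVec, lp.single_apply, Pi.single_apply]

theorem norm_basisVec (l : Fin n → ℤ) : ‖basisVec l‖ = 1 := by
  rw [basisVec, lp.norm_single (by norm_num), norm_one]

theorem hasSum_smul_basisVec (f : EllTwo n) : HasSum (fun l => f l • basisVec l) f := by
  convert! lp.hasSum_single (by norm_num) f using 2 with l
  rw [basisVec, ← lp.single_smul, smul_eq_mul, mul_one]

theorem inner_basisVec (l : Fin n → ℤ) (f : EllTwo n) : ⟪basisVec l, f⟫_ℂ = f l := by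
  rw [basisVec, lp.inner_single_left]
  simp

theorem norm_le_tsum_norm {f : EllTwo n} {C : ℝ} (h : ∀ k, ‖f k‖ * bracket k ^ (2 * n) ≤ C) :
    ‖f‖ ≤ C * bracketSum n := by
  rw [← (hasSum_smul_basisVec f).tsum_eq]
  exact norm_tsum_le_of_bracket_bound fun k => by
    rw [norm_smul, norm_basisVec, mul_one]; exact h k

theorem hasSum_apply (T : EllTwo n →L[ℂ] EllTwo n) (f : EllTwo n) (k : Fin n → ℤ) :
    HasSum (fun l => f l * T (basisVec l) k) (T f k) := by
  have h := ((lp.evalCLM ℂ (fun _ : Fin n → ℤ => ℂ) 2 k).comp T).hasSum (hasSum_smul_basisVec f)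
  convert! h using 2 with l
  exact (((lp.evalCLM ℂ (fun _ : Fin n → ℤ => ℂ) 2 k).comp T).map_smul (f l) (basisVec l)).symm

/-- The coefficients `a(k,p)` of `T f(k) = ∑ₚ a(k,p) f(k+p)`. -/
def opCoeff (T : EllTwo n →L[ℂ] EllTwo n) (k p : Fin n → ℤ) : ℂ := T (basisVec (k + p)) k

theorem opCoeff_add (S T : EllTwo n →L[ℂ] EllTwo n) : opCoeff (S + T) = opCoeff S + opCoeff T :=
  rfl

theorem opCoeff_sub (S T : EllTwo n →L[ℂ] EllTwo n) : opCoeff (S - T) = opCoeff S - opCoeff T :=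
  rfl

/-- The coefficients of the identity. -/
def deltaCoeff (_ p : Fin n → ℤ) : ℂ := if p = 0 then 1 else 0

theorem opCoeff_one : opCoeff (1 : EllTwo n →L[ℂ] EllTwo n) = deltaCoeff := by
  ext k p
  rw [opCoeff, one_apply_eq_self, basisVec_apply, deltaCoeff]
  simp

/-- Matrix multiplication with columns numbered by their displacement from the row, which is why the
second factor is evaluated at k + p. -/
theorem opCoeff_comp (S T : EllTwo n →L[ℂ] EllTwo n) :
    opCoeff (S * T) = coefMul 1 (opCoeff S) (opCoeff T) := by
  ext k r
  have h := hasSum_apply S (T (basisVec (k + r))) k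
  rw [← (Equiv.addLeft k).hasSum_iff] at h
  refine h.tsum_eq.symm.trans ?_
  rw [coefMul]
  congr 1
  ext p
  simp only [Function.comp, Equiv.coe_addLeft, opCoeff, one_smul]
  rw [mul_comm]
  rw [show k + p + (r - p) = k + r by abel]

/-! ### Pseudo-differential operators -/

/-- The integral against the Fourier transform is an inner product in L² with the conjugate of
e^{2πi k·x} σ(k,x). Being continuous, it may be applied termwise to the series. -/
theorem hasSum_pseudoDiff {σ : (Fin n → ℤ) → UnitAddTorus (Fin n) → ℂ}
    (hσ : ∀ k, SmoothOnTorus (σ k)) (f : EllTwo n) (k : Fin n → ℤ) :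
    HasSum (fun l => f l * symbolCoeff σ k (l - k)) (pseudoDiff σ f k) := by
  set F : C(UnitAddTorus (Fin n), ℂ) :=
    ⟨fun x => starRingEnd ℂ (UnitAddTorus.mFourier k x * σ k x),
      Complex.continuous_conj.comp ((UnitAddTorus.mFourier k).continuous.mul (hσ k).continuous)⟩
  set w : Lp ℂ 2 (torusMeasure n) := ContinuousMap.toLp (E := ℂ) 2 (torusMeasure n) ℂ F with hw
  have hin : ∀ u : Lp ℂ 2 (torusMeasure n), ⟪w, u⟫_ℂ =
      ∫ x, UnitAddTorus.mFourier k x * σ k x * u x ∂torusMeasure n := fun u => by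
    rw [L2.inner_def]
    refine integral_congr_ae ?_
    filter_upwards [ContinuousMap.coeFn_toLp (E := ℂ) (p := 2) (𝕜 := ℂ) (torusMeasure n) F]
      with x hx
    rw [hw, hx]
    simp [F, mul_comm]
  have h := (innerSL ℂ w).hasSum (summable_fourierLattice f).hasSum
  have h1 : innerSL ℂ w (fourierLattice f) = pseudoDiff σ f k := by
    rw [innerSL_apply_apply, hin]
    rfl
  have h2 : ∀ l, innerSL ℂ w (UnitAddTorus.mFourierLp 2 (-l) : Lp ℂ 2 (torusMeasure n)) =
      symbolCoeff σ k (l - k) := fun l => by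
    refine (innerSL_apply_apply ℂ _ _).trans ?_
    refine (hin _).trans ?_
    rw [symbolCoeff, torusCoeff]
    refine integral_congr_ae ?_
    filter_upwards [ContinuousMap.coeFn_toLp (E := ℂ) (p := 2) (𝕜 := ℂ) (torusMeasure n)
      (UnitAddTorus.mFourier (-l))] with x hx
    refine (congrArg (UnitAddTorus.mFourier k x * σ k x * ·) hx).trans ?_
    simp only [neg_sub, sub_eq_add_neg k l, UnitAddTorus.mFourier_add]
    ring
  have h3 : ∀ l, f l * symbolCoeff σ k (l - k) = innerSL ℂ w
      (f l • (UnitAddTorus.mFourierLp 2 (-l) : Lp ℂ 2 (torusMeasure n))) := fun l => by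
    rw [← h2]
    exact ((innerSL ℂ w).map_smul (f l) _).symm
  rw [funext h3, ← h1]
  exact h

theorem isPseudoDiffOp_iff {σ : (Fin n → ℤ) → UnitAddTorus (Fin n) → ℂ}
    (hσ : ∀ k, SmoothOnTorus (σ k)) {T : EllTwo n →L[ℂ] EllTwo n} :
    IsPseudoDiffOp σ T ↔ opCoeff T = symbolCoeff σ := by
  constructor
  · intro h
    ext k p
    rw [opCoeff, h]
    refine (hasSum_pseudoDiff hσ _ k).unique ?_
    convert! hasSum_ite_eq (k + p) (symbolCoeff σ k p) using 2 with l
    rw [basisVec_apply]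
    split_ifs with hl
    · rw [hl]; simp
    · simp
  · intro h f k
    refine (hasSum_apply T f k).unique ?_
    convert! hasSum_pseudoDiff hσ f k using 2 with l
    rw [← h, opCoeff]
    simp

/-! ### Boundedness -/

theorem summable_translate_sq (f : EllTwo n) (p : Fin n → ℤ) :
    HasSum (fun k => ‖f (k + p)‖ ^ (2 : ENNReal).toReal) (‖f‖ ^ (2 : ENNReal).toReal) :=
  (Equiv.addRight p).hasSum_iff.2 (lp.hasSum_norm (by norm_num) f)

theorem norm_mul_translate_rpow_le {d : (Fin n → ℤ) → ℂ} {C : ℝ} (hd : ∀ k, ‖d k‖ ≤ C)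
    (f : EllTwo n) (p k : Fin n → ℤ) : ‖d k * f (k + p)‖ ^ (2 : ENNReal).toReal ≤
      C ^ (2 : ENNReal).toReal * ‖f (k + p)‖ ^ (2 : ENNReal).toReal := by
  have hC := (norm_nonneg _).trans (hd k)
  rw [← Real.mul_rpow hC (norm_nonneg _), norm_mul]
  exact Real.rpow_le_rpow (by positivity)
    (mul_le_mul_of_nonneg_right (hd k) (norm_nonneg _)) (by norm_num)

/-- The operator `f ↦ d(k) f(k+p)`. -/
def shiftOp (d : (Fin n → ℤ) → ℂ) (C : ℝ) (hd : ∀ k, ‖d k‖ ≤ C) (p : Fin n → ℤ) :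
    EllTwo n →L[ℂ] EllTwo n :=
  LinearMap.mkContinuous
    { toFun := fun f => ⟨fun k => d k * f (k + p), memℓp_gen (.of_nonneg_of_le
        (fun _ => Real.rpow_nonneg (norm_nonneg _) _) (norm_mul_translate_rpow_le hd f p)
        ((summable_translate_sq f p).summable.mul_left _))⟩
      map_add' := fun f g => by ext k; exact mul_add _ _ _
      map_smul' := fun c f => by ext k; exact mul_left_comm _ _ _ } C fun f => by
    have hC := (norm_nonneg _).trans (hd 0)
    refine lp.norm_le_of_tsum_le (by norm_num) (by positivity) ?_
    have h := (summable_translate_sq f p).mul_left (C ^ (2 : ENNReal).toReal)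
    rw [Real.mul_rpow hC (norm_nonneg _), ← h.tsum_eq]
    exact (Summable.of_nonneg_of_le (fun _ => Real.rpow_nonneg (norm_nonneg _) _)
      (norm_mul_translate_rpow_le hd f p) h.summable).tsum_le_tsum
      (norm_mul_translate_rpow_le hd f p) h.summable

theorem shiftOp_apply {d : (Fin n → ℤ) → ℂ} {C : ℝ} (hd : ∀ k, ‖d k‖ ≤ C) (p : Fin n → ℤ)
    (f : EllTwo n) (k : Fin n → ℤ) : shiftOp d C hd p f k = d k * f (k + p) := rfl

theorem norm_shiftOp_le {d : (Fin n → ℤ) → ℂ} {C : ℝ} (hd : ∀ k, ‖d k‖ ≤ C) (p : Fin n → ℤ) :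
    ‖shiftOp d C hd p‖ ≤ C :=
  LinearMap.mkContinuous_norm_le _ ((norm_nonneg _).trans (hd 0)) _

/-- The operator is a norm convergent sum over p of weighted translations, the one for p having norm
at most sup_k |a(k,p)|. This is the source of all boundedness statements on ℓ². -/
theorem exists_opCoeff_eq {a : (Fin n → ℤ) → (Fin n → ℤ) → ℂ} {C : ℝ}
    (h : ∀ k p, ‖a k p‖ * bracket p ^ (2 * n) ≤ C) :
    ∃ T : EllTwo n →L[ℂ] EllTwo n, opCoeff T = a ∧ ‖T‖ ≤ C * bracketSum n := by
  have hb : ∀ p : Fin n → ℤ, 0 < bracket p ^ (2 * n) := fun p => pow_pos (bracket_pos p) _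
  have hd : ∀ p k, ‖a k p‖ ≤ C / bracket p ^ (2 * n) := fun p k =>
    (le_div_iff₀ (hb p)).2 (h k p)
  have hn : ∀ p, ‖shiftOp (fun k => a k p) _ (hd p) p‖ * bracket p ^ (2 * n) ≤ C := fun p =>
    (le_div_iff₀ (hb p)).1 (norm_shiftOp_le _ _)
  have hs := summable_of_bracket_bound hn
  refine ⟨∑' p, shiftOp (fun k => a k p) _ (hd p) p, ?_, norm_tsum_le_of_bracket_bound hn⟩
  ext k r
  have h1 := ((lp.evalCLM ℂ (fun _ : Fin n → ℤ => ℂ) 2 k).comp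
    (ContinuousLinearMap.apply ℂ (EllTwo n) (basisVec (k + r)))).hasSum hs.hasSum
  refine h1.unique ?_
  convert! hasSum_ite_eq r (a k r) using 2 with p
  change shiftOp (fun k => a k p) _ (hd p) p (basisVec (k + r)) k = _
  rw [shiftOp_apply, basisVec_apply]
  simp only [add_right_inj]
  split_ifs with hp
  · rw [hp, mul_one]
  · rw [mul_zero]

theorem RapidDecay.exists_opCoeff_eq {U : (Fin n → ℤ) → ℝ}
    {a : (Fin n → ℤ) → (Fin n → ℤ) → ℂ} (ha : RapidDecay U a) {D : ℝ} (hU : ∀ k, U k ≤ D) :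
    ∃ T : EllTwo n →L[ℂ] EllTwo n, opCoeff T = a := by
  obtain ⟨C, hC, h⟩ := ha (2 * n)
  obtain ⟨T, hT, -⟩ := LatticePDO.exists_opCoeff_eq (C := C * D) fun k p =>
    (h k p).trans (mul_le_mul_of_nonneg_left (hU k) hC)
  exact ⟨T, hT⟩

/-! ### Traces of smoothing operators -/

theorem summable_norm_basisVec_of_isSmoothing {T : EllTwo n →L[ℂ] EllTwo n}
    (h : IsSmoothing (opCoeff T)) : Summable fun l => ‖basisVec l‖ * ‖T (basisVec l)‖ := by
  -- The 2n orders in l - k together with 2n of the 4n orders in k produce decay of order 2n in l;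
  -- the other 2n orders in k sum the column.
  obtain ⟨C, hC, hb⟩ := h (2 * n + 2 * n) (2 * n)
  refine summable_of_bracket_bound (C := C * bracketSum n) fun l => ?_
  rw [norm_basisVec, one_mul, norm_norm, mul_comm]
  have hl := pow_pos (bracket_pos l) (2 * n)
  rw [← le_div_iff₀' hl, mul_div_right_comm]
  refine norm_le_tsum_norm fun k => ?_
  rw [le_div_iff₀ hl]
  have h1 := hb k (l - k)
  rw [opCoeff, add_sub_cancel] at h1
  have hk := bracket_pos k
  have h2 : bracket l ^ (2 * n) ≤ bracket k ^ (2 * n) * bracket (l - k) ^ (2 * n) := by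
    rw [← mul_pow]
    exact pow_le_pow_left₀ (bracket_pos l).le (bracket_le_mul l k) _
  calc ‖T (basisVec l) k‖ * bracket k ^ (2 * n) * bracket l ^ (2 * n)
      ≤ ‖T (basisVec l) k‖ * bracket k ^ (2 * n) *
          (bracket k ^ (2 * n) * bracket (l - k) ^ (2 * n)) :=
        mul_le_mul_of_nonneg_left h2 (by positivity)
    _ = ‖T (basisVec l) k‖ * bracket (l - k) ^ (2 * n) * bracket k ^ (2 * n + 2 * n) := by ring
    _ ≤ C * (bracket k ^ (2 * n + 2 * n))⁻¹ * bracket k ^ (2 * n + 2 * n) :=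
        mul_le_mul_of_nonneg_right h1 (by positivity)
    _ = C := by
        rw [mul_assoc, inv_mul_cancel₀ (by positivity), mul_one]

theorem hasSum_inner_basisVec (T : EllTwo n →L[ℂ] EllTwo n) (v : EllTwo n) :
    HasSum (fun l => ⟪basisVec l, v⟫_ℂ • T (basisVec l)) (T v) := by
  simpa [inner_basisVec] using T.hasSum (hasSum_smul_basisVec v)

theorem isTraceClass_of_isSmoothing {T : EllTwo n →L[ℂ] EllTwo n}
    (h : IsSmoothing (opCoeff T)) : IsTraceClass T :=
  isTraceClass_of_countable (summable_norm_basisVec_of_isSmoothing h) (hasSum_inner_basisVec T)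

theorem exists_hasNuclearTrace_of_isSmoothing {T : EllTwo n →L[ℂ] EllTwo n}
    (h : IsSmoothing (opCoeff T)) : ∃ t : ℂ, HasNuclearTrace T t ∧
      HasSum (fun k => opCoeff T k 0) t := by
  have hs := summable_norm_basisVec_of_isSmoothing h
  have ht := (summable_inner_of_summable_norm hs).hasSum
  refine ⟨_, ⟨_, _, _, hs, hasSum_inner_basisVec T, ht⟩, ?_⟩
  convert! ht using 2 with k
  rw [inner_basisVec, opCoeff, add_zero]

end Operators

/-! ### Operators with coefficients in a symbol class -/

section SymbolicOperators

variable {n : ℕ} {U V g : (Fin n → ℤ) → ℝ} {a b : (Fin n → ℤ) → (Fin n → ℤ) → ℂ}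
  {W : (Fin n → ℕ) → (Fin n → ℤ) → ℝ} {S T A R G : EllTwo n →L[ℂ] EllTwo n}

/-- The coefficients of `T` satisfy the difference bounds given by `W`. -/
def IsSymbolicOp (W : (Fin n → ℕ) → (Fin n → ℤ) → ℝ) (T : EllTwo n →L[ℂ] EllTwo n) : Prop :=
  ∀ s, DiffDecay W s 0 (opCoeff T)

theorem IsSymbolicOp.rapidDecay (h : IsSymbolicOp W T) : RapidDecay (W 0) (opCoeff T) :=
  (h 0).rapidDecay

theorem isSymbolicOp_iff :
    IsSymbolicOp W T ↔ ∀ α, RapidDecay (W α) (latticeDiff α (opCoeff T)) := by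
  refine ⟨fun h α => ?_, fun h s α _ => ?_⟩
  · simpa using h _ α le_rfl
  · simpa using h α

theorem IsSymbolicOp.add (hS : IsSymbolicOp W S) (hT : IsSymbolicOp W T) :
    IsSymbolicOp W (S + T) := fun s => (hS s).add (hT s)

theorem IsSymbolicOp.sub (hS : IsSymbolicOp W S) (hT : IsSymbolicOp W T) :
    IsSymbolicOp W (S - T) := fun s => (hS s).sub (hT s)

theorem IsSymbolicOp.mul (hW : IsWeightFamily W) (hS : IsSymbolicOp W S)
    (hT : IsSymbolicOp W T) : IsSymbolicOp W (S * T) := fun s => by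
  rw [opCoeff_comp]
  simpa using (hS s).coefMul le_rfl hW (hT s)

theorem isSymbolicOp_of_isSmoothing (hW : IsWeightFamily W) (h : IsSmoothing (opCoeff T)) :
    IsSymbolicOp W T := fun _ => h.diffDecay hW

theorem rapidDecay_deltaCoeff : RapidDecay (fun _ => 1) (deltaCoeff (n := n)) := fun N =>
  ⟨1, zero_le_one, fun k p => by
    rw [deltaCoeff]
    split_ifs with h
    · simp [h, bracket_zero]
    · simp⟩

theorem latticeDiff_deltaCoeff (α : Fin n → ℕ) (hα : α ≠ 0) :
    latticeDiff α (deltaCoeff (n := n)) = 0 := by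
  induction α using multiindex_induction with
  | h0 => exact absurd rfl hα
  | h1 α j _ =>
    rw [latticeDiff_add_single]
    have : fwdDiff (Pi.single j 1) (deltaCoeff (n := n)) = deltaCoeff - deltaCoeff := rfl
    rw [this, latticeDiff_sub, sub_self]

theorem isSymbolicOp_one (hW0 : W 0 = fun _ => 1) :
    IsSymbolicOp W (1 : EllTwo n →L[ℂ] EllTwo n) := isSymbolicOp_iff.2 fun α => by
  rw [opCoeff_one]
  by_cases hα : α = 0
  · rw [hα, latticeDiff_zero, hW0]
    exact rapidDecay_deltaCoeff
  · rw [latticeDiff_deltaCoeff α hα]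
    exact fun N => ⟨0, le_rfl, fun k p => by simp⟩

theorem IsSymbolicOp.pow (hW : IsWeightFamily W) (hW0 : W 0 = fun _ => 1)
    (h : IsSymbolicOp W T) (N : ℕ) : IsSymbolicOp W (T ^ N) := by
  induction N with
  | zero => exact isSymbolicOp_one hW0
  | succ N ih => rw [pow_succ]; exact ih.mul hW h

theorem IsSymbolicOp.sum {ι : Type*} (hW : IsWeightFamily W) (s : Finset ι)
    {F : ι → EllTwo n →L[ℂ] EllTwo n} (h : ∀ i, IsSymbolicOp W (F i)) :
    IsSymbolicOp W (∑ i ∈ s, F i) := by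
  classical
  induction s using Finset.induction_on with
  | empty =>
    refine isSymbolicOp_of_isSmoothing hW fun N P => ⟨0, le_rfl, fun k p => ?_⟩
    simp [opCoeff]
  | insert i s hi ih => rw [Finset.sum_insert hi]; exact (h i).add ih

theorem rapidDecay_opCoeff_pow (hg : SlowlyVarying g) (h : RapidDecay g (opCoeff T)) (N : ℕ) :
    RapidDecay (fun k => g k ^ N) (opCoeff (T ^ N)) := by
  induction N with
  | zero => simpa [opCoeff_one] using rapidDecay_deltaCoeff
  | succ N ih =>
    simp only [pow_succ]
    rw [opCoeff_comp]
    exact ih.coefMul le_rfl hg h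

theorem isSmoothing_opCoeff_mul_left (hT : RapidDecay V (opCoeff T)) (hV : SlowlyVarying V)
    (hS : IsSmoothing (opCoeff S)) : IsSmoothing (opCoeff (S * T)) := by
  rw [opCoeff_comp]
  exact hS.coefMul_left hV hT

theorem isSmoothing_opCoeff_mul_right (hS : RapidDecay U (opCoeff S)) (hU : SlowlyVarying U)
    (hT : IsSmoothing (opCoeff T)) : IsSmoothing (opCoeff (S * T)) := by
  rw [opCoeff_comp]
  exact IsSmoothing.coefMul_right hU hS hT

theorem isSmoothing_of_support (ha : RapidDecay (fun _ => 1) a) {B : ℝ}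
    (h : ∀ k, B < bracket k → a k = 0) : IsSmoothing a := fun M N => by
  obtain ⟨C, hC, hb⟩ := ha N
  refine ⟨C * max B 0 ^ M, by positivity, fun k p => ?_⟩
  have hk := pow_pos (bracket_pos k) M
  rcases lt_or_ge B (bracket k) with h1 | h1
  · rw [h k h1, Pi.zero_apply, norm_zero, zero_mul]
    positivity
  · have h2 : bracket k ^ M ≤ max B 0 ^ M :=
      pow_le_pow_left₀ (bracket_pos k).le (h1.trans (le_max_left _ _)) M
    rw [← div_eq_mul_inv, le_div_iff₀ hk]
    have h3 := hb k p
    rw [mul_one] at h3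
    exact mul_le_mul h3 h2 hk.le hC

/-! ### Estimates for `A G A` -/

theorem norm_apply_le {k : Fin n → ℤ} {C : ℝ}
    (h : ∀ q, ‖opCoeff A k q‖ * bracket q ^ (2 * n) ≤ C) (v : EllTwo n) :
    ‖A v k‖ ≤ ‖v‖ * C * bracketSum n := by
  have h1 := hasSum_apply A v k
  rw [← (Equiv.addLeft k).hasSum_iff] at h1
  rw [← h1.tsum_eq]
  refine norm_tsum_le_of_bracket_bound fun q => ?_
  simp only [Function.comp, Equiv.coe_addLeft, norm_mul]
  rw [mul_assoc]
  exact mul_le_mul (lp.norm_apply_le_norm (by norm_num) v _) (h q)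
    (by have := bracket_pos q; positivity) (norm_nonneg _)

theorem exists_norm_map_basisVec_le (hU : SlowlyVarying U) (h : RapidDecay U (opCoeff A)) :
    ∃ C : ℝ, 0 ≤ C ∧ ∀ l, ‖A (basisVec l)‖ ≤ C * U l := by
  obtain ⟨D, M, hD, hs⟩ := hU.bound
  obtain ⟨C, hC, hb⟩ := h (M + 2 * n)
  refine ⟨C * D * bracketSum n, by have := bracketSum_nonneg (n := n); positivity, fun l => ?_⟩
  have h1 := hasSum_smul_basisVec (A (basisVec l))
  rw [← (Equiv.subLeft l).hasSum_iff] at h1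
  rw [← h1.tsum_eq]
  refine (norm_tsum_le_of_bracket_bound (C := C * D * U l) fun p => ?_).trans_eq (by ring)
  simp only [Function.comp, Equiv.subLeft_apply, norm_smul, norm_basisVec, mul_one]
  have h2 := hb (l - p) p
  rw [opCoeff, sub_add_cancel] at h2
  have h3 := hs l (-p)
  rw [bracket_neg, ← sub_eq_add_neg] at h3
  have hp := pow_pos (bracket_pos p) M
  refine le_of_mul_le_mul_right ?_ hp
  calc _ = ‖A (basisVec l) (l - p)‖ * bracket p ^ (M + 2 * n) := by ring
    _ ≤ C * (D * bracket p ^ M * U l) := h2.trans (mul_le_mul_of_nonneg_left h3 hC)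
    _ = _ := by ring

/-- Nothing but boundedness is known of G. The row of A at k contributes U(k) and the column A
e_{k+p} contributes U(k + p); decay in p has to be regained from these two factors. -/
theorem exists_norm_opCoeff_sandwich_le (hU : SlowlyVarying U) (h : RapidDecay U (opCoeff A))
    (G : EllTwo n →L[ℂ] EllTwo n) :
    ∃ C : ℝ, 0 ≤ C ∧ ∀ k p, ‖opCoeff (A * G * A) k p‖ ≤ C * (U k * U (k + p)) := by
  obtain ⟨C, hC, hb⟩ := h (2 * n)
  obtain ⟨D, hD, hd⟩ := exists_norm_map_basisVec_le hU h
  have hS := bracketSum_nonneg (n := n)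
  refine ⟨‖G‖ * D * C * bracketSum n, by positivity, fun k p => ?_⟩
  have h1 : ‖G (A (basisVec (k + p)))‖ ≤ ‖G‖ * (D * U (k + p)) :=
    (G.le_opNorm _).trans (mul_le_mul_of_nonneg_left (hd _) (norm_nonneg _))
  calc ‖opCoeff (A * G * A) k p‖ ≤ ‖G (A (basisVec (k + p)))‖ * (C * U k) * bracketSum n :=
        norm_apply_le (hb k) _
    _ ≤ ‖G‖ * (D * U (k + p)) * (C * U k) * bracketSum n :=
        mul_le_mul_of_nonneg_right (mul_le_mul_of_nonneg_right h1
          (mul_nonneg hC (hU.pos k).le)) hS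
    _ = _ := by ring

/-- A difference costs at most a constant, which suffices for a remainder already smaller than any
weight in question. The order P is fixed because the remainder with fixed N decays only to a finite
order. -/
theorem exists_latticeDiff_bound (hU : SlowlyVarying U) {P : ℕ}
    (h : ∃ C : ℝ, 0 ≤ C ∧ ∀ k p, ‖a k p‖ * bracket p ^ P ≤ C * U k) (α : Fin n → ℕ) :
    ∃ C : ℝ, 0 ≤ C ∧ ∀ k p, ‖latticeDiff α a k p‖ * bracket p ^ P ≤ C * U k := by
  induction α using multiindex_induction with
  | h0 => rwa [latticeDiff_zero]
  | h1 α j ih =>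
    obtain ⟨C, hC, hb⟩ := ih
    obtain ⟨D, M, hD, hs⟩ := hU.bound
    refine ⟨C * (D * bracket (Pi.single j 1 : Fin n → ℤ) ^ M) + C,
      by have := bracket_pos (Pi.single j 1 : Fin n → ℤ); positivity, fun k p => ?_⟩
    rw [latticeDiff_add_single', fwdDiff, Pi.sub_apply]
    have hp := pow_pos (bracket_pos p) P
    have h1 := (hb (k + Pi.single j 1) p).trans
      (mul_le_mul_of_nonneg_left (hs k (Pi.single j 1)) hC)
    have h2 := mul_le_mul_of_nonneg_right
      (norm_sub_le (latticeDiff α a (k + Pi.single j 1) p) (latticeDiff α a k p)) hp.le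
    linarith [hb k p]

/-! ### Neumann series -/

theorem exists_opCoeff_sandwich_pow_bound (hg : SlowlyVarying g)
    (hgN : ∀ M : ℕ, ∃ (N : ℕ) (C : ℝ), 0 ≤ C ∧ ∀ k, g k ^ N ≤ C * (bracket k ^ M)⁻¹)
    (hR : RapidDecay g (opCoeff R)) (G : EllTwo n →L[ℂ] EllTwo n) (M P : ℕ) :
    ∃ N : ℕ, ∃ C : ℝ, 0 ≤ C ∧ ∀ k p,
      ‖opCoeff (R ^ N * G * R ^ N) k p‖ * bracket p ^ P ≤ C * (bracket k ^ M)⁻¹ := by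
  -- Order M + P in k gives M for the claim and P for the bound of the bracket of p by those of k
  -- and k + p; order P in k + p supplies the other half.
  obtain ⟨N, D, hD, hd⟩ := hgN (M + P)
  obtain ⟨C, hC, hb⟩ := exists_norm_opCoeff_sandwich_le (hg.pow N)
    (rapidDecay_opCoeff_pow hg hR N) G
  refine ⟨N, C * (D * D), by positivity, fun k p => ?_⟩
  have hk := bracket_pos k
  have hkp := bracket_pos (k + p)
  have hp := pow_pos (bracket_pos p) P
  have h1 : bracket p ^ P ≤ bracket k ^ P * bracket (k + p) ^ P := by
    rw [← mul_pow]
    refine pow_le_pow_left₀ (bracket_pos p).le ?_ P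
    have := bracket_add_le (-k) (k + p)
    rwa [neg_add_cancel_left, bracket_neg] at this
  have h2 : (bracket (k + p) ^ (M + P))⁻¹ ≤ (bracket (k + p) ^ P)⁻¹ :=
    inv_anti₀ (by positivity) (pow_le_pow_right₀ (one_le_bracket _) (by omega))
  have h3 : g k ^ N * g (k + p) ^ N ≤
      D * (bracket k ^ (M + P))⁻¹ * (D * (bracket (k + p) ^ P)⁻¹) :=
    mul_le_mul (hd k) ((hd _).trans (mul_le_mul_of_nonneg_left h2 hD))
      (pow_pos (hg.pos _) _).le (by positivity)
  calc _ ≤ C * (g k ^ N * g (k + p) ^ N) * bracket p ^ P :=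
        mul_le_mul_of_nonneg_right (hb k p) hp.le
    _ ≤ C * (D * (bracket k ^ (M + P))⁻¹ * (D * (bracket (k + p) ^ P)⁻¹)) *
          (bracket k ^ P * bracket (k + p) ^ P) :=
        mul_le_mul (mul_le_mul_of_nonneg_left h3 hC) h1 hp.le (by positivity)
    _ = _ := by
        rw [pow_add]
        field_simp

/-- Substituting the right-hand Neumann expansion of G into the left-hand one gives G = F + R^N F +
R^N G R^N. The first two terms are in the class, and the last is bounded by any prescribed weight
once N is large. -/
theorem isSymbolicOp_of_inverse (hW : IsWeightFamily W) (hW0 : W 0 = fun _ => 1)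
    (hg : SlowlyVarying g)
    (hgN : ∀ M : ℕ, ∃ (N : ℕ) (C : ℝ), 0 ≤ C ∧ ∀ k, g k ^ N ≤ C * (bracket k ^ M)⁻¹)
    (hR : IsSymbolicOp W R) (hRg : RapidDecay g (opCoeff R))
    (hl : G * (1 - R) = 1) (hr : (1 - R) * G = 1) : IsSymbolicOp W G := by
  refine isSymbolicOp_iff.2 fun α P => ?_
  -- The power M is chosen so that the inverse M-th power of the bracket is below W_α; then N is
  -- chosen depending on M and P, hence on α and P.
  obtain ⟨c, M, hc, hM⟩ := (hW.slow α).exists_lower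
  obtain ⟨N, hX⟩ := exists_opCoeff_sandwich_pow_bound hg hgN hRg G M P
  have hl' : G = 1 + G * R := by rw [mul_sub, mul_one] at hl; rw [← hl]; abel
  have hr' : G = 1 + R * G := by rw [sub_mul, one_mul] at hr; rw [← hr]; abel
  have e1 : ∀ N : ℕ, G = ∑ i ∈ Finset.range N, R ^ i + R ^ N * G := fun N => by
    induction N with
    | zero => simp
    | succ N ih =>
      rw [Finset.sum_range_succ, add_assoc, pow_succ, mul_assoc]
      nth_rewrite 1 [ih]
      congr 1
      nth_rewrite 1 [hr']
      rw [mul_add, mul_one]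
  have e2 : ∀ N : ℕ, G = ∑ i ∈ Finset.range N, R ^ i + G * R ^ N := fun N => by
    induction N with
    | zero => simp
    | succ N ih =>
      rw [Finset.sum_range_succ, add_assoc, pow_succ', ← mul_assoc]
      nth_rewrite 1 [ih]
      congr 1
      nth_rewrite 1 [hl']
      rw [add_mul, one_mul]
  set F := ∑ i ∈ Finset.range N, R ^ i with hF
  have hFs : IsSymbolicOp W F := IsSymbolicOp.sum hW _ fun i => hR.pow hW hW0 i
  have e : G = (F + R ^ N * F) + R ^ N * G * R ^ N := by
    conv_lhs => rw [e1 N, e2 N]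
    rw [← hF, mul_add, add_assoc, mul_assoc]
  have hY := hFs.add ((hR.pow hW hW0 N).mul hW hFs)
  obtain ⟨C₁, hC₁, h1⟩ := isSymbolicOp_iff.1 hY α P
  obtain ⟨C₂, hC₂, h2⟩ := exists_latticeDiff_bound (slowlyVarying_bracket_pow_inv M) hX α
  refine ⟨C₁ + C₂ * c, by positivity, fun k p => ?_⟩
  have hp := pow_pos (bracket_pos p) P
  have h3 := mul_le_mul_of_nonneg_left (hM k) hC₂
  rw [e, opCoeff_add, latticeDiff_add, Pi.add_apply, Pi.add_apply]
  have h4 := mul_le_mul_of_nonneg_right (norm_add_le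
    (latticeDiff α (opCoeff (F + R ^ N * F)) k p)
    (latticeDiff α (opCoeff (R ^ N * G * R ^ N)) k p)) hp.le
  linarith [h1 k p, h2 k p]

theorem exists_isSymbolicOp_quasiInverse (hW : IsWeightFamily W) (hW0 : W 0 = fun _ => 1)
    (hg : SlowlyVarying g)
    (hgN : ∀ M : ℕ, ∃ (N : ℕ) (C : ℝ), 0 ≤ C ∧ ∀ k, g k ^ N ≤ C * (bracket k ^ M)⁻¹)
    (hg0 : ∀ ε : ℝ, 0 < ε → ∃ L : ℝ, ∀ k, L < bracket k → g k ≤ ε)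
    (hR : IsSymbolicOp W R) (hRg : RapidDecay g (opCoeff R)) :
    ∃ G : EllTwo n →L[ℂ] EllTwo n, IsSymbolicOp W G ∧
      IsSmoothing (opCoeff (G * (1 - R) - 1)) ∧ IsSmoothing (opCoeff ((1 - R) * G - 1)) := by
  obtain ⟨C, hC, hb⟩ := hRg (2 * n)
  have hS := bracketSum_nonneg (n := n)
  -- With this ε the truncated operator has norm at most Cε∑ₚ(1+|p|)⁻²ⁿ, which is less than 1/2.
  obtain ⟨L, hL⟩ := hg0 (1 / (2 * (C * bracketSum n + 1))) (by positivity)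
  set r : (Fin n → ℤ) → (Fin n → ℤ) → ℂ := fun k => if L < bracket k then opCoeff R k else 0
    with hr
  obtain ⟨R', hR', hnorm⟩ := exists_opCoeff_eq (a := r)
    (C := C * (1 / (2 * (C * bracketSum n + 1)))) fun k p => by
      by_cases hk : L < bracket k
      · simp only [hr, if_pos hk]
        exact (hb k p).trans (mul_le_mul_of_nonneg_left (hL k hk) hC)
      · simp only [hr, if_neg hk, Pi.zero_apply, norm_zero, zero_mul]
        positivity
  have hlt : ‖R'‖ < 1 := by
    refine hnorm.trans_lt ?_
    rw [mul_one_div, div_mul_eq_mul_div, div_lt_one (by positivity)]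
    nlinarith [mul_nonneg hC hS]
  have h1 : RapidDecay (fun _ => 1) (opCoeff R) := by simpa only [hW0] using hR.rapidDecay
  have hd : IsSmoothing (opCoeff (R' - R)) := by
    rw [opCoeff_sub, hR']
    refine isSmoothing_of_support (B := L) (RapidDecay.sub (fun N => ?_) h1) fun k hk => ?_
    · obtain ⟨C, hC, hb⟩ := h1 N
      refine ⟨C, hC, fun k p => ?_⟩
      by_cases hk : L < bracket k
      · simpa only [hr, if_pos hk] using hb k p
      · simp only [hr, if_neg hk, Pi.zero_apply, norm_zero, zero_mul]
        positivity
    · simp [hr, hk]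
  have hR's : IsSymbolicOp W R' := by
    simpa using hR.add (isSymbolicOp_of_isSmoothing hW hd)
  have hR'g : RapidDecay g (opCoeff R') := by
    have := hRg.add (hd.rapidDecay hg)
    rwa [← opCoeff_add, add_sub_cancel] at this
  obtain ⟨u, hu⟩ := isUnit_one_sub_of_norm_lt_one hlt
  have hl : (↑u⁻¹ : EllTwo n →L[ℂ] EllTwo n) * (1 - R') = 1 := by rw [← hu, Units.inv_mul]
  have hr : (1 - R') * (↑u⁻¹ : EllTwo n →L[ℂ] EllTwo n) = 1 := by rw [← hu, Units.mul_inv]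
  have hG := isSymbolicOp_of_inverse hW hW0 hg hgN hR's hR'g hl hr
  have hG1 := hG.rapidDecay
  refine ⟨_, hG, ?_, ?_⟩
  · have e : (↑u⁻¹ : EllTwo n →L[ℂ] EllTwo n) * (1 - R) - 1 = ↑u⁻¹ * (R' - R) := by
      nth_rewrite 2 [← hl]
      noncomm_ring
    rw [e]
    exact isSmoothing_opCoeff_mul_right hG1 (hW.slow 0) hd
  · have e : (1 - R) * (↑u⁻¹ : EllTwo n →L[ℂ] EllTwo n) - 1 = (R' - R) * ↑u⁻¹ := by
      nth_rewrite 2 [← hr]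
      noncomm_ring
    rw [e]
    exact isSmoothing_opCoeff_mul_left hG1 (hW.slow 0) hd

/-- Left and right parametrices from an approximate inverse. -/
theorem exists_parametrix (hW : IsWeightFamily W) (hW0 : W 0 = fun _ => 1)
    (hg : SlowlyVarying g)
    (hgN : ∀ M : ℕ, ∃ (N : ℕ) (C : ℝ), 0 ≤ C ∧ ∀ k, g k ^ N ≤ C * (bracket k ^ M)⁻¹)
    (hg0 : ∀ ε : ℝ, 0 < ε → ∃ L : ℝ, ∀ k, L < bracket k → g k ≤ ε)
    {A A' B : EllTwo n →L[ℂ] EllTwo n} (hA : IsSymbolicOp W A)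
    (hAA' : IsSmoothing (opCoeff (A - A'))) (hB : IsSymbolicOp W B)
    (hBA : RapidDecay g (opCoeff (1 - B * A'))) (hAB : RapidDecay g (opCoeff (1 - A' * B))) :
    ∃ Q : EllTwo n →L[ℂ] EllTwo n, IsSymbolicOp W Q ∧
      IsSmoothing (opCoeff (1 - Q * A)) ∧ IsSmoothing (opCoeff (1 - A * Q)) := by
  have hA' : IsSymbolicOp W A' := by
    simpa using hA.sub (isSymbolicOp_of_isSmoothing hW hAA')
  have h1 := isSymbolicOp_one hW0
  obtain ⟨G, hG, hGl, -⟩ := exists_isSymbolicOp_quasiInverse hW hW0 hg hgN hg0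
    (h1.sub (hB.mul hW hA')) hBA
  obtain ⟨G₂, hG₂, -, hGr⟩ := exists_isSymbolicOp_quasiInverse hW hW0 hg hgN hg0
    (h1.sub (hA'.mul hW hB)) hAB
  rw [sub_sub_cancel] at hGl hGr
  have hQ := hG.mul hW hB
  have hQ₂ := hB.mul hW hG₂
  have hl : IsSmoothing (opCoeff (1 - G * B * A)) := by
    have e : 1 - G * B * A = -(G * (B * A') - 1) - G * B * (A - A') := by noncomm_ring
    rw [e, opCoeff_sub]
    exact hGl.neg.sub (isSmoothing_opCoeff_mul_right hQ.rapidDecay (hW.slow 0) hAA')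
  have hr : IsSmoothing (opCoeff (1 - A * (B * G₂))) := by
    have e : 1 - A * (B * G₂) = -(A' * B * G₂ - 1) - (A - A') * (B * G₂) := by noncomm_ring
    rw [e, opCoeff_sub]
    exact hGr.neg.sub (isSmoothing_opCoeff_mul_left hQ₂.rapidDecay (hW.slow 0) hAA')
  refine ⟨G * B, hQ, hl, ?_⟩
  -- The left parametrix GB and the right parametrix BG₂ differ by GB(1 - A BG₂) - (1 - GB A)BG₂,
  -- which is smoothing, so GB is also a right parametrix.
  have e : 1 - A * (G * B) = (1 - A * (B * G₂)) -
      A * (G * B * (1 - A * (B * G₂)) - (1 - G * B * A) * (B * G₂)) := by noncomm_ring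
  rw [e, opCoeff_sub]
  refine hr.sub (isSmoothing_opCoeff_mul_right hA.rapidDecay (hW.slow 0) ?_)
  rw [opCoeff_sub]
  exact (isSmoothing_opCoeff_mul_right hQ.rapidDecay (hW.slow 0) hr).sub
    (isSmoothing_opCoeff_mul_left hQ₂.rapidDecay (hW.slow 0) hl)

end SymbolicOperators

/-! ### Elliptic symbols -/

section Elliptic

variable {n : ℕ} {μ₀ μ₁ μ ρ : ℝ} {Λ : (Fin n → ℤ) → ℝ}
  {σ : (Fin n → ℤ) → UnitAddTorus (Fin n) → ℂ}

theorem IsWeight.exists_weightGain_pow_le (hΛ : IsWeight μ₀ μ₁ μ Λ) (hρ : 0 < ρ) (M : ℕ) :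
    ∃ (N : ℕ) (C : ℝ), 0 ≤ C ∧ ∀ k, weightGain ρ Λ k ^ N ≤ C * (bracket k ^ M)⁻¹ := by
  obtain ⟨t, C, ht, hC, hb⟩ := hΛ.rpow_neg_le M
  obtain ⟨c, hc, hlow⟩ := hΛ.exists_lower_const
  obtain ⟨N, hN⟩ := exists_nat_ge (t / ρ)
  rw [div_le_iff₀ hρ] at hN
  refine ⟨N, c ^ (t - N * ρ) * C, by positivity, fun k => ?_⟩
  have hk := hΛ.apply_pos k
  have h1 : Λ k ^ (t - N * ρ) ≤ c ^ (t - N * ρ) :=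
    Real.rpow_le_rpow_of_nonpos hc (hlow k) (by linarith)
  calc weightGain ρ Λ k ^ N = Λ k ^ (t - N * ρ) * Λ k ^ (-t) := by
        rw [← rpow_zero_sub hΛ.slowlyVarying, ← Real.rpow_add hk]
        congr 1
        ring
    _ ≤ c ^ (t - N * ρ) * (C * (bracket k ^ M)⁻¹) :=
        mul_le_mul h1 (hb k) (Real.rpow_pos_of_pos hk _).le (by positivity)
    _ = _ := by ring

theorem IsWeight.exists_weightGain_le_of_lt (hΛ : IsWeight μ₀ μ₁ μ Λ) (hρ : 0 < ρ) {ε : ℝ}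
    (hε : 0 < ε) : ∃ L : ℝ, ∀ k, L < bracket k → weightGain ρ Λ k ≤ ε := by
  obtain ⟨N, C, hC, hb⟩ := hΛ.exists_weightGain_pow_le hρ 1
  refine ⟨C / ε ^ N, fun k hk => le_of_lt ?_⟩
  rw [div_lt_iff₀ (by positivity)] at hk
  have hk0 := bracket_pos k
  refine lt_of_pow_lt_pow_left₀ N hε.le ((hb k).trans_lt ?_)
  rwa [pow_one, ← div_eq_mul_inv, div_lt_iff₀ hk0, mul_comm]

/-- The symbol `σ` for `|k| ≥ R`, and `1` for `|k| < R`. -/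
def modifiedSymbol (R : ℝ) (σ : (Fin n → ℤ) → UnitAddTorus (Fin n) → ℂ) (k : Fin n → ℤ)
    (x : UnitAddTorus (Fin n)) : ℂ :=
  if R ≤ latticeNorm k then σ k x else 1

theorem smooth_modifiedSymbol (hσ : ∀ k, SmoothOnTorus (σ k)) (R : ℝ) (k : Fin n → ℤ) :
    SmoothOnTorus (modifiedSymbol R σ k) := by
  unfold modifiedSymbol
  split_ifs
  · exact hσ k
  · exact smoothOnTorus_const 1

theorem symbolCoeff_modifiedSymbol (R : ℝ) (k : Fin n → ℤ) : symbolCoeff (modifiedSymbol R σ) k =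
    if R ≤ latticeNorm k then symbolCoeff σ k else deltaCoeff k := by
  unfold symbolCoeff modifiedSymbol
  split_ifs
  · rfl
  · ext p
    exact torusCoeff_one p

/-- The two symbols agree outside a ball, and coefficients vanishing for large k are smoothing. -/
theorem isSmoothing_sub_modifiedSymbol (h : RapidDecay (fun _ => 1) (symbolCoeff σ)) (R : ℝ) :
    IsSmoothing (symbolCoeff σ - symbolCoeff (modifiedSymbol R σ)) := by
  have hδ : RapidDecay (fun _ => 1) (symbolCoeff (modifiedSymbol R σ)) := fun N => by
    obtain ⟨C, hC, hb⟩ := h N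
    obtain ⟨D, hD, hb'⟩ := rapidDecay_deltaCoeff (n := n) N
    refine ⟨C + D, by positivity, fun k p => ?_⟩
    rw [symbolCoeff_modifiedSymbol]
    split_ifs
    · linarith [hb k p]
    · linarith [hb' k p]
  refine isSmoothing_of_support (B := (n + 1) * (1 + R)) (h.sub hδ) fun k hk => ?_
  have h1 : R ≤ latticeNorm k := by
    by_contra! hlt
    have h2 := bracket_le_latticeNorm k
    have h3 : ((n : ℝ) + 1) * (1 + latticeNorm k) ≤ (n + 1) * (1 + R) :=
      mul_le_mul_of_nonneg_left (by linarith) (by positivity)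
    linarith
  rw [Pi.sub_apply, symbolCoeff_modifiedSymbol, if_pos h1, sub_self]

theorem uniformBound_of_rapidDecay (hσ : ∀ k, SmoothOnTorus (σ k))
    (h : RapidDecay (fun _ => 1) (symbolCoeff σ)) (j : Fin n) (s : ℕ) : UniformBound j s σ := by
  intro N _
  obtain ⟨C, hC, hb⟩ := h (N + 2 * n)
  refine ⟨C * bracketSum n, fun k x => ?_⟩
  have hr : IsRapid (torusCoeff (σ k)) := h.isRapid k
  rw [← torusSeries_torusCoeff (hσ k) hr, torusD_iterate_torusSeries hr]
  refine norm_torusSeries_le (fun p => ?_) x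
  have hp := bracket_pos p
  have h1 := hb k p
  rw [mul_one] at h1
  refine le_trans ?_ h1
  rw [norm_mul, norm_pow, Complex.norm_intCast]
  calc _ ≤ bracket p ^ N * ‖torusCoeff (σ k) p‖ * bracket p ^ (2 * n) := by
        refine mul_le_mul_of_nonneg_right (mul_le_mul_of_nonneg_right ?_ (norm_nonneg _))
          (by positivity)
        exact pow_le_pow_left₀ (abs_nonneg _) (by linarith [abs_le_bracket p j]) N
    _ = ‖torusCoeff (σ k) p‖ * bracket p ^ (N + 2 * n) := by ring

theorem symbolCoeff_mul {τ : (Fin n → ℤ) → UnitAddTorus (Fin n) → ℂ}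
    (hσ : ∀ k, SmoothOnTorus (σ k)) (hτ : ∀ k, SmoothOnTorus (τ k))
    (h : ∀ k, IsRapid (symbolCoeff σ k)) :
    symbolCoeff (fun k x => σ k x * τ k x) = coefMul 0 (symbolCoeff σ) (symbolCoeff τ) :=
  torusCoeff_mul hσ hτ h

/-! ### Reciprocals of symbols bounded away from zero. -/

section Inverse

variable {W : (Fin n → ℕ) → (Fin n → ℤ) → ℝ} {c : ℝ}

/-- Rapid decay of coefficients is equivalent to uniform bounds on derivatives; the reciprocal is
taken on the side of functions. -/
theorem rapidDecay_symbolCoeff_inv (hσ : ∀ k, SmoothOnTorus (σ k)) (hc : 0 < c)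
    (hcσ : ∀ k x, c ≤ ‖σ k x‖) (h : RapidDecay (fun _ => 1) (symbolCoeff σ)) :
    RapidDecay (fun _ => 1) (symbolCoeff fun k x => (σ k x)⁻¹) := by
  have h0 : ∀ k x, σ k x ≠ 0 := fun k x => norm_pos_iff.1 (hc.trans_le (hcσ k x))
  refine rapidDecay_torusCoeff_of_uniformBound (fun k => (hσ k).inv (h0 k)) ⟨c⁻¹, fun k x => ?_⟩
    fun j s => UniformBound.inv hσ (uniformBound_of_rapidDecay hσ h j) hc hcσ s
  rw [norm_inv]
  exact inv_anti₀ hc (hcσ k x)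

theorem coefMul_symbolCoeff_inv (hσ : ∀ k, SmoothOnTorus (σ k)) (h0 : ∀ k x, σ k x ≠ 0)
    (h : ∀ k, IsRapid (symbolCoeff σ k)) :
    coefMul 0 (symbolCoeff σ) (symbolCoeff fun k x => (σ k x)⁻¹) = deltaCoeff := by
  rw [← symbolCoeff_mul hσ (fun k => (hσ k).inv (h0 k)) h]
  ext k p
  rw [symbolCoeff]
  simp only [mul_inv_cancel₀ (h0 k _)]
  exact torusCoeff_one p

theorem fwdDiff_symbolCoeff_inv (hσ : ∀ k, SmoothOnTorus (σ k)) (h0 : ∀ k x, σ k x ≠ 0)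
    (h : RapidDecay (fun _ => 1) (symbolCoeff σ))
    (h' : RapidDecay (fun _ => 1) (symbolCoeff fun k x => (σ k x)⁻¹)) (q : Fin n → ℤ) :
    fwdDiff q (symbolCoeff fun k x => (σ k x)⁻¹) =
      -coefMul 0 (coefMul 0 (fwdDiff q (symbolCoeff σ)) (symbolCoeff fun k x => (σ k x)⁻¹))
        fun k => symbolCoeff (fun k x => (σ k x)⁻¹) (k + q) := by
  have hi := fun k => (hσ k).inv (h0 k)
  have hd : ∀ k, SmoothOnTorus fun x => σ (k + q) x - σ k x := fun k => (hσ _).sub (hσ k)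
  have e1 : fwdDiff q (symbolCoeff σ) = symbolCoeff fun k x => σ (k + q) x - σ k x := by
    ext k p
    exact (torusCoeff_sub (hσ _).continuous (hσ _).continuous p).symm
  have hr1 : RapidDecay (fun _ => 1) (fwdDiff q (symbolCoeff σ)) :=
    h.fwdDiff (.const one_pos) q
  have hr2 := hr1.coefMul zero_le_one (.const one_pos) h'
  rw [e1] at hr1 hr2 ⊢
  rw [← symbolCoeff_mul hd hi hr1.isRapid] at hr2 ⊢
  have e2 : (fun k => symbolCoeff (fun k x => (σ k x)⁻¹) (k + q)) =
      symbolCoeff fun k x => (σ (k + q) x)⁻¹ := rfl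
  rw [e2, ← symbolCoeff_mul (fun k => (hd k).mul (hi k)) (fun k => hi _) hr2.isRapid]
  ext k p
  refine (torusCoeff_sub (hi _).continuous (hi _).continuous p).symm.trans ?_
  refine Eq.trans ?_ (torusCoeff_neg _ p)
  congr 1
  ext x
  have := h0 k x
  have := h0 (k + q) x
  field_simp
  ring

/-- Since Δ(1/σ) = -Δσ · σ⁻¹ · σ⁻¹(· + eⱼ), a difference of order s + 1 of the reciprocal needs only
differences of order at most s of the reciprocal, and stability under products concludes. -/
theorem diffDecay_symbolCoeff_inv (hW : IsWeightFamily W) (hW0 : W 0 = fun _ => 1)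
    (hσ : ∀ k, SmoothOnTorus (σ k)) (hc : 0 < c) (hcσ : ∀ k x, c ≤ ‖σ k x‖)
    (h : ∀ s, DiffDecay W s 0 (symbolCoeff σ)) (s : ℕ) :
    DiffDecay W s 0 (symbolCoeff fun k x => (σ k x)⁻¹) := by
  have h0 : ∀ k x, σ k x ≠ 0 := fun k x => norm_pos_iff.1 (hc.trans_le (hcσ k x))
  have h1 : RapidDecay (fun _ => 1) (symbolCoeff σ) := by
    simpa only [hW0] using (h 0).rapidDecay
  have h2 := rapidDecay_symbolCoeff_inv hσ hc hcσ h1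
  induction s with
  | zero =>
    intro α hα
    have : α = 0 := by
      ext i
      exact Finset.sum_eq_zero_iff.1 (Nat.le_zero.1 hα) i (Finset.mem_univ i)
    rw [this, latticeDiff_zero, add_zero, hW0]
    exact h2
  | succ s ih =>
    intro α hα
    by_cases hα0 : α = 0
    · rw [hα0, latticeDiff_zero, add_zero, hW0]
      exact h2
    obtain ⟨j, hj⟩ : ∃ j, α j ≠ 0 := by
      by_contra! h
      exact hα0 (funext h)
    obtain ⟨β, rfl⟩ : ∃ β : Fin n → ℕ, α = β + Pi.single j 1 := by
      refine ⟨Function.update α j (α j - 1), ?_⟩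
      ext i
      rcases eq_or_ne i j with rfl | h
      · simp; omega
      · simp [h]
    rw [order_add, order_single] at hα
    rw [latticeDiff_add_single, fwdDiff_symbolCoeff_inv hσ h0 h1 h2]
    have h3 := ((((h (s + 1)).fwdDiff j).coefMul zero_le_one hW ih).coefMul zero_le_one hW
      (ih.translate hW (Pi.single j 1))).neg β (by omega)
    rwa [add_zero, add_zero, zero_add, add_comm, ← zero_add (β + _)] at h3

theorem exists_approximateInverse (hW : IsWeightFamily W) (hW0 : W 0 = fun _ => 1)
    {g : (Fin n → ℤ) → ℝ} (hg : SlowlyVarying g)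
    (hWg : ∀ j k, W (Pi.single j 1) k ≤ g k) (hσ : ∀ k, SmoothOnTorus (σ k)) (hc : 0 < c)
    (hcσ : ∀ k x, c ≤ ‖σ k x‖) {A : EllTwo n →L[ℂ] EllTwo n} (hA : opCoeff A = symbolCoeff σ)
    (hAs : IsSymbolicOp W A) :
    ∃ B : EllTwo n →L[ℂ] EllTwo n, IsSymbolicOp W B ∧ RapidDecay g (opCoeff (1 - B * A)) ∧
      RapidDecay g (opCoeff (1 - A * B)) := by
  have h0 : ∀ k x, σ k x ≠ 0 := fun k x => norm_pos_iff.1 (hc.trans_le (hcσ k x))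
  have hs : ∀ s, DiffDecay W s 0 (symbolCoeff σ) := hA ▸ hAs
  have ht := diffDecay_symbolCoeff_inv hW hW0 hσ hc hcσ hs
  have h1 : RapidDecay (fun _ => 1) (symbolCoeff σ) := by
    simpa only [hW0] using (hs 0).rapidDecay
  have h2 := rapidDecay_symbolCoeff_inv hσ hc hcσ h1
  obtain ⟨B, hB⟩ := h2.exists_opCoeff_eq (D := 1) fun _ => le_rfl
  -- The product of the symbols is exactly 1, so the error of the operator product is the difference
  -- of the two coefficient products, which gains one first difference and hence g.
  have key : ∀ {a b : (Fin n → ℤ) → (Fin n → ℤ) → ℂ}, RapidDecay (fun _ => 1) a →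
      RapidDecay (fun _ => 1) b → (∀ s, DiffDecay W s 0 b) → coefMul 0 a b = deltaCoeff →
      RapidDecay g (deltaCoeff - coefMul 1 a b) := fun {a b} ha hb hb' hab => by
    have := (ha.coefMul_sub hg (.const one_pos) hb fun j =>
      ((hb' 1) (Pi.single j 1) (by rw [order_single])).mono one_pos.le fun k => by
        rw [zero_add, one_mul]; exact hWg j k).neg
    rw [hab, neg_sub] at this
    simpa using this
  refine ⟨B, fun s => hB ▸ ht s, ?_, ?_⟩
  · rw [opCoeff_sub, opCoeff_one, opCoeff_comp, hA, hB]
    refine key h2 h1 hs ?_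
    have := coefMul_symbolCoeff_inv (fun k => (hσ k).inv (h0 k))
      (fun k x => inv_ne_zero (h0 k x)) h2.isRapid
    simpa only [inv_inv] using this
  · rw [opCoeff_sub, opCoeff_one, opCoeff_comp, hA, hB]
    exact key h1 h2 ht (coefMul_symbolCoeff_inv hσ h0 h1.isRapid)

end Inverse

theorem IsMElliptic.exists_modifiedSymbol_bound (h : IsMElliptic Λ 0 σ) :
    ∃ R c : ℝ, 0 < c ∧ ∀ k x, c ≤ ‖modifiedSymbol R σ k x‖ := by
  obtain ⟨C, R, hC, -, hb⟩ := h
  refine ⟨R, min C 1, lt_min hC one_pos, fun k x => ?_⟩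
  unfold modifiedSymbol
  split_ifs with hk
  · exact (min_le_left _ _).trans (by simpa using hb k x hk)
  · simp

/-- Elliptic operators have parametrices in the class. -/
theorem exists_parametrix_of_isMElliptic (hΛ : IsWeight μ₀ μ₁ μ Λ) (hρ : 0 < ρ)
    (hσ : IsMSymbol ρ Λ 0 σ) (hell : IsMElliptic Λ 0 σ) {A : EllTwo n →L[ℂ] EllTwo n}
    (hA : opCoeff A = symbolCoeff σ) :
    ∃ Q : EllTwo n →L[ℂ] EllTwo n, IsSymbolicOp (symbolGain ρ Λ) Q ∧
      IsSmoothing (opCoeff (1 - Q * A)) ∧ IsSmoothing (opCoeff (1 - A * Q)) := by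
  have hW := isWeightFamily_symbolGain (ρ := ρ) hΛ.slowlyVarying
  have hg := slowlyVarying_weightGain (ρ := ρ) hΛ.slowlyVarying
  have hAs : IsSymbolicOp (symbolGain ρ Λ) A :=
    isSymbolicOp_iff.2 (hA ▸ hσ.rapidDecay_symbolGain hΛ hρ.le)
  have h1 : RapidDecay (fun _ => 1) (symbolCoeff σ) := by
    simpa only [hA, symbolGain_zero] using hAs.rapidDecay
  obtain ⟨R, c, hc, hcσ⟩ := hell.exists_modifiedSymbol_bound
  have hsm := isSmoothing_sub_modifiedSymbol h1 R
  obtain ⟨A', hA'⟩ : ∃ A' : EllTwo n →L[ℂ] EllTwo n,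
      opCoeff A' = symbolCoeff (modifiedSymbol R σ) := by
    have := h1.sub (hsm.rapidDecay (.const one_pos))
    rw [sub_sub_cancel] at this
    exact this.exists_opCoeff_eq (D := 1) fun _ => le_rfl
  have hAA' : IsSmoothing (opCoeff (A - A')) := by rwa [opCoeff_sub, hA, hA']
  have hA's : IsSymbolicOp (symbolGain ρ Λ) A' := by
    simpa using hAs.sub (isSymbolicOp_of_isSmoothing hW hAA')
  obtain ⟨B, hB, hBA, hAB⟩ := exists_approximateInverse hW symbolGain_zero hg
    symbolGain_single_le (smooth_modifiedSymbol hσ.1 R) hc hcσ hA' hA's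
  exact exists_parametrix hW symbolGain_zero hg (hΛ.exists_weightGain_pow_le hρ)
    (fun ε hε => hΛ.exists_weightGain_le_of_lt hρ hε) hAs hAA' hB hBA hAB

theorem isPseudoDiffOp_coeffSymbol {T : EllTwo n →L[ℂ] EllTwo n}
    (h : ∀ k, IsRapid (opCoeff T k)) : IsPseudoDiffOp (coeffSymbol (opCoeff T)) T :=
  (isPseudoDiffOp_iff fun k => smoothOnTorus_torusSeries (h k)).2 (symbolCoeff_coeffSymbol h).symm

theorem exists_isParametrix (hΛ : IsWeight μ₀ μ₁ μ Λ) (hρ : 0 < ρ)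
    (hσ : IsMSymbol ρ Λ 0 σ) (hell : IsMElliptic Λ 0 σ) {A : EllTwo n →L[ℂ] EllTwo n}
    (hA : opCoeff A = symbolCoeff σ) :
    ∃ (τ τ₁ τ₂ : (Fin n → ℤ) → UnitAddTorus (Fin n) → ℂ)
      (B T₁ T₂ : EllTwo n →L[ℂ] EllTwo n), IsParametrix ρ Λ A τ τ₁ τ₂ B T₁ T₂ := by
  obtain ⟨Q, hQ, hl, hr⟩ := exists_parametrix_of_isMElliptic hΛ hρ hσ hell hA
  exact ⟨_, _, _, Q, 1 - Q * A, 1 - A * Q,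
    { symbol := isMSymbol_zero_coeffSymbol hΛ hρ.le (isSymbolicOp_iff.1 hQ)
      symbol_left := fun m => hl.isMSymbol hΛ.slowlyVarying
      symbol_right := fun m => hr.isMSymbol hΛ.slowlyVarying
      op := isPseudoDiffOp_coeffSymbol hQ.rapidDecay.isRapid
      op_left := isPseudoDiffOp_coeffSymbol (hl 0).isRapid
      op_right := isPseudoDiffOp_coeffSymbol (hr 0).isRapid
      left_eq := (sub_sub_cancel _ _).symm
      right_eq := (sub_sub_cancel _ _).symm }⟩

/-- This depends only on the symbol class, so it applies to the remainders of an arbitrary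
parametrix. The trace is the sum of the diagonal coefficients a(k,0), the means of τ(k,·). -/
theorem exists_trace_of_isMSymbol (hΛ : IsWeight μ₀ μ₁ μ Λ)
    {τ : (Fin n → ℤ) → UnitAddTorus (Fin n) → ℂ} {T : EllTwo n →L[ℂ] EllTwo n}
    (hτ : ∀ m, IsMSymbol ρ Λ m τ) (hT : IsPseudoDiffOp τ T) :
    IsSchwartz τ ∧ IsTraceClass T ∧ ∃ t : ℂ, HasNuclearTrace T t ∧
      HasSum (fun k => ∫ x, τ k x ∂torusMeasure n) t := by
  have hsm := (hτ 0).1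
  have h := isSmoothing_symbolCoeff hΛ hτ
  have hc := (isPseudoDiffOp_iff hsm).1 hT
  obtain ⟨t, ht, hs⟩ := exists_hasNuclearTrace_of_isSmoothing (T := T) (hc ▸ h)
  refine ⟨isSchwartz_of_isSmoothing hsm h, isTraceClass_of_isSmoothing (hc ▸ h), t, ht, ?_⟩
  simpa only [hc, symbolCoeff, torusCoeff_zero] using hs

end Elliptic
end

end LatticePDO

/-! ### Assembly of the theorem. -/

theorem mainTheorem6 (n : ℕ) (μ₀ μ₁ μ ρ : ℝ) (Λ : (Fin n → ℤ) → ℝ) (hΛ : IsWeight μ₀ μ₁ μ Λ)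
    (hρ_pos : 0 < ρ) (hρ_le : ρ ≤ 1 / μ)
    (σ : (Fin n → ℤ) → UnitAddTorus (Fin n) → ℂ)
    (hσ : IsMSymbol ρ Λ 0 σ) (hell : IsMElliptic Λ 0 σ) :
    ∃ Tσ : EllTwo n →L[ℂ] EllTwo n, IsPseudoDiffOp σ Tσ ∧ IsFredholm Tσ ∧
      (∃ (τ τ₁ τ₂ : (Fin n → ℤ) → UnitAddTorus (Fin n) → ℂ)
        (Tτ T₁ T₂ : EllTwo n →L[ℂ] EllTwo n), IsParametrix ρ Λ Tσ τ τ₁ τ₂ Tτ T₁ T₂) ∧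
      ∀ (τ τ₁ τ₂ : (Fin n → ℤ) → UnitAddTorus (Fin n) → ℂ)
        (Tτ T₁ T₂ : EllTwo n →L[ℂ] EllTwo n), IsParametrix ρ Λ Tσ τ τ₁ τ₂ Tτ T₁ T₂ →
        IsSchwartz τ₁ ∧ IsSchwartz τ₂ ∧ IsTraceClass T₁ ∧ IsTraceClass T₂ ∧
        ∃ t₁ t₂ : ℂ, HasTrace T₁ t₁ ∧ HasTrace T₂ t₂ ∧
          HasSum (fun k => ∫ x, τ₁ k x ∂torusMeasure n) t₁ ∧
          HasSum (fun k => ∫ x, τ₂ k x ∂torusMeasure n) t₂ ∧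
          (fredholmIndex Tσ : ℂ) = t₁ - t₂ ∧
          HasSum (fun k => ∫ x, (τ₁ k x - τ₂ k x) ∂torusMeasure n) (fredholmIndex Tσ : ℂ) := by
  have h1 : RapidDecay (fun _ => 1) (symbolCoeff σ) := by
    simpa only [latticeDiff_zero, symbolGain_zero] using
      hσ.rapidDecay_symbolGain hΛ hρ_pos.le 0
  obtain ⟨A, hA⟩ := h1.exists_opCoeff_eq (D := 1) fun _ => le_rfl
  have hex := exists_isParametrix hΛ hρ_pos hσ hell hA
  refine ⟨A, (isPseudoDiffOp_iff hσ.1).2 hA, ?_, hex, ?_⟩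
  -- One parametrix suffices for the Fredholm property; its remainders are nuclear.
  · obtain ⟨τ, τ₁, τ₂, B, T₁, T₂, h⟩ := hex
    obtain ⟨-, -, t₁, ht₁, -⟩ := exists_trace_of_isMSymbol hΛ h.symbol_left h.op_left
    obtain ⟨-, -, t₂, ht₂, -⟩ := exists_trace_of_isMSymbol hΛ h.symbol_right h.op_right
    exact isFredholm_of_mathlib (isFredholm_of_nuclear ht₁ ht₂ h.left_eq h.right_eq)
  · intro τ τ₁ τ₂ B T₁ T₂ h
    obtain ⟨hS₁, hT₁, t₁, ht₁, hs₁⟩ := exists_trace_of_isMSymbol hΛ h.symbol_left h.op_left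
    obtain ⟨hS₂, hT₂, t₂, ht₂, hs₂⟩ := exists_trace_of_isMSymbol hΛ h.symbol_right h.op_right
    have hind := fredholmIndex_eq_of_nuclear ht₁ ht₂ h.left_eq h.right_eq
    refine ⟨hS₁, hS₂, hT₁, hT₂, t₁, t₂, ht₁.hasTrace, ht₂.hasTrace, hs₁, hs₂, hind, ?_⟩
    rw [hind]
    convert! hs₁.sub hs₂ using 2 with k
    exact MeasureTheory.integral_sub (((h.symbol_left 0).1 k).integrable) (((h.symbol_right 0).1 k).integrable)
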